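/- Let $\mathbb{W}=W(\mathbb{F}_4)$ and let $\mathcal{C}: y^2-y=x^3$ over $\mathbb{F}_4$, with universal deformation $\mathcal{C}_U: y^2+3u_1xy+(u_1^3-1)y=x^3$ over $\mathbb{W}[[u_1]]$. Let $(E_{\mathcal{C}})_*=\mathbb{W}[[u_1]][u^{\pm1}]$ with $|u_1|=0$, $|u|=-2$, and $(E_{\mathcal{C}})_*V(0)=(E_{\mathcal{C}})_*/2$. Every $\gamma\in G_{24}=\mathrm{Aut}(\mathcal{C})$ has a unique lift to a pair $(\varphi_\gamma,f_\gamma)$, where $\varphi_\gamma$ is a $\mathbb{W}$-algebra automorphism of $\mathbb{W}[[u_1]]$ and $f_\gamma=(l,r,s,t)$, $l\in\mathbb{W}[[u_1]]^\times$, is a change of Weierstrass coordinates carrying $(\varphi_\gamma)_*\mathcal{C}_U$ to $\mathcal{C}_U$; that is, reducing $f_\gamma$ to $\mathbb{F}_4$ is a bijection from the group of all such pairs onto $\mathrm{Aut}(\mathcal{C})$. The group $G_{24}$ acts on $(E_{\mathcal{C}})_*$ by $\varphi_\gamma$ on $\mathbb{W}[[u_1]]$ and $u\mapsto l\,u$.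 The subgroup $C_2=\{\pm1\}$ is central and acts trivially on $(E_{\mathcal{C}})_*V(0)$, so $A_4\cong G_{24}/C_2$ acts on it. Let $$\varphi: H^*(A_4,(E_{\mathcal{C}})_*V(0))\to H^*(G_{24},(E_{\mathcal{C}})_*V(0))$$ be the map induced by the projection $G_{24}\to G_{24}/C_2$. Let $v_1=u_1u^{-1}\in H^{0}(G_{24},(E_{\mathcal{C}})_2V(0))$, let $\Delta=27(u_1^3-1)^3u^{-12}\in H^0(G_{24},(E_{\mathcal{C}})_{24})$, and let $h_1\in H^1(G_{24},(E_{\mathcal{C}})_2V(0))$ be the mod $2$ reduction of the image of $v_1$ under the connecting map of $0\to (E_{\mathcal{C}})_*\xrightarrow{2}(E_{\mathcal{C}})_*\to(E_{\mathcal{C}})_*V(0)\to0$. Then: 1. The composite of $\varphi$ with the projection onto $H^*(G_{24},(E_{\mathcal{C}})_*V(0))/(h_1)$ is surjective in cohomological degrees $\le 3$. 2. $\varphi$ is an isomorphism $H^0(A_4,(E_{\mathcal{C}})_*V(0))\cong H^0(G_{24},(E_{\mathcal{C}})_*V(0))$. 3. The $\mathbb{F}_4$-vector spaces of classes killed by $v_1$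 in $H^1(G_{24},(E_{\mathcal{C}})_4V(0))$, of classes killed by $v_1^2$ in $H^1(G_{24},(E_{\mathcal{C}})_8V(0))$, and of classes killed by $v_1$ in $H^1(G_{24},(E_{\mathcal{C}})_{16}V(0))$ are one-dimensional. If $h_2$, $x$, $y$ are generators of them, respectively, then for every $m\in\mathbb{Z}$ the classes $\Delta^m c$ with $$c\in\{h_2,\ h_2^2,\ h_2^3,\ x,\ v_1x,\ x^2,\ v_1x^2,\ y,\ h_2y,\ h_2^2y\}$$ lie in the image of $\varphi$ in $H^*(G_{24},(E_{\mathcal{C}})_*V(0))$ (hence also modulo $(h_1)$). -/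

import Mathlib

open CategoryTheory

noncomputable section

namespace EllCohomology

section Cohomology

variable {k G A : Type} [CommRing k] [Group G] [CommRing A] [Algebra k A]

/-- An action of a group `G` on an algebra `A` by algebra endomorphisms, as a linear representation. -/
def algAction (ρ : G →* (A →ₐ[k] A)) : Representation k G A where
  toFun g := (ρ g).toLinearMap
  map_one' := by ext; simp
  map_mul' g h := by ext; simp

abbrev algRep (ρ : G →* (A →ₐ[k] A)) : Rep.{0} k G := Rep.of (algAction ρ)

/-- The group cohomology `Hⁿ(G; A)` of a group acting on an algebra `A`. -/
abbrev HH (ρ : G →* (A →ₐ[k] A)) (n : ℕ) : ModuleCat k := groupCohomology (algRep ρ) n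

/-- Multiplication by an invariant element `m` of `A` on `Hⁿ(G; A)`. -/
def mulMap (ρ : G →* (A →ₐ[k] A)) (m : A) (hm : ∀ g, ρ g m = m) (n : ℕ) :
    HH ρ n →ₗ[k] HH ρ n :=
  (groupCohomology.map (MonoidHom.id G)
    (Rep.ofHom (LinearMap.intertwiningMap_of_isIntertwiningMap (ρ := (algRep ρ).ρ)
      (σ := (algRep ρ).ρ) (LinearMap.mulLeft k m) (fun g v => by
        change m * ρ g v = ρ g (m * v)
        rw [map_mul, hm]))) n).hom

/-- The class in `H⁰(G; A)` of an invariant element. -/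
def invClass (ρ : G →* (A →ₐ[k] A)) (m : A) (hm : ∀ g, ρ g m = m) : HH ρ 0 :=
  (groupCohomology.H0Iso (algRep ρ)).inv ⟨m, hm⟩

/-- Cup product with a 1-cochain: `(α ∪ f)(g₀, …, gₙ) = α(g₀) · g₀ f(g₁, …, gₙ)`. -/
def cupCochain (ρ : G →* (A →ₐ[k] A)) {n : ℕ} (α : (Fin 1 → G) → A) (f : (Fin n → G) → A) :
    (Fin (n + 1) → G) → A :=
  fun g => α (fun _ => g 0) * ρ (g 0) (f (Fin.tail g))

/-- The inhomogeneous coboundary, written out. -/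
def dCochain (ρ : G →* (A →ₐ[k] A)) {n : ℕ} (f : (Fin n → G) → A) : (Fin (n + 1) → G) → A :=
  fun g => ρ (g 0) (f (Fin.tail g)) + ∑ j : Fin (n + 1),
    (-1 : k) ^ ((j : ℕ) + 1) • f (Fin.contractNth j (· * ·) g)

theorem d_eq_dCochain (ρ : G →* (A →ₐ[k] A)) {n : ℕ} (f : (Fin n → G) → A) :
    inhomogeneousCochains.d (algRep ρ) n f = dCochain ρ f := rfl

theorem tail_contractNth {n : ℕ} (j : Fin (n + 1)) (g : Fin (n + 2) → G) :
    Fin.tail (Fin.contractNth j.succ (· * ·) g) = Fin.contractNth j (· * ·) (Fin.tail g) := by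
  ext i
  simp only [Fin.tail, Fin.contractNth, Fin.val_succ, Nat.add_lt_add_iff_right,
    Nat.add_right_cancel_iff]
  rfl

theorem cocycle_one (ρ : G →* (A →ₐ[k] A)) {α : (Fin 1 → G) → A} (hα : dCochain ρ α = 0)
    (g h : G) : α (fun _ => g * h) = ρ g (α fun _ => h) + α (fun _ => g) := by
  have := congrFun hα ![g, h]
  have e0 : Fin.contractNth (0 : Fin 2) (· * ·) ![g, h] = fun _ => g * h := by
    ext i; fin_cases i; rfl
  have e1 : Fin.contractNth (1 : Fin 2) (· * ·) ![g, h] = fun _ => g := by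
    ext i; fin_cases i; rfl
  have e2 : Fin.tail ![g, h] = fun _ => h := by
    ext i; fin_cases i; rfl
  have h3 : ρ g (α fun _ => h) + (-(α fun _ => g * h) + α fun _ => g) = 0 := by
    simpa [dCochain, Fin.sum_univ_two, e0, e1, e2] using this
  linear_combination -h3

theorem d_cupCochain (ρ : G →* (A →ₐ[k] A)) {n : ℕ} {α : (Fin 1 → G) → A}
    (hα : dCochain ρ α = 0) (f : (Fin n → G) → A) :
    dCochain ρ (cupCochain ρ α f) = - cupCochain ρ α (dCochain ρ f) := by
  funext g
  have e : ∀ j : Fin (n + 1), (cupCochain ρ α f) (Fin.contractNth j.succ (· * ·) g)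
      = α (fun _ => g 0) * ρ (g 0) (f (Fin.contractNth j (· * ·) (Fin.tail g))) := by
    intro j
    simp only [cupCochain, tail_contractNth]
    rfl
  have e0 : (cupCochain ρ α f) (Fin.contractNth 0 (· * ·) g)
      = α (fun _ => g 0 * g 1) * ρ (g 0 * g 1) (f (Fin.tail (Fin.tail g))) := rfl
  have e2 : ρ (g 0) (cupCochain ρ α f (Fin.tail g))
      = ρ (g 0) (α fun _ => g 1) * ρ (g 0 * g 1) (f (Fin.tail (Fin.tail g))) := by
    simp only [cupCochain, map_mul]
    rfl
  have e3 : cupCochain ρ α (dCochain ρ f) g = α (fun _ => g 0) *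
      (ρ (g 0 * g 1) (f (Fin.tail (Fin.tail g))) + ∑ j : Fin (n + 1),
        (-1 : k) ^ ((j : ℕ) + 1) • ρ (g 0) (f (Fin.contractNth j (· * ·) (Fin.tail g)))) := by
    simp only [cupCochain, dCochain, map_add, map_mul, map_sum, map_smul]
    rfl
  rw [Pi.neg_apply, e3, dCochain, Fin.sum_univ_succ, e0, e2, cocycle_one ρ hα]
  simp only [e, Fin.val_succ, Fin.val_zero, pow_succ (-1 : k) (_ + 1), mul_neg, mul_one, neg_smul,
    Finset.sum_neg_distrib, mul_add, Finset.mul_sum, mul_smul_comm, zero_add, pow_one, one_smul]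
  ring

theorem cup_d_zero (ρ : G →* (A →ₐ[k] A)) {n : ℕ} (m : (Fin 0 → G) → A) {f : (Fin n → G) → A}
    (hf : dCochain ρ f = 0) :
    cupCochain ρ (dCochain ρ m) f = dCochain ρ (fun g => m ![] * f g) := by
  funext g
  have h := congrFun hf g
  have e : ∀ x : Fin 0 → G, m x = m ![] := fun x => congrArg m (Subsingleton.elim _ _)
  simp only [dCochain, Pi.zero_apply] at h
  simp only [cupCochain, dCochain, map_mul, e, Fin.sum_univ_succ (n := 0), Fin.val_zero, zero_add,
    pow_one, neg_smul, one_smul, Finset.univ_eq_empty, Finset.sum_empty, add_zero]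
  simp only [← mul_smul_comm, ← Finset.mul_sum]
  linear_combination (-m ![]) * h

variable (ρ : G →* (A →ₐ[k] A))

theorem d_iCocycles {n : ℕ} (z : groupCohomology.cocycles (algRep ρ) n) :
    dCochain ρ (groupCohomology.iCocycles (algRep ρ) n z) = 0 := by
  have h : groupCohomology.iCocycles (algRep ρ) n ≫ inhomogeneousCochains.d (algRep ρ) n = 0 := by
    rw [← groupCohomology.inhomogeneousCochains.d_def]
    exact HomologicalComplex.iCycles_d _ _ _
  exact congrArg (fun φ => φ.hom z) h

theorem d_cup_cocycles {n : ℕ} (α : groupCohomology.cocycles (algRep ρ) 1)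
    (z : groupCohomology.cocycles (algRep ρ) n) :
    inhomogeneousCochains.d (algRep ρ) (n + 1)
      (cupCochain ρ (groupCohomology.iCocycles (algRep ρ) 1 α)
        (groupCohomology.iCocycles (algRep ρ) n z)) = 0 := by
  rw [d_eq_dCochain, d_cupCochain ρ (d_iCocycles ρ α), d_iCocycles ρ z]
  funext g
  simp only [cupCochain, Pi.neg_apply, Pi.zero_apply, map_zero, mul_zero, neg_zero]
  rfl

/-- The cup product of a 1-cocycle with an `n`-cocycle, as an `(n + 1)`-cocycle. -/
def cupCocycle {n : ℕ} (α : groupCohomology.cocycles (algRep ρ) 1)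
    (z : groupCohomology.cocycles (algRep ρ) n) : groupCohomology.cocycles (algRep ρ) (n + 1) :=
  groupCohomology.cocyclesMk
    (cupCochain ρ (groupCohomology.iCocycles (algRep ρ) 1 α)
      (groupCohomology.iCocycles (algRep ρ) n z)) (d_cup_cocycles ρ α z)

theorem exists_rep {n : ℕ} (c : HH ρ n) : ∃ z, groupCohomology.π (algRep ρ) n z = c :=
  groupCohomology_induction_on c fun z => ⟨z, rfl⟩

/-- The cup product `H¹(G; A) × Hⁿ(G; A) → Hⁿ⁺¹(G; A)`. It is computed on representing cocycles and
does not depend on them, see `cup_π`. -/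
def cup {n : ℕ} (a : HH ρ 1) (c : HH ρ n) : HH ρ (n + 1) :=
  groupCohomology.π (algRep ρ) (n + 1)
    (cupCocycle ρ (exists_rep ρ a).choose (exists_rep ρ c).choose)

/-- The inhomogeneous cochain underlying a cocycle. -/
abbrev coc {n : ℕ} (z : groupCohomology.cocycles (algRep ρ) n) : (Fin n → G) → A :=
  groupCohomology.iCocycles (algRep ρ) n z

theorem coc_injective {n : ℕ} {z w : groupCohomology.cocycles (algRep ρ) n}
    (h : coc ρ z = coc ρ w) : z = w :=
  (ModuleCat.mono_iff_injective (groupCohomology.iCocycles (algRep ρ) n)).1 inferInstance h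

theorem coc_toCocycles {n : ℕ} (b : (Fin n → G) → A) :
    coc ρ (groupCohomology.toCocycles (algRep ρ) n (n + 1) b) = dCochain ρ b := by
  have h : groupCohomology.toCocycles (algRep ρ) n (n + 1) ≫
      groupCohomology.iCocycles (algRep ρ) (n + 1) = inhomogeneousCochains.d (algRep ρ) n := by
    rw [← groupCohomology.inhomogeneousCochains.d_def]
    exact HomologicalComplex.toCycles_i _ _ _
  exact congrArg (fun φ => φ.hom b) h

theorem π_exact {i n : ℕ} (hi : (ComplexShape.up ℕ).prev n = i)
    (z : groupCohomology.cocycles (algRep ρ) n)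
    (h : groupCohomology.π (algRep ρ) n z = 0) :
    ∃ b, groupCohomology.toCocycles (algRep ρ) i n b = z := by
  have := ShortComplex.exact_of_g_is_cokernel
    (ShortComplex.mk _ _ ((groupCohomology.inhomogeneousCochains
      (algRep ρ)).toCycles_comp_homologyπ i n))
    ((groupCohomology.inhomogeneousCochains (algRep ρ)).homologyIsCokernel i n hi)
  exact (ShortComplex.moduleCat_exact_iff _).1 this z h

theorem π_toCocycles {n : ℕ} (b : (Fin n → G) → A) :
    groupCohomology.π (algRep ρ) (n + 1)
      (groupCohomology.toCocycles (algRep ρ) n (n + 1) b) = 0 :=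
  congrArg (fun φ => φ.hom b) ((groupCohomology.inhomogeneousCochains
      (algRep ρ)).toCycles_comp_homologyπ n (n + 1))

theorem π_eq_succ {n : ℕ} {z w : groupCohomology.cocycles (algRep ρ) (n + 1)} :
    groupCohomology.π (algRep ρ) (n + 1) z = groupCohomology.π (algRep ρ) (n + 1) w ↔
      ∃ b : (Fin n → G) → A, coc ρ z = coc ρ w + dCochain ρ b := by
  constructor
  · intro h
    obtain ⟨b, hb⟩ := π_exact ρ (i := n) (by simp) (z - w) (by rw [map_sub, h, sub_self])
    refine ⟨b, ?_⟩
    rw [← coc_toCocycles, hb]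
    change _ = _ + (groupCohomology.iCocycles (algRep ρ) (n + 1)) (z - w)
    rw [map_sub]
    exact (add_sub_cancel _ _).symm
  · rintro ⟨b, hb⟩
    have : z = w + groupCohomology.toCocycles (algRep ρ) n (n + 1) b := by
      apply coc_injective
      rw [hb, ← coc_toCocycles]
      exact (map_add (groupCohomology.iCocycles (algRep ρ) (n + 1)).hom _ _).symm
    rw [this, map_add, π_toCocycles, add_zero]

theorem π_injective_zero {z w : groupCohomology.cocycles (algRep ρ) 0}
    (h : groupCohomology.π (algRep ρ) 0 z = groupCohomology.π (algRep ρ) 0 w) : z = w := by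
  obtain ⟨b, hb⟩ := π_exact ρ (i := 0) (by simp) (z - w) (by rw [map_sub, h, sub_self])
  have h0 : groupCohomology.toCocycles (algRep ρ) 0 0 = 0 := by
    rw [← cancel_mono (groupCohomology.iCocycles (algRep ρ) 0), HomologicalComplex.toCycles_i,
      Limits.zero_comp]
    exact (groupCohomology.inhomogeneousCochains (algRep ρ)).shape 0 0 (by simp)
  rw [h0] at hb
  exact (sub_eq_zero.1 hb.symm)

theorem coc_cupCocycle {n : ℕ} (α : groupCohomology.cocycles (algRep ρ) 1)
    (z : groupCohomology.cocycles (algRep ρ) n) :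
    coc ρ (cupCocycle ρ α z) = cupCochain ρ (coc ρ α) (coc ρ z) :=
  groupCohomology.iCocycles_mk _ (d_cup_cocycles ρ α z)

theorem π_cup_congr {n : ℕ} {α β : groupCohomology.cocycles (algRep ρ) 1}
    {z w : groupCohomology.cocycles (algRep ρ) n}
    (h1 : groupCohomology.π (algRep ρ) 1 α = groupCohomology.π (algRep ρ) 1 β)
    (h2 : groupCohomology.π (algRep ρ) n z = groupCohomology.π (algRep ρ) n w) :
    groupCohomology.π (algRep ρ) (n + 1) (cupCocycle ρ α z) =
      groupCohomology.π (algRep ρ) (n + 1) (cupCocycle ρ β w) := by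
  trans groupCohomology.π (algRep ρ) (n + 1) (cupCocycle ρ β z)
  · obtain ⟨b, hb⟩ := (π_eq_succ ρ).1 h1
    refine (π_eq_succ ρ).2 ⟨fun g => b ![] * coc ρ z g, ?_⟩
    rw [coc_cupCocycle, coc_cupCocycle, ← cup_d_zero ρ b (d_iCocycles ρ z), hb]
    funext g
    simp [cupCochain, add_mul]
  · cases n with
    | zero => rw [π_injective_zero ρ h2]
    | succ n =>
      obtain ⟨b, hb⟩ := (π_eq_succ ρ).1 h2
      refine (π_eq_succ ρ).2 ⟨-cupCochain ρ (coc ρ β) b, ?_⟩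
      have h3 : dCochain ρ (-cupCochain ρ (coc ρ β) b) = -dCochain ρ (cupCochain ρ (coc ρ β) b) := by
        funext g
        simp only [dCochain, Pi.neg_apply, map_neg, smul_neg, Finset.sum_neg_distrib, neg_add]
      rw [coc_cupCocycle, coc_cupCocycle, h3, d_cupCochain ρ (d_iCocycles ρ β), neg_neg, hb]
      funext g
      simp [cupCochain, mul_add]

theorem cup_π {n : ℕ} (α : groupCohomology.cocycles (algRep ρ) 1)
    (z : groupCohomology.cocycles (algRep ρ) n) :
    cup ρ (groupCohomology.π (algRep ρ) 1 α) (groupCohomology.π (algRep ρ) n z) =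
      groupCohomology.π (algRep ρ) (n + 1) (cupCocycle ρ α z) :=
  π_cup_congr ρ (exists_rep ρ _).choose_spec (exists_rep ρ _).choose_spec

end Cohomology
end EllCohomology

namespace EllCohomology

open WeierstrassCurve LaurentPolynomial

section Deformation

variable {k R : Type} [CommRing k] [CommRing R] [Algebra k R]

/-- Automorphisms of a Weierstrass curve `U` over `R` covering a `k`-algebra automorphism `φ` of the
base `R`: pairs `(φ, f)` where the change of variables `f = (l, r, s, t)` carries `φ_* U` to `U`. -/
@[ext]
structure CurveAut (k : Type) {R : Type} [CommRing k] [CommRing R] [Algebra k R]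
    (U : WeierstrassCurve R) where
  φ : R ≃ₐ[k] R
  f : VariableChange R
  lift : f • U.map (φ : R →+* R) = U

namespace CurveAut

variable {U : WeierstrassCurve R}

theorem map_mul_eq (φ ψ : R ≃ₐ[k] R) (W : WeierstrassCurve R) :
    W.map ((φ * ψ : R ≃ₐ[k] R) : R →+* R) =
      (W.map (ψ : R →+* R)).map (φ : R →+* R) := rfl

instance : One (CurveAut k U) := ⟨⟨1, 1, one_smul _ _⟩⟩

instance : Mul (CurveAut k U) where
  mul a b := ⟨a.φ * b.φ, a.f * b.f.map (a.φ : R →+* R), by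
    rw [map_mul_eq, mul_smul, map_variableChange, b.lift, a.lift]⟩

instance : Inv (CurveAut k U) where
  inv a := ⟨a.φ⁻¹, (a.f⁻¹).map ((a.φ⁻¹ : R ≃ₐ[k] R) : R →+* R), by
    rw [map_variableChange]
    have h : a.f⁻¹ • U = U.map (a.φ : R →+* R) := by
      rw [inv_smul_eq_iff, a.lift]
    rw [h, ← map_mul_eq, inv_mul_cancel]
    rfl⟩

theorem mul_f (a b : CurveAut k U) : (a * b).f = a.f * b.f.map (a.φ : R →+* R) := rfl

instance : Group (CurveAut k U) where
  mul_assoc a b c := by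
    refine CurveAut.ext (mul_assoc _ _ _) ?_
    simp only [mul_f, mul_assoc]
    congr 1
    exact (map_mul (VariableChange.mapHom (a.φ : R →+* R)) b.f (c.f.map (b.φ : R →+* R))).symm
  one_mul a := CurveAut.ext (one_mul _) (one_mul a.f)
  mul_one a := by
    refine CurveAut.ext (mul_one _) ?_
    change a.f * VariableChange.mapHom (a.φ : R →+* R) 1 = a.f
    rw [map_one, mul_one]
  inv_mul_cancel a := by
    refine CurveAut.ext (inv_mul_cancel _) ?_
    change VariableChange.mapHom ((a.φ⁻¹ : R ≃ₐ[k] R) : R →+* R) (a.f⁻¹) *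
      VariableChange.mapHom ((a.φ⁻¹ : R ≃ₐ[k] R) : R →+* R) a.f = 1
    rw [← map_mul, inv_mul_cancel, map_one]

variable (k U) in
/-- The automorphism `[-1]` of `U`, covering the identity of the base. -/
def negOne : CurveAut k U where
  φ := 1
  f := ⟨-1, 0, -U.a₁, -U.a₃⟩
  lift := by
    change _ • U = _
    simp only [variableChange_def, inv_neg, inv_one, Units.val_neg, Units.val_one]
    ext1 <;> dsimp only <;> ring

theorem lift_a₁ (a : CurveAut k U) : a.φ U.a₁ + 2 * a.f.s = a.f.u * U.a₁ := by
  have h := congrArg WeierstrassCurve.a₁ a.lift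
  rw [variableChange_a₁] at h
  have h' : (a.f.u⁻¹ : Rˣ) * (a.φ U.a₁ + 2 * a.f.s) = U.a₁ := h
  have hu : (a.f.u : R) * (a.f.u⁻¹ : Rˣ) = 1 := Units.mul_inv _
  linear_combination (a.f.u : R) * h' - (a.φ U.a₁ + 2 * a.f.s) * hu

theorem lift_a₃ (a : CurveAut k U) :
    a.φ U.a₃ + a.f.r * a.φ U.a₁ + 2 * a.f.t = (a.f.u : R) ^ 3 * U.a₃ := by
  have h := congrArg WeierstrassCurve.a₃ a.lift
  rw [variableChange_a₃] at h
  have h' : ((a.f.u⁻¹ : Rˣ) : R) ^ 3 * (a.φ U.a₃ + a.f.r * a.φ U.a₁ + 2 * a.f.t) = U.a₃ := h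
  have hu : (a.f.u : R) * (a.f.u⁻¹ : Rˣ) = 1 := Units.mul_inv _
  have hu3 : (a.f.u : R) ^ 3 * ((a.f.u⁻¹ : Rˣ) : R) ^ 3 = 1 := by rw [← mul_pow, hu, one_pow]
  linear_combination (a.f.u : R) ^ 3 * h' -
    (a.φ U.a₃ + a.f.r * a.φ U.a₁ + 2 * a.f.t) * hu3

theorem lift_Δ (a : CurveAut k U) : a.φ U.Δ = (a.f.u : R) ^ 12 * U.Δ := by
  have h := congrArg WeierstrassCurve.Δ a.lift
  rw [variableChange_Δ, map_Δ] at h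
  have h' : ((a.f.u⁻¹ : Rˣ) : R) ^ 12 * a.φ U.Δ = U.Δ := h
  have hu : (a.f.u : R) * (a.f.u⁻¹ : Rˣ) = 1 := Units.mul_inv _
  have hu3 : (a.f.u : R) ^ 12 * ((a.f.u⁻¹ : Rˣ) : R) ^ 12 = 1 := by rw [← mul_pow, hu, one_pow]
  linear_combination (a.f.u : R) ^ 12 * h' - a.φ U.Δ * hu3

theorem commute_negOne (a : CurveAut k U) : a * negOne k U = negOne k U * a := by
  refine CurveAut.ext (mul_one a.φ) ?_
  have h1 : (a * negOne k U).f = a.f * (negOne k U).f.map (a.φ : R →+* R) := rfl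
  have h2 : (negOne k U * a).f = (negOne k U).f * a.f := rfl
  rw [h1, h2]
  have e1 := lift_a₁ a
  have e3 := lift_a₃ a
  apply VariableChange.ext
  · ext
    simp [negOne, VariableChange.mul_def, VariableChange.map]
  · simp [negOne, VariableChange.mul_def, VariableChange.map]
  · simp [negOne, VariableChange.mul_def, VariableChange.map]
    linear_combination -e1
  · simp [negOne, VariableChange.mul_def, VariableChange.map]
    linear_combination -e3

variable (k U) in
/-- The central subgroup `{±1}`. -/
def C2 : Subgroup (CurveAut k U) := Subgroup.zpowers (negOne k U)

instance : (C2 k U).Normal where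
  conj_mem n hn g := by
    obtain ⟨m, rfl⟩ := Subgroup.mem_zpowers_iff.1 hn
    have h : Commute g (negOne k U ^ m) := Commute.zpow_right (commute_negOne g) m
    rw [h.eq, mul_inv_cancel_right]
    exact hn

end CurveAut

open CurveAut

variable {U : WeierstrassCurve R}

variable (R) in
/-- The unit `u = T` of `R[u, u⁻¹]`. -/
def uUnit : (LaurentPolynomial R)ˣ :=
  ⟨T 1, T (-1), by rw [← T_add]; simp, by rw [← T_add]; simp⟩

theorem uUnit_zpow (n : ℤ) : ((uUnit R ^ n : (LaurentPolynomial R)ˣ) : LaurentPolynomial R) = T n := by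
  induction n using Int.induction_on with
  | zero => simp
  | succ n ih => rw [zpow_add_one, Units.val_mul, ih, T_add]; rfl
  | pred n ih => rw [zpow_sub_one, Units.val_mul, ih, T_sub]; rfl

/-- The endomorphism of `R[u, u⁻¹]` given by an automorphism `(φ, f)` of the curve, with
`f = (l, r, s, t)`: it is `φ` on `R` and sends `u` to `l u`. -/
def actE (γ : CurveAut k U) : LaurentPolynomial R →ₐ[k] LaurentPolynomial R :=
  AddMonoidAlgebra.liftNCAlgHom
    ((AddMonoidAlgebra.singleZeroAlgHom : R →ₐ[k] LaurentPolynomial R).comp (γ.φ : R →ₐ[k] R))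
    ((Units.coeHom (LaurentPolynomial R)).comp
      (zpowersHom (LaurentPolynomial R)ˣ
        (Units.map (C : R →+* LaurentPolynomial R).toMonoidHom γ.f.u * uUnit R)))
    (fun _ _ => Commute.all _ _)

theorem actE_C_mul_T (γ : CurveAut k U) (a : R) (n : ℤ) :
    actE γ (C a * T n) = C (γ.φ a * ((γ.f.u ^ n : Rˣ) : R)) * T n := by
  rw [← single_eq_C_mul_T]
  have : actE γ (AddMonoidAlgebra.single n a) =
      C (γ.φ a) * (((Units.map (C : R →+* LaurentPolynomial R).toMonoidHom γ.f.u * uUnit R) ^ n :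
        (LaurentPolynomial R)ˣ) : LaurentPolynomial R) := by
    rw [actE, AddMonoidAlgebra.coe_liftNCAlgHom]
    exact AddMonoidAlgebra.liftNC_single _ _ _ _
  rw [this, mul_zpow, Units.val_mul, uUnit_zpow, ← map_zpow, map_mul, mul_assoc]
  rfl

theorem algHom_ext_CT {B : Type} [CommRing B] [Algebra k B] {f g : LaurentPolynomial R →ₐ[k] B}
    (h : ∀ a n, f (C a * T n) = g (C a * T n)) : f = g := by
  apply AlgHom.ext
  intro x
  induction x using LaurentPolynomial.induction_on' with
  | add p q hp hq => rw [map_add, map_add, hp, hq]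
  | C_mul_T n a => exact h a n

variable (k U) in
/-- The action of the automorphism group on `R[u, u⁻¹]`. -/
def actionE : CurveAut k U →* (LaurentPolynomial R →ₐ[k] LaurentPolynomial R) where
  toFun := actE
  map_one' := algHom_ext_CT fun a n => by
    rw [actE_C_mul_T]
    change C (a * ((1 ^ n : Rˣ) : R)) * T n = C a * T n
    rw [one_zpow, Units.val_one, mul_one]
  map_mul' γ δ := algHom_ext_CT fun a n => by
    rw [AlgHom.mul_apply, actE_C_mul_T, actE_C_mul_T, actE_C_mul_T]
    congr 2
    change γ.φ (δ.φ a) * (((γ.f.u * Units.map (γ.φ : R →* R) δ.f.u) ^ n : Rˣ) : R) = _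
    rw [map_mul, mul_zpow, Units.val_mul, ← map_zpow, mul_assoc]
    congr 1
    rw [mul_comm]
    rfl

variable (R) in
/-- The ring `R[u, u⁻¹] / 2`. -/
abbrev ModTwo : Type := LaurentPolynomial R ⧸ (Ideal.span {2} : Ideal (LaurentPolynomial R))

variable (k R) in
/-- Reduction modulo `2`. -/
abbrev red : LaurentPolynomial R →ₐ[k] ModTwo R := Ideal.Quotient.mkₐ k (Ideal.span {2})

theorem red_eq_zero_iff {x : LaurentPolynomial R} : red k R x = 0 ↔ ∃ y, x = 2 * y := by
  rw [red, Ideal.Quotient.mkₐ_eq_mk, Ideal.Quotient.eq_zero_iff_mem, Ideal.mem_span_singleton]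
  rfl

theorem red_surjective : Function.Surjective (red k R) := Ideal.Quotient.mk_surjective

theorem span_two_le (f : LaurentPolynomial R →ₐ[k] LaurentPolynomial R) :
    (Ideal.span {2} : Ideal (LaurentPolynomial R)) ≤ (Ideal.span {2}).comap f := by
  rw [Ideal.span_le, Set.singleton_subset_iff, SetLike.mem_coe, Ideal.mem_comap, map_ofNat]
  exact Ideal.mem_span_singleton_self _

variable (k U) in
/-- The induced action on `R[u, u⁻¹] / 2`. -/
def actionModTwo : CurveAut k U →* (ModTwo R →ₐ[k] ModTwo R) where
  toFun γ := Ideal.quotientMapₐ _ (actionE k U γ) (span_two_le _)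
  map_one' := by
    apply AlgHom.ext
    intro x
    obtain ⟨x, rfl⟩ := red_surjective (k := k) x
    change red k R (actionE k U 1 x) = red k R x
    rw [map_one]; rfl
  map_mul' γ δ := by
    apply AlgHom.ext
    intro x
    obtain ⟨x, rfl⟩ := red_surjective (k := k) x
    change red k R (actionE k U (γ * δ) x) = red k R (actionE k U γ (actionE k U δ x))
    rw [map_mul]; rfl

theorem actionModTwo_red (γ : CurveAut k U) (x : LaurentPolynomial R) :
    actionModTwo k U γ (red k R x) = red k R (actionE k U γ x) := rfl

theorem actionModTwo_negOne : actionModTwo k U (negOne k U) = 1 := by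
  apply AlgHom.ext
  intro x
  obtain ⟨x, rfl⟩ := red_surjective (k := k) x
  rw [actionModTwo_red]
  change (red k R) (actE (negOne k U) x) = red k R x
  induction x using LaurentPolynomial.induction_on' with
  | add p q hp hq => rw [map_add, map_add, map_add, hp, hq]
  | C_mul_T n a =>
    rw [actE_C_mul_T, ← sub_eq_zero, ← map_sub, red_eq_zero_iff]
    change ∃ y, C (a * (((-1) ^ n : Rˣ) : R)) * T n - C a * T n = 2 * y
    rcases Int.even_or_odd n with hn | hn
    · exact ⟨0, by rw [hn.neg_one_zpow]; simp⟩
    · refine ⟨- (C a * T n), ?_⟩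
      rw [hn.neg_one_zpow, Units.val_neg, Units.val_one, mul_neg, mul_one, map_neg]
      ring

variable (k U) in
/-- As `-1` acts trivially modulo `2`, the quotient by `{±1}` acts on `R[u, u⁻¹] / 2`. -/
def actionQuot : (CurveAut k U ⧸ C2 k U) →* (ModTwo R →ₐ[k] ModTwo R) :=
  QuotientGroup.lift (C2 k U) (actionModTwo k U) (by
    rw [C2, Subgroup.zpowers_le]
    exact actionModTwo_negOne)

variable (k U) in
/-- The map on cohomology induced by the projection onto the quotient by `{±1}`. -/
def inflation (n : ℕ) : HH (actionQuot k U) n →ₗ[k] HH (actionModTwo k U) n :=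
  (groupCohomology.map (A := algRep (actionQuot k U)) (B := algRep (actionModTwo k U))
    (QuotientGroup.mk' (C2 k U))
    (Rep.ofHom (LinearMap.intertwiningMap_of_isIntertwiningMap _ _ LinearMap.id
      fun _ _ => rfl)) n).hom

theorem a₁_invariant (γ : CurveAut k U) :
    actionModTwo k U γ (red k R (C U.a₁ * T (-1))) = red k R (C U.a₁ * T (-1)) := by
  rw [actionModTwo_red]
  change red k R (actE γ _) = _
  rw [actE_C_mul_T, ← sub_eq_zero, ← map_sub, red_eq_zero_iff]
  refine ⟨C (-(γ.f.s * (γ.f.u⁻¹ : Rˣ))) * T (-1), ?_⟩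
  have h := γ.lift_a₁
  have h3 : γ.φ U.a₁ * ((γ.f.u ^ (-1 : ℤ) : Rˣ) : R) - U.a₁ = 2 * -(γ.f.s * (γ.f.u⁻¹ : Rˣ)) := by
    have hu : (γ.f.u : R) * (γ.f.u⁻¹ : Rˣ) = 1 := Units.mul_inv _
    rw [zpow_neg_one]
    linear_combination (γ.f.u⁻¹ : Rˣ) * h + U.a₁ * hu
  rw [← sub_mul, ← map_sub, h3, map_mul, map_ofNat, mul_assoc]

theorem Δ_invariant (γ : CurveAut k U) :
    actionE k U γ (C U.Δ * T (-12)) = C U.Δ * T (-12) := by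
  change actE γ _ = _
  rw [actE_C_mul_T, lift_Δ]
  congr 2
  have h : (γ.f.u : R) ^ 12 * ((γ.f.u ^ (-12 : ℤ) : Rˣ) : R) = 1 := by
    rw [← Units.val_pow_eq_pow_val, ← Units.val_mul, ← zpow_natCast, ← zpow_add]
    simp
  linear_combination U.Δ * h

variable (k U) in
/-- The sequence `0 → R[u, u⁻¹] → R[u, u⁻¹] → R[u, u⁻¹] / 2 → 0`, with first map multiplication
by `2`. -/
def bocksteinSeq : ShortComplex (Rep.{0} k (CurveAut k U)) :=
  ShortComplex.mk (X₁ := algRep (actionE k U)) (X₂ := algRep (actionE k U))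
    (X₃ := algRep (actionModTwo k U))
    (Rep.ofHom (LinearMap.intertwiningMap_of_isIntertwiningMap (algAction (actionE k U))
      (algAction (actionE k U)) (LinearMap.mulLeft k 2) (fun g v => by
        change 2 * actionE k U g v = actionE k U g (2 * v)
        rw [map_mul, map_ofNat])))
    (Rep.ofHom (LinearMap.intertwiningMap_of_isIntertwiningMap (algAction (actionE k U))
      (algAction (actionModTwo k U)) (red k R).toLinearMap (fun _ _ => rfl)))
    (by
      refine ConcreteCategory.hom_ext _ _ fun (x : LaurentPolynomial R) => ?_
      change red k R (2 * x) = 0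
      exact red_eq_zero_iff.2 ⟨x, rfl⟩)

theorem bocksteinSeq_shortExact (h2 : ∀ r : R, 2 * r = 0 → r = 0) :
    (bocksteinSeq k U).ShortExact where
  exact := by
    rw [← (bocksteinSeq k U).exact_map_iff_of_faithful (forget₂ (Rep.{0} k _) (ModuleCat.{0} k)),
      ShortComplex.moduleCat_exact_iff]
    intro x hx
    obtain ⟨y, hy⟩ := red_eq_zero_iff.1 (show red k R x = 0 from hx)
    exact ⟨y, hy.symm⟩
  mono_f := by
    rw [Rep.mono_iff_injective]
    intro (x : LaurentPolynomial R) (y : LaurentPolynomial R) hxy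
    replace hxy : (2 : LaurentPolynomial R) * x = 2 * y := hxy
    have h : (C (2 : R) : LaurentPolynomial R) = 2 := map_ofNat _ _
    rw [← sub_eq_zero, ← mul_sub, ← h, ← smul_eq_C_mul] at hxy
    refine sub_eq_zero.1 (?_ : x - y = 0)
    apply LaurentPolynomial.ext
    intro a
    have := congrArg (fun p => p.coeff a) hxy
    exact h2 _ (by simpa using this)
  epi_g := by
    rw [Rep.epi_iff_surjective]
    exact red_surjective (k := k)

/-- The Bockstein: the connecting map of the above sequence, followed by reduction modulo `2`. -/
def bockstein (hU : (bocksteinSeq k U).ShortExact) (n : ℕ) :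
    HH (actionModTwo k U) n →ₗ[k] HH (actionModTwo k U) (n + 1) :=
  (groupCohomology.δ hU n (n + 1) rfl ≫
    groupCohomology.map (MonoidHom.id _) (bocksteinSeq k U).g (n + 1)).hom

end Deformation

end EllCohomology

namespace EllCohomology

open WeierstrassCurve LaurentPolynomial

/-- The field with four elements. -/
abbrev F4 : Type := GaloisField 2 2

/-- The ring `𝕎` of 2-typical Witt vectors of `𝔽₄`. -/
abbrev W4 : Type := WittVector 2 F4

/-- The ring `(E_C)_0 = 𝕎[[u₁]]`. -/
abbrev E0 : Type := PowerSeries W4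

/-- The reduction `𝕎[[u₁]] → 𝔽₄` to the residue field. -/
def residue : E0 →+* F4 := (WittVector.constantCoeff (p := 2)).comp PowerSeries.constantCoeff

/-- The supersingular curve `C : y² - y = x³` over `𝔽₄`. -/
def curveC : WeierstrassCurve F4 := ⟨0, 0, -1, 0, 0⟩

/-- The automorphism group of `C`. -/
abbrev AutC : Subgroup (VariableChange F4) := MulAction.stabilizer (VariableChange F4) curveC

/-- The universal deformation `C_U : y² + 3u₁xy + (u₁³ - 1)y = x³` of `C`. -/
def curveCU : WeierstrassCurve E0 :=
  ⟨3 * PowerSeries.X, 0, PowerSeries.X ^ 3 - 1, 0, 0⟩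

/-- The group `G₂₄ = Aut(C)`, as the group of the lifts of the automorphisms of `C` to `C_U`. -/
abbrev G24 : Type := CurveAut W4 curveCU

/-- The quotient `G₂₄ / C₂`, isomorphic to `A₄`. -/
abbrev A4 : Type := G24 ⧸ CurveAut.C2 W4 curveCU

/-- The ring `(E_C)_* = 𝕎[[u₁]][u, u⁻¹]`, where `u` has degree `-2`. -/
abbrev Estar : Type := LaurentPolynomial E0

/-- The coefficients `(E_C)_* V(0) = (E_C)_* / 2`. -/
abbrev EV0 : Type := ModTwo E0

/-- `Hⁿ(G₂₄; (E_C)_* V(0))`. -/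
abbrev HG24 (n : ℕ) : ModuleCat W4 := HH (actionModTwo W4 curveCU) n

/-- `Hⁿ(A₄; (E_C)_* V(0))`. -/
abbrev HA4 (n : ℕ) : ModuleCat W4 := HH (actionQuot W4 curveCU) n

/-- The map `Hⁿ(A₄; (E_C)_* V(0)) → Hⁿ(G₂₄; (E_C)_* V(0))` induced by the projection. -/
abbrev phi (n : ℕ) : HA4 n →ₗ[W4] HG24 n := inflation W4 curveCU n

/-- The invariant element `v₁ = u₁ u⁻¹`. -/
def v1 : EV0 := red W4 E0 (C PowerSeries.X * T (-1))

theorem v1_eq : v1 = red W4 E0 (C curveCU.a₁ * T (-1)) := by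
  rw [v1, eq_comm, ← sub_eq_zero, ← map_sub, red_eq_zero_iff]
  refine ⟨C PowerSeries.X * T (-1), ?_⟩
  have h : (C curveCU.a₁ : Estar) = 3 * C PowerSeries.X := by
    rw [curveCU, map_mul, map_ofNat]
  rw [h]
  ring

theorem v1_invariant (γ : G24) : actionModTwo W4 curveCU γ v1 = v1 := by
  rw [v1_eq]
  exact a₁_invariant γ

theorem two_regular (r : E0) (h : 2 * r = 0) : r = 0 := by
  have h2 : (2 : W4) ≠ 0 := by
    have := WittVector.p_nonzero 2 F4
    exact_mod_cast this
  ext1 n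
  have h3 := congrArg (PowerSeries.coeff n) h
  have h4 : (2 : E0) = PowerSeries.C (2 : W4) := (map_ofNat _ _).symm
  rw [h4, PowerSeries.coeff_C_mul, map_zero] at h3
  rw [map_zero]
  exact (mul_eq_zero.1 h3).resolve_left h2

theorem bocksteinSeq_exact : (bocksteinSeq W4 curveCU).ShortExact :=
  bocksteinSeq_shortExact two_regular

/-- The class `h₁`, the Bockstein of `v₁`. -/
def h1 : HG24 1 :=
  bockstein bocksteinSeq_exact 0 (invClass (actionModTwo W4 curveCU) v1 v1_invariant)

/-- The degree `n` part of the ideal `(h₁)` of the graded ring `H^*(G₂₄; (E_C)_* V(0))`. -/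
def h1Ideal : (n : ℕ) → Submodule W4 (HG24 n)
  | 0 => ⊥
  | n + 1 => Submodule.span W4 (Set.range fun c : HG24 n => cup (actionModTwo W4 curveCU) h1 c)

theorem isUnit_Δ : IsUnit curveCU.Δ := by
  have h1 : curveCU.Δ = 27 * (PowerSeries.X ^ 3 - 1) ^ 3 := by
    simp only [curveCU, WeierstrassCurve.Δ, WeierstrassCurve.b₂, WeierstrassCurve.b₄,
      WeierstrassCurve.b₆, WeierstrassCurve.b₈]
    ring
  rw [h1, PowerSeries.isUnit_iff_constantCoeff]
  apply WittVector.isUnit_of_coeff_zero_ne_zero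
  change residue (27 * (PowerSeries.X ^ 3 - 1) ^ 3) ≠ 0
  have h2 : residue PowerSeries.X = 0 := by simp [residue]
  have h3 : (2 : F4) = 0 := CharTwo.two_eq_zero
  have h4 : (27 : F4) = 1 := by linear_combination 13 * h3
  rw [map_mul, map_pow, map_sub, map_pow, h2, map_ofNat, map_one, h4]
  simp

/-- The invariant unit `Δ = Δ(C_U) u⁻¹² = 27 (u₁³ - 1)³ u⁻¹²`. -/
def DeltaUnit : Estarˣ :=
  Units.map (C : E0 →+* Estar).toMonoidHom isUnit_Δ.unit * uUnit E0 ^ (-12 : ℤ)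

theorem coe_DeltaUnit : (DeltaUnit : Estar) = C curveCU.Δ * T (-12) := by
  rw [DeltaUnit, Units.val_mul, uUnit_zpow]
  rfl

/-- The reduction of `Δ` modulo `2`. -/
def Delta : EV0ˣ := Units.map (red W4 E0).toRingHom.toMonoidHom DeltaUnit

theorem Delta_invariant (γ : G24) : actionModTwo W4 curveCU γ (Delta : EV0) = Delta := by
  change red W4 E0 (actionE W4 curveCU γ (DeltaUnit : Estar)) = red W4 E0 (DeltaUnit : Estar)
  rw [coe_DeltaUnit, Δ_invariant]

theorem Delta_zpow_invariant (m : ℤ) (γ : G24) :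
    actionModTwo W4 curveCU γ ((Delta ^ m : EV0ˣ) : EV0) = ((Delta ^ m : EV0ˣ) : EV0) := by
  have h : Units.map (actionModTwo W4 curveCU γ).toRingHom.toMonoidHom Delta = Delta :=
    Units.ext (Delta_invariant γ)
  have h2 : Units.map (actionModTwo W4 curveCU γ).toRingHom.toMonoidHom (Delta ^ m) = Delta ^ m := by
    rw [map_zpow, h]
  exact congrArg Units.val h2

/-- Multiplication by `v₁`. -/
def v1Mul (n : ℕ) : HG24 n →ₗ[W4] HG24 n :=
  mulMap (actionModTwo W4 curveCU) v1 v1_invariant n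

/-- Multiplication by `Δᵐ`. -/
def DeltaMul (m : ℤ) (n : ℕ) : HG24 n →ₗ[W4] HG24 n :=
  mulMap (actionModTwo W4 curveCU) ((Delta ^ m : EV0ˣ) : EV0) (Delta_zpow_invariant m) n

/-- The product with a class of degree `1` in `H^*(G₂₄; (E_C)_* V(0))`. -/
abbrev cupG {n : ℕ} (a : HG24 1) (c : HG24 n) : HG24 (n + 1) := cup (actionModTwo W4 curveCU) a c

/-- The part of `(E_C)_* V(0)` of internal degree `t`. -/
def gradedPiece (t : ℤ) : Submodule W4 EV0 :=
  Submodule.span W4 {m | ∃ (a : E0) (l : ℤ), -2 * l = t ∧ m = red W4 E0 (C a * T l)}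

/-- A class of internal degree `t`: one that has a cocycle with values of internal degree `t`. -/
def HasInternalDegree (t : ℤ) {n : ℕ} (c : HG24 n) : Prop :=
  ∃ z : groupCohomology.cocycles (algRep (actionModTwo W4 curveCU)) n,
    groupCohomology.π _ n z = c ∧ ∀ g, coc (actionModTwo W4 curveCU) z g ∈ gradedPiece t

/-- `c` generates the (one-dimensional) `𝔽₄`-vector space of the classes in
`H¹(G₂₄; (E_C)_* V(0))` of internal degree `t` that are annihilated by `v₁ᵉ`. -/
def IsTorsionGenerator (t : ℤ) (e : ℕ) (c : HG24 1) : Prop :=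
  c ≠ 0 ∧ ∀ c' : HG24 1,
    (HasInternalDegree t c' ∧ (v1Mul 1 ^ e) c' = 0) ↔ ∃ w : W4, c' = w • c

end EllCohomology

end

open EllCohomology

open CategoryTheory
noncomputable section
namespace EllCohomology

open WeierstrassCurve LaurentPolynomial

/-! ### The ring `𝕎[[u₁]]` and its automorphisms -/

/-! After inverting `v₁`, the ring `(E_C)_* V(0)` becomes `𝔽₄((u₁))[v₁, v₁⁻¹]`. Its component of
internal degree `2t` is then the space `Mt t` of Laurent series with a pole of order at most `t`,
and multiplication by `v₁` is the inclusion of `Mt t` in `Mt (t + 1)`. In terms of `z = u₁⁻¹` the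
group acts by affine maps `z ↦ l⁻¹(z + σ)` with `l, σ ∈ 𝔽₄`, on which `-1` has no effect. The class
`h₁` is `v₁` times the class of the cocycle `h = s / (l u₁)`. The Weierstrass equations modulo `2`
give `h² + h = z³ + γ(z)³`, so `h = σ² z + τ` with `τ² + τ = σ³`. The triple `(l, σ, τ)` is a
coordinate system on `G₂₄`, and only `τ` fails to descend to `A₄`.

Multiplication by `N = z⁴ + z`, which the group only rescales, shifts `t` by `4` and twists by a
character, so `t` matters modulo `4`. For `t ≡ 3` averaging with the weights `γ(z³)`, whose sum is
`0` but whose sum against `h` is `1`, shows that in degrees one to three each cocycle is a power of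
`h` times an invariant, up to a coboundary (`cocycle_eq_hpow`). Constants lie in `Mt 3`, so the same
result computes the cohomology of the characters occurring as graded pieces: it is generated by
products of `σ` with itself and of `σ²` with itself, the mixed products vanish, and in degree three
one family suffices (`cocycle_one_eq`, `cocycle_two_eq`, `cocycle_three_eq`). The cases `t ≡ 0, 1,
2` then follow by removing leading coefficients: each one that occurs belongs to an inflated
cocycle, a multiple of `h` or a coboundary (`good_zero`, `good_one`, `good_two`). The outcome is
`cocycle_mem_Good`, which is surjectivity modulo `h₁`.

A class of degree `2t` killed by `v₁ᵉ` is the coboundary of some `m ∈ Mt (t + e)`. In the three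
cases of interest `m` can only be a multiple of `z³`, `z⁶` or `z⁹` modulo `Mt t`
(`isTorsionGenerator_of`). The coboundary of a power of `z` is inflated, and inflated classes are
stable under products and under multiplication by invariants.

The group of lifts is identified with `Aut(C)` by a rigidity argument (`eq_one_of_reduction`)
together with explicit lifts of two generators. -/

theorem residue_X : residue PowerSeries.X = 0 := by simp [residue]

theorem isUnit_of_residue_ne_zero {f : E0} (h : residue f ≠ 0) : IsUnit f :=
  PowerSeries.isUnit_iff_constantCoeff.2 (WittVector.isUnit_of_coeff_zero_ne_zero _ h)

theorem two_F4 : (2 : F4) = 0 := CharTwo.two_eq_zero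

theorem residue_two : residue 2 = 0 := by rw [map_ofNat, two_F4]

theorem residue_eq_zero_iff {f : E0} :
    residue f = 0 ↔ ∃ a b, f = 2 * a + PowerSeries.X * b := by
  constructor
  · intro h
    obtain ⟨b, hb⟩ : PowerSeries.X ∣ f - PowerSeries.C (PowerSeries.constantCoeff f) := by
      rw [PowerSeries.X_dvd_iff]; simp
    have h0 : (PowerSeries.constantCoeff f).coeff 0 = 0 := h
    obtain ⟨a, ha⟩ : (2 : W4) ∣ PowerSeries.constantCoeff f := by
      have := WittVector.mem_span_p_iff_coeff_zero_eq_zero (p := 2) (PowerSeries.constantCoeff f)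
      rw [Ideal.mem_span_singleton] at this
      exact_mod_cast this.2 h0
    refine ⟨PowerSeries.C a, b, ?_⟩
    rw [← hb, ha, map_mul, map_ofNat]
    ring
  · rintro ⟨a, b, rfl⟩
    rw [map_add, map_mul, map_mul, residue_two, residue_X]
    ring

/-- A `𝕎`-algebra endomorphism of `𝕎[[u₁]]` is determined by the image of `u₁`, if this is in the
maximal ideal. -/
theorem E0_algHom_ext {φ ψ : E0 →ₐ[W4] E0} (h : φ PowerSeries.X = ψ PowerSeries.X)
    (h0 : residue (φ PowerSeries.X) = 0) : φ = ψ := by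
  apply AlgHom.ext
  intro f
  by_contra hne
  have hu : ¬ IsUnit (φ PowerSeries.X) := fun hu => (hu.map residue).ne_zero h0
  -- A nonzero element is divisible by only finitely many powers of a nonunit. Truncation shows,
  -- however, that `φ f - ψ f` is divisible by every power of `φ(u₁)`, because the two maps agree on
  -- polynomials.
  have hfin : FiniteMultiplicity (φ PowerSeries.X) (φ f - ψ f) :=
    FiniteMultiplicity.of_not_isUnit hu (sub_ne_zero.2 hne)
  obtain ⟨n, hn⟩ := hfin
  apply hn
  obtain ⟨g, hg⟩ : PowerSeries.X ^ (n + 1) ∣ f - (PowerSeries.trunc (n + 1) f : E0) := by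
    rw [PowerSeries.X_pow_dvd_iff]
    intro m hm
    rw [map_sub, Polynomial.coeff_coe, PowerSeries.coeff_trunc, if_pos hm, sub_self]
  have hp : ∀ p : Polynomial W4, φ (p : E0) = ψ (p : E0) := by
    intro p
    have : (φ.comp (Polynomial.coeToPowerSeries.algHom W4)) =
        ψ.comp (Polynomial.coeToPowerSeries.algHom W4) := by
      apply Polynomial.algHom_ext
      simpa using h
    simpa using congrArg (fun χ => χ p) this
  rw [sub_eq_iff_eq_add.1 hg, map_add, map_add, hp, map_mul, map_mul, map_pow, map_pow, ← h]
  exact ⟨φ g - ψ g, by ring⟩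

open scoped PowerSeries.WithPiTopology in
/-- Substitution of an element of the maximal ideal for `u₁`. -/
theorem exists_subst {b : E0} (hb : residue b = 0) :
    ∃ φ : E0 →ₐ[W4] E0, φ PowerSeries.X = b := by
  -- With the `2`-adic topology on `𝕎`, both `2` and `u₁` are topologically nilpotent in `𝕎[[u₁]]`.
  -- Hence every element `2a + u₁c` of the maximal ideal can be substituted.
  let I : Ideal W4 := Ideal.span {((2 : ℕ) : W4)}
  let : WithIdeal W4 := ⟨I⟩
  have hI : IsAdic I := rfl
  have hc := hI.isAdicComplete_iff.1 inferInstance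
  have := hc.1
  have := hc.2
  have : IsLinearTopology E0 E0 := inferInstance
  have hX : PowerSeries.HasEval (PowerSeries.X : E0) := PowerSeries.HasEval.X
  have h2 : PowerSeries.HasEval (2 : E0) := by
    have h : IsTopologicallyNilpotent (2 : W4) := by
      rw [IsTopologicallyNilpotent, hI.hasBasis_nhds_zero.tendsto_right_iff]
      intro n _
      filter_upwards [Filter.eventually_ge_atTop n] with m hm
      exact Ideal.pow_le_pow_right hm (Ideal.pow_mem_pow (Ideal.mem_span_singleton_self _) m)
    have := PowerSeries.HasEval.map (φ := (PowerSeries.C : W4 →+* E0))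
      PowerSeries.WithPiTopology.continuous_C h
    rwa [map_ofNat] at this
  obtain ⟨a, c, rfl⟩ := residue_eq_zero_iff.1 hb
  have ha : PowerSeries.HasEval (2 * a + PowerSeries.X * c) :=
    PowerSeries.HasEval.add (PowerSeries.HasEval.mul_right _ h2) (PowerSeries.HasEval.mul_right _ hX)
  have : ContinuousSMul W4 E0 := by
    refine ⟨?_⟩
    have : (fun p : W4 × E0 => p.1 • p.2) = fun p => PowerSeries.C p.1 * p.2 := by
      funext p; rw [PowerSeries.smul_eq_C_mul]
    rw [this]
    exact (PowerSeries.WithPiTopology.continuous_C.comp continuous_fst).mul continuous_snd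
  refine ⟨PowerSeries.aeval ha, ?_⟩
  have := PowerSeries.aeval_coe (R := W4) ha Polynomial.X
  simpa using this

end EllCohomology
end

open CategoryTheory
noncomputable section
namespace EllCohomology

open WeierstrassCurve LaurentPolynomial

/-! ### The group `G₂₄` -/

theorem residue_C_of_X_dvd {f : E0} :
    residue f = residue (PowerSeries.C (PowerSeries.constantCoeff f)) := by
  simp [residue]

theorem residue_φ_X (φ : E0 ≃ₐ[W4] E0) : residue (φ PowerSeries.X) = 0 := by
  by_contra h
  have h1 := isUnit_of_residue_ne_zero h
  have h2 : IsUnit (PowerSeries.X : E0) := by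
    have := h1.map φ.symm
    rwa [AlgEquiv.symm_apply_apply] at this
  have h3 := h2.map residue
  rw [residue_X] at h3
  exact not_isUnit_zero h3

theorem residue_φ (φ : E0 ≃ₐ[W4] E0) (f : E0) : residue (φ f) = residue f := by
  obtain ⟨b, hb⟩ : PowerSeries.X ∣ f - PowerSeries.C (PowerSeries.constantCoeff f) := by
    rw [PowerSeries.X_dvd_iff]; simp
  have h1 : f = algebraMap W4 E0 (PowerSeries.constantCoeff f) + PowerSeries.X * b := by
    rw [← hb]; exact (add_sub_cancel _ _).symm
  have h2 : φ f = algebraMap W4 E0 (PowerSeries.constantCoeff f) + φ PowerSeries.X * φ b := by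
    conv_lhs => rw [h1]
    rw [map_add, map_mul, AlgEquiv.commutes]
  rw [h2, map_add, map_mul, residue_φ_X, zero_mul, add_zero, residue_C_of_X_dvd]
  conv_rhs => rw [residue_C_of_X_dvd]
  simp

theorem residue_comp_φ (φ : E0 ≃ₐ[W4] E0) : residue.comp (φ : E0 →+* E0) = residue :=
  RingHom.ext (residue_φ φ)

theorem residueC_U : curveCU.map residue = curveC := by
  ext <;> simp [curveCU, curveC, residue_X]

/-- Reduction of a lift to an automorphism of `C`. -/
def reduction : G24 →* VariableChange F4 where
  toFun γ := γ.f.map residue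
  map_one' := map_one (VariableChange.mapHom residue)
  map_mul' γ δ := by
    rw [CurveAut.mul_f]
    have h := map_mul (VariableChange.mapHom residue) γ.f (δ.f.map (γ.φ : E0 →+* E0))
    refine h.trans ?_
    congr 1
    change (δ.f.map (γ.φ : E0 →+* E0)).map residue = δ.f.map residue
    rw [VariableChange.map_map, residue_comp_φ]

theorem reduction_mem (γ : G24) : reduction γ ∈ AutC := by
  rw [MulAction.mem_stabilizer_iff]
  have h := congrArg (fun W => W.map residue) γ.lift
  simp only [← map_variableChange, residueC_U, WeierstrassCurve.map_map, residue_comp_φ] at h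
  exact h

/-! ### The five Weierstrass equations satisfied by a lift -/

namespace CurveAut

variable (γ : G24)

theorem φ_a₁ : γ.φ curveCU.a₁ = 3 * γ.φ PowerSeries.X := by
  change γ.φ (3 * PowerSeries.X) = _
  rw [map_mul, map_ofNat]

theorem φ_a₃ : γ.φ curveCU.a₃ = γ.φ PowerSeries.X ^ 3 - 1 := by
  change γ.φ (PowerSeries.X ^ 3 - 1) = _
  rw [map_sub, map_pow, map_one]

theorem eq_a₁ : 3 * γ.φ PowerSeries.X + 2 * γ.f.s = (γ.f.u : E0) * (3 * PowerSeries.X) := by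
  have h := γ.lift_a₁
  rwa [φ_a₁] at h

theorem eq_a₃ : γ.φ PowerSeries.X ^ 3 - 1 + γ.f.r * (3 * γ.φ PowerSeries.X) + 2 * γ.f.t =
    (γ.f.u : E0) ^ 3 * (PowerSeries.X ^ 3 - 1) := by
  have h := γ.lift_a₃
  rwa [φ_a₃, φ_a₁] at h

theorem eq_a₂ : 3 * γ.f.r = γ.f.s ^ 2 + 3 * γ.φ PowerSeries.X * γ.f.s := by
  have h := congrArg WeierstrassCurve.a₂ γ.lift
  rw [variableChange_a₂] at h
  rw [map_a₁, map_a₂, ← Units.val_pow_eq_pow_val] at h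
  replace h := (Units.mul_right_eq_zero _).1 h
  change γ.φ 0 - _ * γ.φ curveCU.a₁ + _ - _ = 0 at h
  rw [φ_a₁, map_zero] at h
  linear_combination h

theorem eq_a₄ : γ.f.s * (γ.φ PowerSeries.X ^ 3 - 1) +
    (γ.f.t + γ.f.r * γ.f.s) * (3 * γ.φ PowerSeries.X) + 2 * γ.f.s * γ.f.t = 3 * γ.f.r ^ 2 := by
  have h := congrArg WeierstrassCurve.a₄ γ.lift
  rw [variableChange_a₄] at h
  rw [map_a₁, map_a₂, map_a₃, map_a₄, ← Units.val_pow_eq_pow_val] at h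
  replace h := (Units.mul_right_eq_zero _).1 h
  change γ.φ 0 - _ * γ.φ curveCU.a₃ + 2 * _ * γ.φ 0 - _ * γ.φ curveCU.a₁ + _ - _ = 0 at h
  rw [φ_a₁, φ_a₃, map_zero] at h
  linear_combination -h

theorem eq_a₆ : γ.f.r ^ 3 = γ.f.t * (γ.φ PowerSeries.X ^ 3 - 1) + γ.f.t ^ 2 +
    γ.f.r * γ.f.t * (3 * γ.φ PowerSeries.X) := by
  have h := congrArg WeierstrassCurve.a₆ γ.lift
  rw [variableChange_a₆] at h
  rw [map_a₁, map_a₂, map_a₃, map_a₄, map_a₆, ← Units.val_pow_eq_pow_val] at h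
  replace h := (Units.mul_right_eq_zero _).1 h
  change γ.φ 0 + _ * γ.φ 0 + _ * γ.φ 0 + _ - _ * γ.φ curveCU.a₃ - _ - _ * γ.φ curveCU.a₁ = 0 at h
  rw [φ_a₁, φ_a₃, map_zero] at h
  linear_combination h

end CurveAut

theorem isUnit_three : IsUnit (3 : E0) := by
  apply isUnit_of_residue_ne_zero
  rw [map_ofNat, show (3 : F4) = 1 by linear_combination two_F4]
  exact one_ne_zero

/-- Rigidity of lifts. When `f` reduces to the identity, the equations for `a₂` and `a₄` express `r`
as a multiple of `s` and `s` as a multiple of `t`, and the one for `a₆` becomes a unit times `t`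
equal to `0`. So `r = s = t = 0` exactly, without successive approximation. The equations for `a₁`
and `a₃` then give `φ(u₁) = l u₁` and `l³ = 1`, and `l ≡ 1` forces `l = 1`. -/
theorem eq_one_of_reduction {γ : G24} (h : reduction γ = 1) : γ = 1 := by
  have hl : residue γ.f.u = 1 := congrArg (fun f => (f.u : F4)) h
  have hr : residue γ.f.r = 0 := congrArg (fun f => f.r) h
  have hs : residue γ.f.s = 0 := congrArg (fun f => f.s) h
  have ht : residue γ.f.t = 0 := congrArg (fun f => f.t) h
  have hb := residue_φ_X γ.φ
  have e1 := γ.eq_a₁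
  have e2 := γ.eq_a₂
  have e3 := γ.eq_a₃
  have e4 := γ.eq_a₄
  have e6 := γ.eq_a₆
  obtain ⟨i3, hi3⟩ := isUnit_three.exists_left_inv
  set b := γ.φ PowerSeries.X with hbdef
  set r := γ.f.r
  set s := γ.f.s
  set t := γ.f.t
  have hr' : r = s * (i3 * s + b) := by linear_combination i3 * e2 + (b * s - r) * hi3
  have hUs : IsUnit (b ^ 3 - 1 + 2 * t + 3 * r * b - 3 * r * (i3 * s + b)) := by
    apply isUnit_of_residue_ne_zero
    simp [hb, ht, hr]
  obtain ⟨j, hj⟩ := hUs.exists_left_inv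
  have hs' : s = -j * (3 * b) * t := by
    linear_combination (-s) * hj + j * e4 + 3 * j * r * hr'
  have hUt : IsUnit (b ^ 3 - 1 + t + 3 * r * b - r ^ 2 * (i3 * s + b) * (-j * (3 * b))) := by
    apply isUnit_of_residue_ne_zero
    simp [hb, ht, hr]
  have ht0 : t = 0 := by
    refine hUt.mul_right_eq_zero.1 ?_
    linear_combination -e6 + r ^ 2 * hr' + r ^ 2 * (i3 * s + b) * hs'
  have hs0 : s = 0 := by rw [hs', ht0, mul_zero]
  have hr0 : r = 0 := by rw [hr', hs0, zero_mul]
  have hbX : b = (γ.f.u : E0) * PowerSeries.X := by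
    linear_combination i3 * e1 - (b - (γ.f.u : E0) * PowerSeries.X) * hi3 - 2 * i3 * hs0
  have hl3 : (γ.f.u : E0) = 1 := by
    have hU : IsUnit ((γ.f.u : E0) ^ 2 + γ.f.u + 1) := by
      apply isUnit_of_residue_ne_zero
      rw [map_add, map_add, map_pow, hl, map_one]
      rw [show (1 ^ 2 + 1 + 1 : F4) = 1 by linear_combination two_F4]
      exact one_ne_zero
    have : ((γ.f.u : E0) ^ 2 + γ.f.u + 1) * (γ.f.u - 1) = 0 := by
      rw [hbX, hr0, ht0] at e3
      linear_combination e3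
    exact sub_eq_zero.1 (hU.mul_right_eq_zero.1 this)
  refine CurveAut.ext ?_ ?_
  · have : (γ.φ : E0 →ₐ[W4] E0) = AlgHom.id W4 E0 := by
      apply E0_algHom_ext
      · change γ.φ PowerSeries.X = PowerSeries.X
        rw [← hbdef, hbX, hl3, one_mul]
      · exact hb
    exact AlgEquiv.ext fun x => congrArg (fun φ => φ x) this
  · exact VariableChange.ext (Units.ext hl3) hr0 hs0 ht0

theorem reduction_injective : Function.Injective reduction :=
  (injective_iff_map_eq_one reduction).2 fun _ => eq_one_of_reduction

end EllCohomology
end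

open CategoryTheory
noncomputable section
namespace EllCohomology

open WeierstrassCurve LaurentPolynomial

/-! ### The field `𝔽₄` -/

instance : Fintype F4 := Fintype.ofFinite F4

theorem card_F4 : Fintype.card F4 = 4 := by
  rw [← Nat.card_eq_fintype_card, GaloisField.card 2 2 (by norm_num)]
  norm_num

theorem F4_pow_four (x : F4) : x ^ 4 = x := by
  have := FiniteField.pow_card x
  rwa [card_F4] at this

theorem F4_pow_three {x : F4} (hx : x ≠ 0) : x ^ 3 = 1 := by
  apply mul_left_cancel₀ hx
  linear_combination F4_pow_four x

theorem exists_F4_cube_root : ∃ w : F4, w ^ 2 + w + 1 = 0 := by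
  classical
  obtain ⟨w, hw⟩ : ∃ w : F4, w ∉ ({0, 1} : Finset F4) := by
    by_contra! h
    have := Finset.card_le_card (fun x _ => h x : (Finset.univ : Finset F4) ⊆ {0, 1})
    rw [Finset.card_univ, card_F4] at this
    exact absurd (this.trans Finset.card_le_two) (by norm_num)
  simp only [Finset.mem_insert, Finset.mem_singleton, not_or] at hw
  refine ⟨w, mul_left_cancel₀ (sub_ne_zero.2 hw.2) ?_⟩
  linear_combination F4_pow_three hw.1

/-- A primitive third root of unity in `𝔽₄`. -/
def ω : F4 := exists_F4_cube_root.choose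

theorem ω_sq : ω ^ 2 + ω + 1 = 0 := exists_F4_cube_root.choose_spec

theorem ω_ne_zero : ω ≠ 0 := fun h => by
  have := ω_sq
  rw [h] at this
  simp at this

theorem ω_ne_one : ω ≠ 1 := fun h => by
  have h1 := ω_sq
  rw [h] at h1
  exact one_ne_zero (α := F4) (by linear_combination h1 - two_F4)

theorem F4_cases (x : F4) : x = 0 ∨ x = 1 ∨ x = ω ∨ x = ω + 1 := by
  have h : x * ((x - 1) * ((x - ω) * (x - (ω + 1)))) = 0 := by
    linear_combination F4_pow_four x + (x ^ 2 - x) * ω_sq +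
      (-x ^ 3 * ω - x ^ 3 + x ^ 2 * ω + x ^ 2 + x - x ^ 2) * two_F4
  rcases mul_eq_zero.1 h with h | h
  · exact Or.inl h
  rcases mul_eq_zero.1 h with h | h
  · exact Or.inr (Or.inl (sub_eq_zero.1 h))
  rcases mul_eq_zero.1 h with h | h
  · exact Or.inr (Or.inr (Or.inl (sub_eq_zero.1 h)))
  · exact Or.inr (Or.inr (Or.inr (sub_eq_zero.1 h)))

/-- The Teichmüller lift of `ω`, in `𝕎[[u₁]]`. -/
def wW : W4 := WittVector.teichmuller 2 ω

theorem wW_sq : wW ^ 2 + wW + 1 = 0 := by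
  have h3 : wW ^ 3 = 1 := by rw [wW, ← map_pow, F4_pow_three ω_ne_zero, map_one]
  have h1 : wW - 1 ≠ 0 := fun h => by
    have := congrArg (WittVector.constantCoeff (p := 2)) h
    rw [map_sub, map_one, map_zero, sub_eq_zero] at this
    exact ω_ne_one ((WittVector.teichmuller_coeff_zero 2 ω).symm.trans this)
  apply mul_left_cancel₀ h1
  linear_combination h3

def wE : E0 := algebraMap W4 E0 wW

theorem wE_sq : wE ^ 2 + wE + 1 = 0 := by
  rw [wE, ← map_pow, ← map_add, ← map_one (algebraMap W4 E0), ← map_add, wW_sq, map_zero]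

theorem residue_wE : residue wE = ω := by
  change residue (PowerSeries.C wW) = ω
  simp [residue, wW]

/-! ### Generators of `G₂₄` -/

/-- An automorphism of `𝕎[[u₁]]` from two endomorphisms that are inverse to each other on `u₁`. -/
def mkAut (φ ψ : E0 →ₐ[W4] E0) (h1 : φ (ψ PowerSeries.X) = PowerSeries.X)
    (h2 : ψ (φ PowerSeries.X) = PowerSeries.X) : E0 ≃ₐ[W4] E0 :=
  AlgEquiv.ofAlgHom φ ψ
    (E0_algHom_ext (φ := φ.comp ψ) (ψ := AlgHom.id W4 E0) h1 (by
      change residue (φ (ψ PowerSeries.X)) = 0; rw [h1, residue_X]))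
    (E0_algHom_ext (φ := ψ.comp φ) (ψ := AlgHom.id W4 E0) h2 (by
      change residue (ψ (φ PowerSeries.X)) = 0; rw [h2, residue_X]))

theorem map_wE (φ : E0 →ₐ[W4] E0) : φ wE = wE := φ.commutes wW

theorem lift_of_eq (φ : E0 ≃ₐ[W4] E0) (f : VariableChange E0) {b : E0} (hb : φ PowerSeries.X = b)
    (e1 : 3 * b + 2 * f.s = (f.u : E0) * (3 * PowerSeries.X))
    (e2 : 3 * f.r = f.s ^ 2 + 3 * b * f.s)
    (e3 : b ^ 3 - 1 + f.r * (3 * b) + 2 * f.t = (f.u : E0) ^ 3 * (PowerSeries.X ^ 3 - 1))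
    (e4 : f.s * (b ^ 3 - 1) + (f.t + f.r * f.s) * (3 * b) + 2 * f.s * f.t = 3 * f.r ^ 2)
    (e6 : f.r ^ 3 = f.t * (b ^ 3 - 1) + f.t ^ 2 + f.r * f.t * (3 * b)) :
    f • curveCU.map (φ : E0 →+* E0) = curveCU := by
  have h1 : (curveCU.map (φ : E0 →+* E0)).a₁ = 3 * b := by
    change φ (3 * PowerSeries.X) = _
    rw [map_mul, map_ofNat, hb]
  have h2 : (curveCU.map (φ : E0 →+* E0)).a₂ = 0 := map_zero _
  have h3 : (curveCU.map (φ : E0 →+* E0)).a₃ = b ^ 3 - 1 := by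
    change φ (PowerSeries.X ^ 3 - 1) = _
    rw [map_sub, map_pow, map_one, hb]
  have h4 : (curveCU.map (φ : E0 →+* E0)).a₄ = 0 := map_zero _
  have h6 : (curveCU.map (φ : E0 →+* E0)).a₆ = 0 := map_zero _
  have hu : ((f.u⁻¹ : E0ˣ) : E0) * f.u = 1 := Units.inv_mul _
  have hu3 : ((f.u⁻¹ : E0ˣ) : E0) ^ 3 * (f.u : E0) ^ 3 = 1 := by rw [← mul_pow, hu, one_pow]
  rw [variableChange_def, h1, h2, h3, h4, h6]
  ext1 <;> dsimp only [curveCU]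
  · linear_combination ((f.u⁻¹ : E0ˣ) : E0) * e1 + 3 * PowerSeries.X * hu
  · linear_combination ((f.u⁻¹ : E0ˣ) : E0) ^ 2 * e2
  · linear_combination ((f.u⁻¹ : E0ˣ) : E0) ^ 3 * e3 + (PowerSeries.X ^ 3 - 1) * hu3
  · linear_combination -((f.u⁻¹ : E0ˣ) : E0) ^ 4 * e4
  · linear_combination ((f.u⁻¹ : E0ˣ) : E0) ^ 6 * e6

/-- Replacing `u₁` by `ωu₁` leaves `u₁³ - 1` unchanged and scales `a₁`, which the unit `l = ω`
compensates. -/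
theorem exists_rotation : ∃ γ : G24, γ.φ PowerSeries.X = wE * PowerSeries.X ∧
    reduction γ = ⟨Units.mk0 ω ω_ne_zero, 0, 0, 0⟩ := by
  obtain ⟨φ, hφ⟩ := exists_subst (b := wE * PowerSeries.X) (by rw [map_mul, residue_X, mul_zero])
  obtain ⟨ψ, hψ⟩ := exists_subst (b := wE ^ 2 * PowerSeries.X)
    (by rw [map_mul, residue_X, mul_zero])
  have h3 : wE * wE ^ 2 = 1 := by linear_combination (wE - 1) * wE_sq
  let u : E0ˣ := ⟨wE, wE ^ 2, h3, by rw [mul_comm, h3]⟩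
  refine ⟨⟨mkAut φ ψ ?_ ?_, ⟨u, 0, 0, 0⟩, lift_of_eq _ _ hφ ?_ ?_ ?_ ?_ ?_⟩, hφ, ?_⟩
  · rw [hψ, map_mul, map_pow, map_wE, hφ]
    linear_combination PowerSeries.X * h3
  · rw [hφ, map_mul, map_wE, hψ]
    linear_combination PowerSeries.X * h3
  · change _ = wE * _
    ring
  · ring
  · change _ = wE ^ 3 * _
    linear_combination h3
  · ring
  · ring
  · refine VariableChange.ext (Units.ext ?_) ?_ ?_ ?_
    · exact residue_wE
    · exact map_zero _
    · exact map_zero _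
    · exact map_zero _

/-- The base is moved by the Möbius involution `u₁ ↦ (u₁ + 2)/(u₁ - 1)`. The square of the
automorphism below reduces to `-1`. -/
theorem exists_order_four : ∃ γ : G24,
    γ.φ PowerSeries.X * (PowerSeries.X - 1) = PowerSeries.X + 2 ∧
    reduction γ = ⟨1, 1, 1, ω⟩ := by
  obtain ⟨v, hv⟩ : ∃ v : E0, v * (PowerSeries.X - 1) = 1 := by
    refine IsUnit.exists_left_inv (isUnit_of_residue_ne_zero ?_)
    simp [residue_X]
  have hrv : residue v = 1 := by
    have := congrArg residue hv
    rw [map_mul, map_sub, residue_X, map_one] at this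
    linear_combination -this - two_F4
  have h30 : residue 3 = 1 := by rw [map_ofNat]; linear_combination two_F4
  obtain ⟨φ, hφ⟩ := exists_subst (b := (PowerSeries.X + 2) * v) (by
    rw [map_mul, map_add, residue_X, residue_two]; ring)
  obtain ⟨i3, hi3⟩ := isUnit_three.exists_left_inv
  have hφv : φ v * (3 * v) = 1 := by
    have := congrArg φ hv
    rw [map_mul, map_sub, map_one, hφ] at this
    linear_combination this - φ v * hv
  have hinv : φ (φ PowerSeries.X) = PowerSeries.X := by
    rw [hφ, map_mul, map_add, map_ofNat, hφ]
    linear_combination PowerSeries.X * hφv - 2 * φ v * hv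
  have hw := wE_sq
  have hc : (1 + 2 * wE) * (1 + 2 * wE) = -3 := by linear_combination 4 * hw
  -- Here `1 + 2ω` is a square root of `-3`, hence a unit, and `v = (u₁ - 1)⁻¹`.
  let u : E0ˣ := ⟨(1 + 2 * wE) * v, -i3 * (1 + 2 * wE) * (PowerSeries.X - 1), by
    linear_combination (-i3 * (1 + 2 * wE) ^ 2) * hv - i3 * hc + hi3, by
    linear_combination (-i3 * (1 + 2 * wE) ^ 2) * hv - i3 * hc + hi3⟩
  have hu : (u : E0) = (1 + 2 * wE) * v := rfl
  have hX : (PowerSeries.X : E0) * v = 1 + v := by linear_combination hv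
  generalize hXX : (PowerSeries.X : E0) = X at *
  refine ⟨⟨mkAut φ φ (hXX ▸ hinv) (hXX ▸ hinv), ⟨u, -3 * (X ^ 2 + X + 1) * v ^ 2,
    3 * (wE * X - 1) * v, 3 * (1 - wE) * (X ^ 2 + X + 1) * (X - wE ^ 2) * v ^ 3⟩,
    lift_of_eq _ _ (hXX ▸ hφ) ?_ ?_ ?_ ?_ ?_⟩, ?_, ?_⟩
  · dsimp only
    rw [hu, hXX]
    ring
  · dsimp only
    grind
  · dsimp only
    rw [hu, hXX]
    grind
  · dsimp only
    grind
  · dsimp only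
    grind
  · change φ X * _ = _
    rw [hφ]
    linear_combination (X + 2) * hv
  · have hrX : residue X = 0 := hXX ▸ residue_X
    refine VariableChange.ext (Units.ext ?_) ?_ ?_ ?_
    · change residue ((1 + 2 * wE) * v) = 1
      simp only [map_mul, map_add, map_one, hrv, residue_two]
      ring
    · change residue (-3 * (X ^ 2 + X + 1) * v ^ 2) = 1
      simp only [map_mul, map_add, map_neg, map_one, map_pow, hrv, hrX, h30]
      linear_combination -two_F4
    · change residue (3 * (wE * X - 1) * v) = 1
      simp only [map_mul, map_sub, map_one, hrv, hrX, h30]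
      linear_combination -two_F4
    · change residue (3 * (1 - wE) * (X ^ 2 + X + 1) * (X - wE ^ 2) * v ^ 3) = ω
      simp only [map_mul, map_add, map_sub, map_one, map_pow, hrv, hrX, h30, residue_wE]
      linear_combination (ω - 2) * ω_sq + (1 - ω) * two_F4 + ω * two_F4

/-- These conditions leave three choices for `l`, four for `s` and then two for `t`: this is where
the order `24` comes from. -/
theorem mem_AutC_iff {f : VariableChange F4} (hf : f ∈ AutC) :
    (f.u : F4) ^ 3 = 1 ∧ f.r = f.s ^ 2 ∧ f.t ^ 2 + f.t = f.s ^ 3 := by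
  rw [MulAction.mem_stabilizer_iff] at hf
  have h2 := congrArg WeierstrassCurve.a₂ hf
  have h6 := congrArg WeierstrassCurve.a₆ hf
  rw [variableChange_a₂, ← Units.val_pow_eq_pow_val] at h2
  replace h2 := (Units.mul_right_eq_zero _).1 h2
  rw [variableChange_a₆, ← Units.val_pow_eq_pow_val] at h6
  replace h6 := (Units.mul_right_eq_zero _).1 h6
  dsimp only [curveC] at h2 h6
  have hr : f.r = f.s ^ 2 := by linear_combination h2 + (-f.r) * two_F4
  refine ⟨F4_pow_three f.u.ne_zero, hr, ?_⟩
  rw [hr] at h6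
  linear_combination -h6 + f.s ^ 2 * F4_pow_four f.s + f.t * two_F4

/-- The powers of the rotation give all scalings, and the square of the element of order four is `-1
= (1, 0, 0, 1)`. Conjugating by scalings reaches every `s ≠ 0`, and multiplying by `-1` reaches the
second value of `t`. -/
theorem closure_generators {g i : G24} (hg : reduction g = ⟨Units.mk0 ω ω_ne_zero, 0, 0, 0⟩)
    (hi : reduction i = ⟨1, 1, 1, ω⟩) {f : VariableChange F4} (hf : f ∈ AutC) :
    f ∈ (Subgroup.closure {g, i}).map reduction := by
  set R := (Subgroup.closure {g, i}).map reduction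
  have hgR : (⟨Units.mk0 ω ω_ne_zero, 0, 0, 0⟩ : VariableChange F4) ∈ R :=
    ⟨g, Subgroup.subset_closure (Set.mem_insert _ _), hg⟩
  have hiR : (⟨1, 1, 1, ω⟩ : VariableChange F4) ∈ R :=
    ⟨i, Subgroup.subset_closure (Set.mem_insert_of_mem _ rfl), hi⟩
  have hu : ∀ u : F4ˣ, (⟨u, 0, 0, 0⟩ : VariableChange F4) ∈ R := by
    intro u
    rcases F4_cases u with h | h | h | h
    · exact absurd h u.ne_zero
    · obtain rfl : u = 1 := Units.ext h
      exact R.one_mem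
    · obtain rfl : u = Units.mk0 ω ω_ne_zero := Units.ext h
      exact hgR
    · have h2 := R.mul_mem hgR hgR
      rw [VariableChange.mul_def] at h2
      convert h2 using 2
      · refine Units.ext ?_
        simp only [Units.val_mul, Units.val_mk0, h]
        linear_combination -ω_sq + (ω + 1) * two_F4
      · simp
      · simp
      · simp
  have hneg : (⟨1, 0, 0, 1⟩ : VariableChange F4) ∈ R := by
    have h2 := R.mul_mem hiR hiR
    rw [VariableChange.mul_def] at h2
    convert h2 using 2
    · simp
    · simp only [Units.val_one]; linear_combination -two_F4
    · simp only [Units.val_one]; linear_combination -two_F4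
    · simp only [Units.val_one]; linear_combination -ω * two_F4
  obtain ⟨-, hr, ht⟩ := mem_AutC_iff hf
  suffices h : (⟨1, f.r, f.s, f.t⟩ : VariableChange F4) ∈ R by
    have h2 := R.mul_mem (hu f.u) h
    rw [VariableChange.mul_def] at h2
    convert h2 using 1
    refine VariableChange.ext ?_ ?_ ?_ ?_ <;> simp
  by_cases hs : f.s = 0
  · have ht2 : f.t * (f.t + 1) = 0 := by rw [hs] at ht; linear_combination ht
    rw [hr, hs]
    rcases mul_eq_zero.1 ht2 with h | h
    · rw [h]
      convert R.one_mem using 1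
      refine VariableChange.ext rfl ?_ rfl rfl
      exact zero_pow two_ne_zero
    · have h1 : f.t = 1 := by linear_combination h - two_F4
      rw [h1]
      convert hneg using 2
      simp
  · have hs3 := F4_pow_three hs
    have hI : (⟨1, f.s ^ 2, f.s, ω⟩ : VariableChange F4) ∈ R := by
      have h2 := R.mul_mem (hu (Units.mk0 f.s hs)⁻¹) (R.mul_mem hiR (hu (Units.mk0 f.s hs)))
      rw [VariableChange.mul_def, VariableChange.mul_def] at h2
      convert h2 using 2
      · simp
      · simp
      · simp
      · simp [hs3]
    have ht2 : (f.t - ω) * (f.t - (ω + 1)) = 0 := by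
      linear_combination ht + hs3 + ω_sq - (f.t * ω + f.t) * two_F4
    rw [hr]
    rcases mul_eq_zero.1 ht2 with h | h
    · rwa [sub_eq_zero.1 h]
    · rw [sub_eq_zero.1 h]
      have h2 := R.mul_mem hI hneg
      rw [VariableChange.mul_def] at h2
      convert h2 using 2
      · simp
      · simp
      · simp
      · simp

theorem reduction_bijOn : Set.BijOn (fun γ : G24 => γ.f.map residue) Set.univ (AutC : Set _) := by
  refine ⟨fun γ _ => reduction_mem γ, reduction_injective.injOn, fun f hf => ?_⟩
  obtain ⟨g, -, hg⟩ := exists_rotation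
  obtain ⟨i, -, hi⟩ := exists_order_four
  obtain ⟨γ, -, hγ⟩ := closure_generators hg hi hf
  exact ⟨γ, trivial, hγ⟩

theorem closure_eq_top {g i : G24} (hg : reduction g = ⟨Units.mk0 ω ω_ne_zero, 0, 0, 0⟩)
    (hi : reduction i = ⟨1, 1, 1, ω⟩) : Subgroup.closure {g, i} = ⊤ := by
  rw [eq_top_iff]
  intro γ _
  obtain ⟨δ, hδ, h⟩ := closure_generators hg hi (reduction_mem γ)
  rwa [← reduction_injective h]

end EllCohomology
end

open CategoryTheory
noncomputable section
namespace EllCohomology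

/-! ### Laurent series over `𝔽₄` in `u₁ = z⁻¹`, filtered by the pole order -/

/-- The field `𝔽₄((u₁))`. -/
abbrev KK : Type := LaurentSeries F4

/-- The algebra structure for which scalar multiplication is coefficientwise. -/
instance : Algebra F4 KK := HahnSeries.instAlgebra

/-- The element `z = u₁⁻¹`. -/
def zz : KK := HahnSeries.single (-1) 1

/-- The Laurent series with a pole of order at most `t`. -/
def Mt (t : ℤ) : Submodule F4 KK where
  carrier := {f | ∀ n < -t, f.coeff n = 0}
  add_mem' {f g} hf hg n hn := by rw [HahnSeries.coeff_add, hf n hn, hg n hn, add_zero]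
  zero_mem' n _ := HahnSeries.coeff_zero
  smul_mem' a f hf n hn := by rw [HahnSeries.coeff_smul, hf n hn, smul_zero]

theorem mem_Mt {t : ℤ} {f : KK} : f ∈ Mt t ↔ ∀ n < -t, f.coeff n = 0 := Iff.rfl

theorem Mt_mono {s t : ℤ} (h : s ≤ t) : Mt s ≤ Mt t := fun _ hf n hn => hf n (by omega)

theorem zz_zpow (n : ℤ) : zz ^ n = HahnSeries.single (-n) (1 : F4) := by
  have h : zz = (HahnSeries.single (1 : ℤ) (1 : F4))⁻¹ := by
    rw [eq_comm, inv_eq_iff_eq_inv, eq_comm, ← one_mul (zz⁻¹), ← div_eq_mul_inv, div_eq_iff, zz]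
    · rw [HahnSeries.single_mul_single]; simp
    · exact HahnSeries.single_ne_zero one_ne_zero
  rw [h, inv_zpow', ← RatFunc.single_zpow]

theorem zz_ne_zero : zz ≠ 0 := HahnSeries.single_ne_zero one_ne_zero

theorem coeff_zz_zpow (n m : ℤ) : (zz ^ n).coeff m = if m = -n then 1 else 0 := by
  rw [zz_zpow, HahnSeries.coeff_single]
  congr

theorem coeff_zz_zpow_mul (n : ℤ) (f : KK) (m : ℤ) : (zz ^ n * f).coeff m = f.coeff (m + n) := by
  have := HahnSeries.coeff_single_mul_add (r := (1 : F4)) (x := f) (a := m + n) (b := -n)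
  rw [zz_zpow]
  rwa [add_neg_cancel_right, one_mul] at this

theorem zpow_mul_mem {n t : ℤ} {f : KK} : zz ^ n * f ∈ Mt (n + t) ↔ f ∈ Mt t := by
  simp only [mem_Mt, coeff_zz_zpow_mul]
  constructor
  · intro h m hm
    have := h (m - n) (by omega)
    rwa [sub_add_cancel] at this
  · intro h m hm
    exact h _ (by omega)

theorem mem_Mt_zero {f : KK} : f ∈ Mt 0 ↔ ∃ p : PowerSeries F4, f = (p : KK) := by
  constructor
  · intro h
    refine ⟨PowerSeries.mk fun n => f.coeff n, ?_⟩
    ext n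
    rcases lt_or_ge n 0 with hn | hn
    · rw [h n (by simpa using hn)]
      simp [PowerSeries.coeff_coe, hn]
    · lift n to ℕ using hn
      simp
  · rintro ⟨p, rfl⟩ n hn
    have hn' : n < 0 := by simpa using hn
    simp [PowerSeries.coeff_coe, hn']

theorem mem_Mt_iff {t : ℤ} {f : KK} : f ∈ Mt t ↔ ∃ p : PowerSeries F4, f = zz ^ t * (p : KK) := by
  have h : f = zz ^ t * (zz ^ (-t) * f) := by
    rw [← mul_assoc, ← zpow_add₀ zz_ne_zero, add_neg_cancel, zpow_zero, one_mul]
  constructor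
  · intro hf
    have : zz ^ (-t) * f ∈ Mt (-t + t) := zpow_mul_mem.2 hf
    rw [neg_add_cancel] at this
    obtain ⟨p, hp⟩ := mem_Mt_zero.1 this
    exact ⟨p, by rw [← hp, ← h]⟩
  · rintro ⟨p, rfl⟩
    have := (zpow_mul_mem (n := t)).2 (mem_Mt_zero.2 ⟨p, rfl⟩)
    rwa [add_zero] at this

theorem mul_mem_Mt {s t : ℤ} {f g : KK} (hf : f ∈ Mt s) (hg : g ∈ Mt t) : f * g ∈ Mt (s + t) := by
  obtain ⟨p, rfl⟩ := mem_Mt_iff.1 hf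
  obtain ⟨q, rfl⟩ := mem_Mt_iff.1 hg
  refine mem_Mt_iff.2 ⟨p * q, ?_⟩
  rw [zpow_add₀ zz_ne_zero, map_mul]
  ring

theorem zpow_mem_Mt (n : ℤ) : zz ^ n ∈ Mt n := mem_Mt_iff.2 ⟨1, by rw [map_one, mul_one]⟩

theorem pow_mem_Mt (n : ℕ) : zz ^ n ∈ Mt n := by
  rw [← zpow_natCast]; exact zpow_mem_Mt n

theorem algebraMap_mem_Mt (a : F4) : algebraMap F4 KK a ∈ Mt 0 := by
  rw [Algebra.algebraMap_eq_smul_one]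
  exact (Mt 0).smul_mem a (by simpa using zpow_mem_Mt 0)

theorem mem_Mt_pred {t : ℤ} {f : KK} (hf : f ∈ Mt t) (h : f.coeff (-t) = 0) : f ∈ Mt (t - 1) := by
  intro n hn
  rcases eq_or_lt_of_le (show -t ≥ n by omega) with h1 | h1
  · rw [h1, h]
  · exact hf n h1

/-- Splitting off the leading term. -/
theorem sub_lead_mem {t : ℤ} {f : KK} (hf : f ∈ Mt t) :
    f - f.coeff (-t) • zz ^ t ∈ Mt (t - 1) := by
  refine mem_Mt_pred (sub_mem hf ((Mt t).smul_mem _ (zpow_mem_Mt t))) ?_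
  rw [HahnSeries.coeff_sub, HahnSeries.coeff_smul, coeff_zz_zpow, if_pos rfl, smul_eq_mul, mul_one,
    sub_self]

/-- The subring `𝔽₄[z]`. -/
def Poly : Subalgebra F4 KK := Algebra.adjoin F4 {zz}

theorem zz_mem_Poly : zz ∈ Poly := Algebra.subset_adjoin rfl

theorem Poly_coeff {p : KK} (hp : p ∈ Poly) : ∀ n : ℤ, 0 < n → p.coeff n = 0 := by
  obtain ⟨P, rfl⟩ : ∃ P : Polynomial F4, Polynomial.aeval zz P = p := by
    rw [Poly, Algebra.adjoin_singleton_eq_range_aeval] at hp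
    exact hp
  clear hp
  induction P using Polynomial.induction_on' with
  | add p q hp hq =>
    intro n hn
    rw [map_add, HahnSeries.coeff_add, hp n hn, hq n hn, add_zero]
  | monomial m a =>
    intro n hn
    rw [Polynomial.aeval_monomial, ← Algebra.smul_def, HahnSeries.coeff_smul, ← zpow_natCast,
      coeff_zz_zpow, if_neg (by omega), smul_zero]

theorem exists_Poly_sub_mem (f : KK) : ∃ p ∈ Poly, f - p ∈ Mt (-1) := by
  obtain ⟨t, ht⟩ : ∃ t : ℕ, f ∈ Mt t := by
    refine ⟨f.order.natAbs, fun n hn => ?_⟩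
    by_contra h
    have := HahnSeries.order_le_of_coeff_ne_zero h
    omega
  induction t generalizing f with
  | zero =>
    refine ⟨f.coeff 0 • 1, Poly.smul_mem (one_mem _) _, ?_⟩
    have := sub_lead_mem ht
    simpa using this
  | succ t ih =>
    have h := sub_lead_mem ht
    rw [show ((t + 1 : ℕ) : ℤ) - 1 = t by push_cast; ring] at h
    obtain ⟨p, hp, hfp⟩ := ih _ h
    refine ⟨p + f.coeff (-((t + 1 : ℕ) : ℤ)) • zz ^ ((t + 1 : ℕ) : ℤ), ?_, ?_⟩
    · refine add_mem hp (Poly.smul_mem ?_ _)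
      rw [zpow_natCast]
      exact pow_mem zz_mem_Poly _
    · rwa [add_comm p, ← sub_sub]

/-- A Laurent series splits into its polynomial part in `z`, constant term included, and the rest.
Substitutions `z ↦ az + b` preserve both summands, so the projection will commute with the group. -/
theorem isCompl_Mt_Poly : IsCompl (Mt (-1)) (Subalgebra.toSubmodule Poly) := by
  refine IsCompl.of_eq ?_ ?_
  · rw [eq_bot_iff]
    rintro f ⟨h1, h2⟩
    change f = 0
    ext n
    rcases lt_or_ge n 1 with hn | hn
    · exact h1 n (by simpa using hn)
    · exact Poly_coeff h2 n (by omega)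
  · rw [eq_top_iff]
    intro f _
    obtain ⟨p, hp, h⟩ := exists_Poly_sub_mem f
    rw [← sub_add_cancel f p]
    exact Submodule.add_mem_sup h hp

/-- The projection to the series without polynomial part. -/
def pr : KK →ₗ[F4] KK := (Mt (-1)).subtype ∘ₗ Submodule.projectionOnto _ _ isCompl_Mt_Poly

theorem pr_mem (f : KK) : pr f ∈ Mt (-1) := Subtype.prop _

theorem pr_of_mem {f : KK} (hf : f ∈ Mt (-1)) : pr f = f :=
  congrArg Subtype.val (Submodule.projectionOnto_apply_left isCompl_Mt_Poly ⟨f, hf⟩)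

theorem pr_of_mem_Poly {f : KK} (hf : f ∈ Poly) : pr f = 0 :=
  congrArg Subtype.val (Submodule.projectionOnto_apply_right isCompl_Mt_Poly ⟨f, hf⟩)

theorem sub_pr_mem (f : KK) : f - pr f ∈ Poly := by
  obtain ⟨p, hp, h⟩ := exists_Poly_sub_mem f
  have h1 : pr f = f - p := by
    conv_lhs => rw [← sub_add_cancel f p, map_add, pr_of_mem h, pr_of_mem_Poly hp, add_zero]
  rwa [h1, sub_sub_cancel]

/-! ### Reduction modulo `2` of `𝕎[[u₁]]` -/

/-- The reduction `𝕎[[u₁]] → 𝔽₄[[u₁]]`. -/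
def redS : E0 →+* PowerSeries F4 := PowerSeries.map (WittVector.constantCoeff (p := 2))

theorem redS_surjective : Function.Surjective redS :=
  PowerSeries.map_surjective _ fun a => ⟨WittVector.teichmuller 2 a, by simp⟩

theorem redS_X : redS PowerSeries.X = PowerSeries.X := PowerSeries.map_X _

theorem redS_eq_zero_iff {f : E0} : redS f = 0 ↔ ∃ g, f = 2 * g := by
  constructor
  · intro h
    have : ∀ n, ∃ a : W4, PowerSeries.coeff n f = 2 * a := by
      intro n
      have hn := congrArg (PowerSeries.coeff n) h
      rw [redS, PowerSeries.coeff_map, map_zero] at hn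
      have h2 := WittVector.mem_span_p_iff_coeff_zero_eq_zero (p := 2) (PowerSeries.coeff n f)
      rw [Ideal.mem_span_singleton] at h2
      exact_mod_cast h2.2 hn
    choose a ha using this
    refine ⟨PowerSeries.mk a, ?_⟩
    ext1 n
    have h4 : (2 : E0) = PowerSeries.C (2 : W4) := (map_ofNat _ _).symm
    rw [h4, PowerSeries.coeff_C_mul, PowerSeries.coeff_mk, ha]
  · rintro ⟨g, rfl⟩
    rw [map_mul, map_ofNat]
    have : (2 : PowerSeries F4) = PowerSeries.C (2 : F4) := (map_ofNat _ _).symm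
    rw [this, two_F4, map_zero, zero_mul]

theorem redS_C (a : W4) : redS (PowerSeries.C a) = PowerSeries.C (WittVector.constantCoeff a) :=
  PowerSeries.map_C _ _

end EllCohomology
end

open CategoryTheory
noncomputable section
namespace EllCohomology

open WeierstrassCurve

/-! ### The action of `G₂₄` on `𝔽₄((u₁))` -/

theorem redS_φ_eq_zero (φ : E0 ≃ₐ[W4] E0) {f : E0} (hf : redS f = 0) : redS (φ f) = 0 := by
  obtain ⟨g, rfl⟩ := redS_eq_zero_iff.1 hf
  exact redS_eq_zero_iff.2 ⟨φ g, by rw [map_mul, map_ofNat]⟩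

/-- The automorphism of `𝔽₄[[u₁]]` induced by an automorphism of `𝕎[[u₁]]`. -/
def actS (γ : G24) : PowerSeries F4 →+* PowerSeries F4 :=
  redS.liftOfSurjective redS_surjective
    ⟨redS.comp (γ.φ : E0 →+* E0), fun _ hf => redS_φ_eq_zero γ.φ hf⟩

theorem actS_redS (γ : G24) (f : E0) : actS γ (redS f) = redS (γ.φ f) :=
  RingHom.liftOfRightInverse_comp_apply redS _ _ _ f

theorem actS_mul (γ δ : G24) (f : PowerSeries F4) : actS (γ * δ) f = actS γ (actS δ f) := by
  obtain ⟨f, rfl⟩ := redS_surjective f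
  rw [actS_redS, actS_redS, actS_redS]
  rfl

theorem actS_one (f : PowerSeries F4) : actS 1 f = f := by
  obtain ⟨f, rfl⟩ := redS_surjective f
  rw [actS_redS]
  rfl

theorem actS_injective (γ : G24) : Function.Injective (actS γ) := by
  apply Function.LeftInverse.injective (g := actS γ⁻¹)
  intro f
  rw [← actS_mul, inv_mul_cancel, actS_one]

theorem actS_C (γ : G24) (a : F4) : actS γ (PowerSeries.C a) = PowerSeries.C a := by
  have h : PowerSeries.C a = redS (PowerSeries.C (WittVector.teichmuller 2 a)) := by
    rw [redS_C]; simp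
  have h2 : γ.φ (PowerSeries.C (WittVector.teichmuller 2 a)) =
    PowerSeries.C (WittVector.teichmuller 2 a) := γ.φ.commutes _
  rw [h, actS_redS, h2]

/-- The action of `G₂₄` on `𝔽₄((u₁))`, as ring homomorphisms. -/
def actRing (γ : G24) : KK →+* KK :=
  IsFractionRing.lift (A := PowerSeries F4) (K := KK)
    (g := (HahnSeries.ofPowerSeries ℤ F4).comp (actS γ))
    (HahnSeries.ofPowerSeries_injective.comp (actS_injective γ))

theorem actRing_coe (γ : G24) (f : PowerSeries F4) :
    actRing γ (f : KK) = ((actS γ f : PowerSeries F4) : KK) :=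
  IsFractionRing.lift_algebraMap (A := PowerSeries F4) (K := KK) _ f

theorem ringHom_ext_KK {α β : KK →+* KK} (h : ∀ f : PowerSeries F4, α (f : KK) = β (f : KK)) :
    α = β :=
  IsLocalization.ringHom_ext (nonZeroDivisors (PowerSeries F4)) (RingHom.ext h)

theorem algebraMap_KK (a : F4) : algebraMap F4 KK a = ((PowerSeries.C a : PowerSeries F4) : KK) :=
  (PowerSeries.coe_C a).symm

/-- The action of `G₂₄` on `𝔽₄((u₁))`. -/
def act : G24 →* (KK →ₐ[F4] KK) where
  toFun γ := ⟨actRing γ, fun a => by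
    change actRing γ (algebraMap F4 KK a) = _
    rw [algebraMap_KK, actRing_coe, actS_C]⟩
  map_one' := by
    apply AlgHom.coe_ringHom_injective
    exact ringHom_ext_KK fun f => (actRing_coe 1 f).trans (by rw [actS_one]; rfl)
  map_mul' γ δ := by
    apply AlgHom.coe_ringHom_injective
    refine ringHom_ext_KK fun f => (actRing_coe _ f).trans ?_
    change _ = actRing γ (actRing δ _)
    rw [actRing_coe, actRing_coe, actS_mul]

theorem act_coe (γ : G24) (f : PowerSeries F4) :
    act γ (f : KK) = ((actS γ f : PowerSeries F4) : KK) := actRing_coe γ f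

theorem act_mul_apply (γ δ : G24) (f : KK) : act (γ * δ) f = act γ (act δ f) := by
  rw [map_mul]; rfl

theorem act_one_apply (f : KK) : act 1 f = f := by
  rw [map_one]; rfl

theorem two_KK : (2 : KK) = 0 := by
  rw [← map_ofNat (algebraMap F4 KK), two_F4, map_zero]

theorem two_PS : (2 : PowerSeries F4) = 0 := by
  rw [← map_ofNat (PowerSeries.C (R := F4)), two_F4, map_zero]

instance : CharP KK 2 := charP_of_injective_algebraMap (algebraMap F4 KK).injective 2

/-- The reduction modulo `2` of the unit `l`. -/
def lbar (γ : G24) : (PowerSeries F4)ˣ := Units.map redS.toMonoidHom γ.f.u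

theorem lbar_coe (γ : G24) : (lbar γ : PowerSeries F4) = redS γ.f.u := rfl

/-- Modulo `2` the term `2s` drops out of the equation for `a₁`. -/
theorem actS_X (γ : G24) : actS γ PowerSeries.X = (lbar γ : PowerSeries F4) * PowerSeries.X := by
  have h := congrArg redS γ.eq_a₁
  rw [map_add, map_mul, map_mul, map_mul, map_mul, map_ofNat, map_ofNat, redS_X, ← actS_redS,
    redS_X, ← lbar_coe] at h
  linear_combination h + ((lbar γ : PowerSeries F4) * PowerSeries.X - actS γ PowerSeries.X - redS γ.f.s) * two_PS

theorem zz_inv : zz⁻¹ = ((PowerSeries.X : PowerSeries F4) : KK) := by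
  rw [PowerSeries.coe_X, ← zpow_neg_one, zz_zpow, neg_neg]

theorem act_zz (γ : G24) : act γ zz = ((↑(lbar γ)⁻¹ : PowerSeries F4) : KK) * zz := by
  have hl : ((↑(lbar γ)⁻¹ : PowerSeries F4) : KK) * ((lbar γ : PowerSeries F4) : KK) = 1 := by
    rw [← map_mul, Units.inv_mul, map_one]
  rw [← inv_inv (act γ zz), ← map_inv₀, zz_inv, act_coe, actS_X, map_mul, ← zz_inv, mul_inv,
    inv_inv, eq_inv_of_mul_eq_one_left hl]

/-- The group multiplies `z` by units of `𝔽₄[[u₁]]`, so pole orders do not change. -/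
theorem act_mem {γ : G24} {t : ℤ} {f : KK} (hf : f ∈ Mt t) : act γ f ∈ Mt t := by
  obtain ⟨p, rfl⟩ := mem_Mt_iff.1 hf
  rw [map_mul, map_zpow₀, act_zz, act_coe, mul_zpow]
  refine mem_Mt_iff.2 ⟨(((lbar γ)⁻¹ ^ t : (PowerSeries F4)ˣ) : PowerSeries F4) * actS γ p, ?_⟩
  have : ((((lbar γ)⁻¹ ^ t : (PowerSeries F4)ˣ) : PowerSeries F4) : KK) =
      (((((lbar γ)⁻¹ : (PowerSeries F4)ˣ) : PowerSeries F4)) : KK) ^ t := by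
    have := map_zpow (Units.map (HahnSeries.ofPowerSeries ℤ F4).toMonoidHom) (lbar γ)⁻¹ t
    have h2 := congrArg (Units.val) this
    rw [Units.val_zpow_eq_zpow_val] at h2
    exact h2
  rw [map_mul, this]
  ring

/-- Affine maps are closed under composition and inversion, so two generators suffice. The rotation
gives `z ↦ ω⁻¹z`, and `u₁ ↦ (u₁ + 2)/(u₁ - 1)` becomes `z ↦ z + 1` modulo `2`. -/
theorem exists_affine (γ : G24) : ∃ (c : F4ˣ) (s : F4), act γ zz = c⁻¹ • (zz + algebraMap F4 KK s) := by
  obtain ⟨g, hgX, hg⟩ := exists_rotation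
  obtain ⟨i, hiX, hi⟩ := exists_order_four
  have hγ : γ ∈ Subgroup.closure {g, i} := by rw [closure_eq_top hg hi]; trivial
  induction hγ using Subgroup.closure_induction with
  | mem x hx =>
    rcases hx with rfl | rfl
    · refine ⟨Units.mk0 ω ω_ne_zero, 0, ?_⟩
      have h1 : act x zz⁻¹ = algebraMap F4 KK ω * zz⁻¹ := by
        rw [zz_inv, act_coe, ← redS_X, actS_redS, hgX, map_mul, map_mul, algebraMap_KK]
        congr 2
        change redS (PowerSeries.C wW) = _
        rw [redS_C, wW]
        simp
      rw [map_inv₀] at h1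
      rw [← inv_inv (act x zz), h1, mul_inv, inv_inv, map_zero, add_zero, Units.smul_def,
        Algebra.smul_def, Units.val_inv_eq_inv_val, map_inv₀]
      rfl
    · refine ⟨1, 1, ?_⟩
      have h1 : act x zz⁻¹ * (zz⁻¹ + 1) = zz⁻¹ := by
        have h2 := congrArg redS hiX
        rw [map_mul, ← actS_redS, map_sub, map_add, map_one, map_ofNat, redS_X] at h2
        have h3 := congrArg (HahnSeries.ofPowerSeries ℤ F4) h2
        rw [map_mul, map_sub, map_add, map_ofNat, map_one, ← act_coe, ← zz_inv] at h3
        linear_combination h3 + (1 + act x zz⁻¹) * two_KK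
      rw [map_inv₀] at h1
      have h0 : act x zz ≠ 0 := by
        rw [ne_eq, map_eq_zero]; exact zz_ne_zero
      have h0' := zz_ne_zero
      field_simp at h1
      rw [inv_one, one_smul, map_one]
      linear_combination -h1
  | one => exact ⟨1, 0, by rw [act_one_apply]; simp⟩
  | mul x y _ _ hx hy =>
    obtain ⟨c, s, h⟩ := hx
    obtain ⟨d, t, h'⟩ := hy
    refine ⟨c * d, s + c * t, ?_⟩
    rw [act_mul_apply, h', Units.smul_def, map_smul, map_add, h, AlgHom.commutes, mul_inv]
    simp only [Units.smul_def, Algebra.smul_def, map_add, map_mul, Units.val_mul]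
    have : algebraMap F4 KK (c⁻¹ : F4ˣ) * algebraMap F4 KK c = 1 := by
      rw [← map_mul, Units.inv_mul, map_one]
    linear_combination -(algebraMap F4 KK (d⁻¹ : F4ˣ)) * algebraMap F4 KK t * this
  | inv x _ hx =>
    obtain ⟨c, s, h⟩ := hx
    refine ⟨c⁻¹, - c⁻¹ * s, ?_⟩
    have h2 := congrArg (act x⁻¹) h
    rw [← act_mul_apply, inv_mul_cancel, act_one_apply, Units.smul_def, map_smul, map_add,
      AlgHom.commutes] at h2
    simp only [Units.smul_def, Algebra.smul_def, inv_inv, map_mul, map_neg] at h2 ⊢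
    have : algebraMap F4 KK (c⁻¹ : F4ˣ) * algebraMap F4 KK c = 1 := by
      rw [← map_mul, Units.inv_mul, map_one]
    linear_combination -algebraMap F4 KK c * h2 - (act x⁻¹ zz) * this

/-- The multiplier of the action on `z`. -/
def ll (γ : G24) : F4ˣ := (exists_affine γ).choose

/-- The translation part of the action on `z`. -/
def sg (γ : G24) : F4 := (exists_affine γ).choose_spec.choose

theorem act_z (γ : G24) : act γ zz = (ll γ)⁻¹ • (zz + algebraMap F4 KK (sg γ)) :=
  (exists_affine γ).choose_spec.choose_spec

theorem coeff_algebraMap (a : F4) (n : ℤ) :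
    (algebraMap F4 KK a).coeff n = if n = 0 then a else 0 := by
  change (HahnSeries.C a).coeff n = _
  rw [HahnSeries.C_apply, HahnSeries.coeff_single]
  congr

theorem coeff_zz (n : ℤ) : zz.coeff n = if n = -1 then 1 else 0 := by
  have := coeff_zz_zpow 1 n
  rwa [zpow_one] at this

theorem affine_unique {c d : F4} {s t : F4}
    (h : c • zz + algebraMap F4 KK s = d • zz + algebraMap F4 KK t) : c = d ∧ s = t := by
  constructor
  · have := congrArg (fun f => f.coeff (-1)) h
    simpa [coeff_algebraMap, coeff_zz] using this
  · have := congrArg (fun f => f.coeff 0) h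
    simpa [coeff_algebraMap, coeff_zz] using this

theorem act_z' (γ : G24) : act γ zz =
    ((ll γ)⁻¹ : F4ˣ).val • zz + algebraMap F4 KK (((ll γ)⁻¹ : F4ˣ).val * sg γ) := by
  rw [act_z, Units.smul_def, smul_add, map_mul, ← Algebra.smul_def]

theorem affine_mul (γ δ : G24) : ll (γ * δ) = ll γ * ll δ ∧ sg (γ * δ) = sg γ + ll γ * sg δ := by
  have h := act_mul_apply γ δ zz
  rw [act_z', act_z' δ, map_add, map_smul, act_z' γ, AlgHom.commutes, smul_add, smul_smul,
    Algebra.smul_def _ (algebraMap F4 KK _), ← map_mul, add_assoc, ← map_add] at h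
  obtain ⟨h1, h2⟩ := affine_unique h
  have h3 : ll (γ * δ) = ll γ * ll δ := by
    have : (ll (γ * δ))⁻¹ = (ll δ)⁻¹ * (ll γ)⁻¹ := Units.ext h1
    rw [← mul_inv, inv_inj] at this
    rw [this, mul_comm]
  refine ⟨h3, ?_⟩
  have h4 : ((ll (γ * δ) : F4ˣ) : F4) * ((ll (γ * δ))⁻¹ : F4ˣ) = 1 := Units.mul_inv _
  have h5 : (ll γ : F4) * ((ll γ)⁻¹ : F4ˣ) = 1 := Units.mul_inv _
  have h6 : (ll δ : F4) * ((ll δ)⁻¹ : F4ˣ) = 1 := Units.mul_inv _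
  have h7 : (ll (γ * δ) : F4) = ll γ * ll δ := by rw [h3]; rfl
  have h8 : (ll γ : F4) * ll δ * ((ll (γ * δ))⁻¹ : F4ˣ) = 1 := by rw [← h7, h4]
  linear_combination (ll γ * ll δ : F4) * h2 + (-sg (γ * δ)) * h8 +
    (sg γ * (ll δ : F4) * ((ll δ)⁻¹ : F4ˣ)) * h5 + (sg γ + (ll γ : F4) * sg δ) * h6

/-- The multiplier as a homomorphism. -/
def lHom : G24 →* F4ˣ := MonoidHom.mk' ll fun γ δ => (affine_mul γ δ).1

theorem ll_mul (γ δ : G24) : ll (γ * δ) = ll γ * ll δ := (affine_mul γ δ).1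

theorem sg_mul (γ δ : G24) : sg (γ * δ) = sg γ + ll γ * sg δ := (affine_mul γ δ).2

theorem ll_cube (γ : G24) : (ll γ : F4) ^ 3 = 1 := F4_pow_three (ll γ).ne_zero

theorem ll_inv (γ : G24) : (((ll γ)⁻¹ : F4ˣ) : F4) = (ll γ : F4) ^ 2 := by
  have h6 : (ll γ : F4) * ((ll γ)⁻¹ : F4ˣ) = 1 := Units.mul_inv _
  linear_combination (-((ll γ)⁻¹ : F4ˣ).val) * ll_cube γ + (ll γ : F4) ^ 2 * h6

/-! ### The cocycle `h = h₁ / v₁` -/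

/-- The cochain `h = s / (l u₁)`. -/
def hh (γ : G24) : KK :=
  ((redS γ.f.s : PowerSeries F4) : KK) * ((↑(lbar γ)⁻¹ : PowerSeries F4) : KK) * zz

theorem hh_eq (γ : G24) : hh γ = ((redS γ.f.s : PowerSeries F4) : KK) * act γ zz := by
  rw [hh, act_zz, mul_assoc]

/-- This is the composition law of coordinate changes, `s(γδ) = γ(l(δ)) s(γ) + γ(s(δ))`, divided by
`l u₁`. -/
theorem hh_mul (γ δ : G24) : hh (γ * δ) = hh γ + act γ (hh δ) := by
  have e1 : ((lbar (γ * δ) : PowerSeries F4) : KK) =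
      ((lbar γ : PowerSeries F4) : KK) * act γ ((lbar δ : PowerSeries F4) : KK) := by
    rw [act_coe, ← map_mul, lbar_coe δ, actS_redS]
    congr 1
    exact map_mul redS (γ.f.u : E0) (γ.φ δ.f.u)
  have e2 : ((redS (γ * δ).f.s : PowerSeries F4) : KK) =
      act γ ((lbar δ : PowerSeries F4) : KK) * ((redS γ.f.s : PowerSeries F4) : KK) +
        act γ ((redS δ.f.s : PowerSeries F4) : KK) := by
    rw [act_coe, act_coe, ← map_mul, ← map_add, lbar_coe δ, actS_redS, actS_redS, ← map_mul,
      ← map_add]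
    rfl
  have hu : ∀ η : G24, ((↑(lbar η)⁻¹ : PowerSeries F4) : KK) *
      ((lbar η : PowerSeries F4) : KK) = 1 := fun η => by
    rw [← map_mul, Units.inv_mul, map_one]
  have hu' := congrArg (act γ) (hu δ)
  rw [map_mul, map_one] at hu'
  have hu2 := hu (γ * δ)
  rw [e1] at hu2
  rw [hh, hh, hh, e2, map_mul, map_mul, act_zz γ]
  have key : ((↑(lbar (γ * δ))⁻¹ : PowerSeries F4) : KK) =
      ((↑(lbar γ)⁻¹ : PowerSeries F4) : KK) * act γ ((↑(lbar δ)⁻¹ : PowerSeries F4) : KK) := by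
    have := hu γ
    grind
  rw [key]
  linear_combination (((redS γ.f.s : PowerSeries F4) : KK) *
    ((↑(lbar γ)⁻¹ : PowerSeries F4) : KK) * zz) * hu'

/-- Modulo `2` the equation for `a₂` reads `r = s² + l u₁ s` and the one for `a₃` reads `l³ = 1 + r
l u₁`. Eliminating `r` and multiplying by `γ(z)³ = (z/l)³` gives the Artin–Schreier equation. -/
theorem hh_sq (γ : G24) : hh γ ^ 2 + hh γ = zz ^ 3 + act γ zz ^ 3 := by
  have ha2 := congrArg redS γ.eq_a₂
  have ha3 := congrArg redS γ.eq_a₃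
  simp only [map_add, map_mul, map_pow, map_sub, map_one, map_ofNat, ← actS_redS, redS_X] at ha2 ha3
  rw [← lbar_coe, actS_X] at ha3
  rw [actS_X] at ha2
  replace ha2 := congrArg (HahnSeries.ofPowerSeries ℤ F4) ha2
  replace ha3 := congrArg (HahnSeries.ofPowerSeries ℤ F4) ha3
  simp only [map_add, map_mul, map_pow, map_sub, map_one, map_ofNat, ← zz_inv] at ha2 ha3
  have hu : ((↑(lbar γ)⁻¹ : PowerSeries F4) : KK) * ((lbar γ : PowerSeries F4) : KK) = 1 := by
    rw [← map_mul, Units.inv_mul, map_one]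
  have hz : zz * zz⁻¹ = 1 := mul_inv_cancel₀ zz_ne_zero
  have h2 := two_KK
  rw [hh_eq, act_zz]
  generalize ((↑(lbar γ)⁻¹ : PowerSeries F4) : KK) = v at *
  generalize ((lbar γ : PowerSeries F4) : KK) = l at *
  generalize ((redS γ.f.s : PowerSeries F4) : KK) = s at *
  generalize ((redS γ.f.r : PowerSeries F4) : KK) = r at *
  generalize ((redS γ.f.t : PowerSeries F4) : KK) = t at *
  generalize zz⁻¹ = x at *
  generalize zz = z at *
  have hr : r = s ^ 2 + l * x * s := by
    linear_combination ha2 + (l * x * s - r) * h2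
  have hl : l ^ 3 = 1 + (s ^ 2 + l * x * s) * (l * x) := by
    rw [hr] at ha3
    linear_combination -ha3 + (l ^ 3 - 1 + (s ^ 2 + l * x * s) * (l * x) + t) * h2
  have hm : v * z * (l * x) = 1 := by linear_combination z * x * hu + hz
  have hz3 : z ^ 3 = (v * z) ^ 3 * l ^ 3 := by
    have : v ^ 3 * l ^ 3 = 1 := by rw [← mul_pow, hu, one_pow]
    linear_combination -z ^ 3 * this
  rw [hz3, hl]
  generalize v * z = m at *
  generalize l * x = y at *
  linear_combination (-m ^ 2 * s ^ 2 - m * s * (m * y + 1)) * hm - m ^ 3 * h2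

theorem exists_artinSchreier (s : F4) : ∃ t : F4, t ^ 2 + t = s ^ 3 := by
  by_cases hs : s = 0
  · exact ⟨0, by rw [hs]; ring⟩
  · exact ⟨ω, by rw [F4_pow_three hs]; linear_combination ω_sq - two_F4⟩

/-- Because `l³ = 1`, the right side of `hh_sq` is `σz² + σ²z + σ³`. If `t² + t = σ³`, then `σ²z +
t` and `σ²z + t + 1` are the two roots of the resulting quadratic equation for `h`. -/
theorem exists_tau (γ : G24) : ∃ t : F4, hh γ = sg γ ^ 2 • zz + algebraMap F4 KK t ∧
    t ^ 2 + t = sg γ ^ 3 := by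
  obtain ⟨t, ht⟩ := exists_artinSchreier (sg γ)
  have h := hh_sq γ
  have hl : algebraMap F4 KK ((ll γ)⁻¹ : F4ˣ) ^ 3 = 1 := by
    rw [← map_pow, F4_pow_three (Units.ne_zero _), map_one]
  have h4 := congrArg (algebraMap F4 KK) (F4_pow_four (sg γ))
  have ht' := congrArg (algebraMap F4 KK) ht
  rw [act_z, Units.smul_def, Algebra.smul_def, mul_pow, hl, one_mul] at h
  simp only [map_pow, map_add] at h4 ht'
  have h2 := two_KK
  simp only [Algebra.smul_def, map_pow]
  set σ := algebraMap F4 KK (sg γ)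
  have key : (hh γ - σ ^ 2 * zz - algebraMap F4 KK t) *
      (hh γ - σ ^ 2 * zz - algebraMap F4 KK t - 1) = 0 := by
    linear_combination h + zz ^ 2 * h4 + ht' + (σ * zz ^ 2 + σ ^ 2 * zz +
      zz ^ 3 + σ * zz ^ 2 + σ ^ 2 * zz + σ ^ 3 - hh γ * σ ^ 2 * zz -
      hh γ * algebraMap F4 KK t + σ ^ 2 * zz * algebraMap F4 KK t - hh γ) * h2
  rcases mul_eq_zero.1 key with h0 | h0
  · exact ⟨t, by linear_combination h0, ht⟩
  · refine ⟨t + 1, ?_, ?_⟩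
    · rw [map_add, map_one]; linear_combination h0
    · linear_combination ht + (t + 1) * two_F4

/-- The constant term of `h`. -/
def ta (γ : G24) : F4 := (exists_tau γ).choose

theorem hh_eq_affine (γ : G24) : hh γ = sg γ ^ 2 • zz + algebraMap F4 KK (ta γ) :=
  (exists_tau γ).choose_spec.1

theorem ta_sq (γ : G24) : ta γ ^ 2 + ta γ = sg γ ^ 3 := (exists_tau γ).choose_spec.2

/-- The constant term of the cocycle identity for `h`. The correction by `σ` and `σ²` is what makes
the product of these two cochains a coboundary, see `cd_Ta`. -/
theorem ta_mul (γ δ : G24) : ta (γ * δ) = ta γ + ta δ + (ll γ : F4) ^ 2 * sg γ * sg δ ^ 2 := by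
  have h := hh_mul γ δ
  rw [hh_eq_affine, hh_eq_affine γ, hh_eq_affine δ, map_add, map_smul, act_z', AlgHom.commutes,
    smul_add, smul_smul, Algebra.smul_def _ (algebraMap F4 KK _), ← map_mul] at h
  have h2 : sg (γ * δ) ^ 2 • zz + algebraMap F4 KK (ta (γ * δ)) =
      (sg γ ^ 2 + sg δ ^ 2 * ((ll γ)⁻¹ : F4ˣ).val) • zz + algebraMap F4 KK (ta γ +
        (sg δ ^ 2 * (((ll γ)⁻¹ : F4ˣ).val * sg γ) + ta δ)) := by
    rw [h]
    simp only [map_add, add_smul]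
    ring
  rw [(affine_unique h2).2, ll_inv]
  ring

theorem constantCoeff_redS (f : E0) : PowerSeries.constantCoeff (redS f) = residue f := by
  rw [← PowerSeries.coeff_zero_eq_constantCoeff_apply, redS, PowerSeries.coeff_map,
    PowerSeries.coeff_zero_eq_constantCoeff_apply]
  rfl

theorem coeff_coe_mul_zz (p : PowerSeries F4) :
    ((p : KK) * zz).coeff (-1) = PowerSeries.constantCoeff p := by
  have := coeff_zz_zpow_mul 1 (p : KK) (-1)
  rw [zpow_one, mul_comm] at this
  rw [this, neg_add_cancel, ← PowerSeries.coeff_zero_eq_constantCoeff_apply]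
  exact LaurentSeries.coeff_coe_powerSeries p 0

theorem residue_u (γ : G24) : residue γ.f.u = ll γ := by
  have h := act_zz γ
  rw [act_z'] at h
  have h2 := congrArg (fun f => f.coeff (-1)) h
  simp only [HahnSeries.coeff_add, HahnSeries.coeff_smul, coeff_algebraMap, coeff_zz, coeff_coe_mul_zz] at h2
  simp at h2
  rw [lbar_coe, constantCoeff_redS] at h2
  exact h2.symm

theorem residue_s (γ : G24) : residue γ.f.s = ll γ * sg γ ^ 2 := by
  have h := hh_eq_affine γ
  rw [hh_eq, act_z'] at h
  have h2 := congrArg (fun f => f.coeff (-1)) h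
  have h4 : ∀ p : PowerSeries F4, (p : KK).coeff (-1) = 0 := fun p => by
    simp [PowerSeries.coeff_coe]
  rw [mul_add, mul_smul_comm, mul_comm _ (algebraMap F4 KK _), ← Algebra.smul_def] at h2
  simp only [HahnSeries.coeff_add, HahnSeries.coeff_smul, coeff_algebraMap, coeff_zz, coeff_coe_mul_zz, h4] at h2
  rw [constantCoeff_redS, ll_inv] at h2
  simp at h2
  linear_combination (ll γ : F4) * h2 - residue γ.f.s * ll_cube γ

/-! ### Coordinates on `G₂₄` -/

/-- The central element `-1`. -/
abbrev eps : G24 := CurveAut.negOne W4 curveCU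

/-- For `-1` the action on `z` is trivial and `s = -3u₁`, so `h = -3u₁z = 1` in characteristic two.
Thus `τ` detects the centre. -/
theorem coords_eps : ll eps = 1 ∧ sg eps = 0 ∧ ta eps = 1 := by
  have h1 : act eps zz = zz := by
    rw [← inv_inj, ← map_inv₀, zz_inv, act_coe, ← redS_X, actS_redS]
    rfl
  have h2 := act_z' eps
  rw [h1] at h2
  have h0 : (1 : F4) • zz + algebraMap F4 KK 0 = ((ll eps)⁻¹ : F4ˣ).val • zz +
      algebraMap F4 KK (((ll eps)⁻¹ : F4ˣ).val * sg eps) := by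
    rw [one_smul, map_zero, add_zero]; exact h2
  obtain ⟨h3, h4⟩ := affine_unique h0
  have h5 : ll eps = 1 := by
    rw [← inv_inj, inv_one]
    exact Units.ext h3.symm
  rw [h5, inv_one, Units.val_one, one_mul] at h4
  refine ⟨h5, h4.symm, ?_⟩
  have h6 := hh_eq_affine eps
  have h7 : eps.f.s = -(3 * PowerSeries.X) := rfl
  rw [hh_eq, h1, h7, ← h4, map_neg, map_mul, map_ofNat, redS_X, map_neg, map_mul, map_ofNat,
    ← zz_inv] at h6
  have h8 : (0 : F4) • zz + algebraMap F4 KK 1 = (0 : F4) ^ 2 • zz + algebraMap F4 KK (ta eps) := by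
    rw [← h6, zero_smul, map_one]
    have hz : zz⁻¹ * zz = 1 := inv_mul_cancel₀ zz_ne_zero
    linear_combination 3 * hz + 2 * two_KK
  exact (affine_unique h8).2.symm

theorem reduction_coords (γ : G24) : (reduction γ).u = ll γ ∧
    (reduction γ).r = ((ll γ : F4) * sg γ ^ 2) ^ 2 ∧ (reduction γ).s = ll γ * sg γ ^ 2 ∧
    (reduction γ).t ^ 2 + (reduction γ).t = ((ll γ : F4) * sg γ ^ 2) ^ 3 := by
  have hs : (reduction γ).s = ll γ * sg γ ^ 2 := residue_s γ
  obtain ⟨-, hr, ht⟩ := mem_AutC_iff (reduction_mem γ)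
  rw [hs] at hr ht
  exact ⟨Units.ext (residue_u γ), hr, hs, ht⟩

/-- With `l = 1` and `σ = 0` the reduction is `(1, 0, 0, t)` with `t ∈ {0, 1}`, so the element is
`1` or `-1`, and `τ(-1) = 1` excludes the latter. -/
theorem eq_one_of_coords {γ : G24} (h1 : ll γ = 1) (h2 : sg γ = 0) (h3 : ta γ = 0) : γ = 1 := by
  obtain ⟨hu, hr, hs, ht⟩ := reduction_coords γ
  obtain ⟨hu', hr', hs', ht'⟩ := reduction_coords eps
  simp only [coords_eps.1, coords_eps.2.1] at hu' hr' hs' ht'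
  simp only [h1, h2] at hu hr hs ht
  have e1 : eps ≠ 1 := fun h => by
    have := ta_mul eps eps
    rw [h, mul_one] at this
    have h5 := coords_eps.2.2
    have h6 := coords_eps.2.1
    rw [h] at h5 h6
    rw [h5, h6] at this
    exact one_ne_zero (α := F4) (by linear_combination -this)
  have e2 : (reduction eps).t = 1 := by
    have : (reduction eps).t * ((reduction eps).t + 1) = 0 := by linear_combination ht'
    rcases mul_eq_zero.1 this with h | h
    · refine absurd (eq_one_of_reduction ?_) e1
      refine VariableChange.ext hu' (hr'.trans ?_) (hs'.trans ?_) h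
      · simp; rfl
      · simp; rfl
    · linear_combination h - two_F4
  have : (reduction γ).t * ((reduction γ).t + 1) = 0 := by linear_combination ht
  rcases mul_eq_zero.1 this with h | h
  · refine eq_one_of_reduction ?_
    refine VariableChange.ext hu (hr.trans ?_) (hs.trans ?_) h
    · simp; rfl
    · simp; rfl
  · exfalso
    have h4 : γ = eps := by
      apply reduction_injective
      refine VariableChange.ext (hu.trans hu'.symm) (hr.trans hr'.symm) (hs.trans hs'.symm) ?_
      rw [e2]
      linear_combination h - two_F4
    rw [h4, coords_eps.2.2] at h3
    exact one_ne_zero h3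

theorem coords_injective {γ δ : G24} (h1 : ll γ = ll δ) (h2 : sg γ = sg δ) (h3 : ta γ = ta δ) :
    γ = δ := by
  have e1 := ll_mul γ (γ⁻¹ * δ)
  have e2 := sg_mul γ (γ⁻¹ * δ)
  have e3 := ta_mul γ (γ⁻¹ * δ)
  rw [mul_inv_cancel_left, ← h1, left_eq_mul] at e1
  rw [mul_inv_cancel_left, ← h2, left_eq_add, mul_eq_zero] at e2
  replace e2 := e2.resolve_left (Units.ne_zero _)
  rw [mul_inv_cancel_left, ← h3, e2] at e3
  have := eq_one_of_coords e1 e2 (by linear_combination -e3)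
  rwa [inv_mul_eq_one] at this

theorem F4_sq_injective {a b : F4} (h : a ^ 2 = b ^ 2) : a = b := by
  linear_combination -F4_pow_four a + F4_pow_four b + (a ^ 2 + b ^ 2) * h

/-- An element of `Aut(C)` with the right `l` and `s` lifts to some `γ`. Its `τ` is one of the two
roots of the Artin–Schreier equation, and multiplication by `-1` exchanges them. -/
theorem coords_surjective (c : F4ˣ) {s t : F4} (hst : t ^ 2 + t = s ^ 3) :
    ∃ γ : G24, ll γ = c ∧ sg γ = s ∧ ta γ = t := by
  obtain ⟨t', ht'⟩ := exists_artinSchreier (c * s ^ 2)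
  have hf : (⟨c, (c * s ^ 2) ^ 2, c * s ^ 2, t'⟩ : VariableChange F4) ∈ AutC := by
    rw [MulAction.mem_stabilizer_iff, variableChange_def]
    have hc := F4_pow_three (Units.ne_zero c⁻¹)
    ext1 <;> dsimp only [curveC]
    · linear_combination ((c⁻¹ : F4ˣ) : F4) * (c * s ^ 2) * two_F4
    · linear_combination ((c⁻¹ : F4ˣ) : F4) ^ 2 * (c * s ^ 2) ^ 2 * two_F4
    · linear_combination -hc + ((c⁻¹ : F4ˣ) : F4) ^ 3 * t' * two_F4
    · linear_combination ((c⁻¹ : F4ˣ) : F4) ^ 4 * (3 * F4_pow_four (c * s ^ 2) +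
        (2 * (c * s ^ 2) - c * s ^ 2 * t') * two_F4)
    · linear_combination ((c⁻¹ : F4ˣ) : F4) ^ 6 * (-ht' +
        (c * s ^ 2) ^ 2 * F4_pow_four (c * s ^ 2) + t' * two_F4)
  obtain ⟨γ, -, hγ⟩ := reduction_bijOn.surjOn hf
  replace hγ : reduction γ = _ := hγ
  obtain ⟨hu, -, hs, -⟩ := reduction_coords γ
  rw [hγ] at hu hs
  replace hu : ll γ = c := hu.symm
  replace hs : sg γ = s := by
    replace hs : (c * s ^ 2 : F4) = ll γ * sg γ ^ 2 := hs
    rw [hu] at hs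
    exact F4_sq_injective (mul_left_cancel₀ (Units.ne_zero c) hs).symm
  have h1 := ta_sq γ
  rw [hs] at h1
  have h2 : (ta γ - t) * (ta γ - t - 1) = 0 := by
    linear_combination h1 - hst + (-ta γ * t + t ^ 2 - ta γ + t) * two_F4
  rcases mul_eq_zero.1 h2 with h | h
  · exact ⟨γ, hu, hs, by linear_combination h⟩
  · refine ⟨γ * eps, ?_, ?_, ?_⟩
    · rw [ll_mul, coords_eps.1, mul_one, hu]
    · rw [sg_mul, coords_eps.2.1, mul_zero, add_zero, hs]
    · rw [ta_mul, coords_eps.2.1, coords_eps.2.2]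
      linear_combination h + two_F4

end EllCohomology
end

open CategoryTheory
noncomputable section
namespace EllCohomology

/-! ### Cochains with coefficients in `𝔽₄`-representations -/

section Cochains

variable {G : Type} [Group G] {V V' : Type} [AddCommGroup V] [Module F4 V] [AddCommGroup V']
  [Module F4 V'] {n : ℕ}

/-- The coboundary of inhomogeneous cochains; there are no signs in characteristic `2`. -/
def cd (ρ : Representation F4 G V) (f : (Fin n → G) → V) : (Fin (n + 1) → G) → V :=
  fun g => ρ (g 0) (f (Fin.tail g)) + ∑ j : Fin (n + 1), f (Fin.contractNth j (· * ·) g)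

theorem neg_one_F4 : (-1 : F4) = 1 := CharTwo.neg_eq 1

theorem cd_eq_d (ρ : Representation F4 G V) (f : (Fin n → G) → V) :
    cd ρ f = inhomogeneousCochains.d (Rep.of ρ) n f := by
  funext g
  change _ = ρ (g 0) (f (Fin.tail g)) + ∑ j : Fin (n + 1),
    (-1 : F4) ^ ((j : ℕ) + 1) • f (Fin.contractNth j (· * ·) g)
  simp only [cd, neg_one_F4, one_pow, one_smul]

theorem cd_cd (ρ : Representation F4 G V) (f : (Fin n → G) → V) : cd ρ (cd ρ f) = 0 := by
  rw [cd_eq_d, cd_eq_d]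
  have h := groupCohomology.inhomogeneousCochains.d_comp_d (A := Rep.of ρ) n
  exact congrArg (fun φ => φ.hom f) h

theorem cd_add (ρ : Representation F4 G V) (f f' : (Fin n → G) → V) :
    cd ρ (f + f') = cd ρ f + cd ρ f' := by
  rw [cd_eq_d, cd_eq_d, cd_eq_d]
  exact map_add (inhomogeneousCochains.d (Rep.of ρ) n).hom f f'

theorem cd_zero (ρ : Representation F4 G V) : cd ρ (0 : (Fin n → G) → V) = 0 := by
  rw [cd_eq_d]
  exact map_zero (inhomogeneousCochains.d (Rep.of ρ) n).hom

theorem add_self_F4 (v : V) : v + v = 0 := by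
  rw [← two_smul F4 v, two_F4, zero_smul]

/-- Product of an operator-valued 1-cochain with a cochain. -/
def cupD (a : G → V →ₗ[F4] V') (f : (Fin n → G) → V) : (Fin (n + 1) → G) → V' :=
  fun g => a (g 0) (f (Fin.tail g))

theorem cupD_add (a : G → V →ₗ[F4] V') (f f' : (Fin n → G) → V) :
    cupD a (f + f') = cupD a f + cupD a f' := funext fun g => map_add (a (g 0)) _ _

theorem cupD_zero (a : G → V →ₗ[F4] V') : cupD a (0 : (Fin n → G) → V) = 0 :=
  funext fun g => map_zero (a (g 0))

/-- The Leibniz rule, for an operator-valued cochain with a defect. -/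
theorem cd_cupD_defect {ρ : Representation F4 G V} {ρ' : Representation F4 G V'}
    {a : G → V →ₗ[F4] V'} {D : G → G → V → V'}
    (ha : ∀ g h v, a (g * h) v = ρ' g (a h v) + a g (ρ h v) + D g h v) (f : (Fin n → G) → V) :
    cd ρ' (cupD a f) = cupD a (cd ρ f) + fun g => D (g 0) (g 1) (f (Fin.tail (Fin.tail g))) := by
  funext g
  have e : ∀ j : Fin (n + 1), (cupD a f) (Fin.contractNth j.succ (· * ·) g)
      = a (g 0) (f (Fin.contractNth j (· * ·) (Fin.tail g))) := by
    intro j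
    simp only [cupD, tail_contractNth]
    rfl
  have e0 : (cupD a f) (Fin.contractNth 0 (· * ·) g)
      = a (g 0 * g 1) (f (Fin.tail (Fin.tail g))) := rfl
  have e2 : cupD a (cd ρ f) g = a (g 0) (ρ (g 1) (f (Fin.tail (Fin.tail g)))) +
      ∑ j : Fin (n + 1), a (g 0) (f (Fin.contractNth j (· * ·) (Fin.tail g))) := by
    simp only [cupD, cd, map_add, map_sum]
    rfl
  have e3 : cupD a f (Fin.tail g) = a (g 1) (f (Fin.tail (Fin.tail g))) := rfl
  rw [Pi.add_apply, e2, cd, Fin.sum_univ_succ, e0, ha, e3]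
  simp only [e]
  have key : ∀ X B C D : V', X + (X + B + C + D) = B + D + C := fun X B C D => by
    have := add_self_F4 X
    calc X + (X + B + C + D) = (X + X) + (B + D + C) := by abel
      _ = _ := by rw [this, zero_add]
  exact key _ _ _ _

theorem cd_cupD {ρ : Representation F4 G V} {ρ' : Representation F4 G V'} {a : G → V →ₗ[F4] V'}
    (ha : ∀ g h v, a (g * h) v = ρ' g (a h v) + a g (ρ h v)) (f : (Fin n → G) → V) :
    cd ρ' (cupD a f) = cupD a (cd ρ f) := by
  rw [cd_cupD_defect (ρ := ρ) (D := fun _ _ _ => 0) (fun g h v => by rw [ha, add_zero])]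
  exact add_zero _

/-- A linear map applied to a coboundary, with its failure to be equivariant. -/
theorem map_cd {ρ : Representation F4 G V} {ρ' : Representation F4 G V'} {q : V →ₗ[F4] V'}
    {r : G → V → V'} {M : Submodule F4 V} (hq : ∀ g, ∀ v ∈ M, q (ρ g v) = ρ' g (q v) + r g v)
    {f : (Fin n → G) → V} (hf : ∀ g, f g ∈ M) :
    (fun g => q (cd ρ f g)) = cd ρ' (fun g => q (f g)) + fun g => r (g 0) (f (Fin.tail g)) := by
  funext g
  simp only [cd, map_add, map_sum, hq _ _ (hf _), Pi.add_apply]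
  abel

theorem map_cd' {ρ : Representation F4 G V} {ρ' : Representation F4 G V'} {q : V →ₗ[F4] V'}
    (hq : ∀ g v, q (ρ g v) = ρ' g (q v)) (f : (Fin n → G) → V) :
    (fun g => q (cd ρ f g)) = cd ρ' (fun g => q (f g)) := by
  rw [map_cd (ρ := ρ) (r := fun _ _ => 0) (M := ⊤) (fun g v _ => by rw [hq, add_zero])
    (fun _ => trivial)]
  exact add_zero _

theorem cd_mem {ρ : Representation F4 G V} {M : Submodule F4 V} (hM : ∀ g, ∀ v ∈ M, ρ g v ∈ M)
    {f : (Fin n → G) → V} (hf : ∀ g, f g ∈ M) (g : Fin (n + 1) → G) : cd ρ f g ∈ M :=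
  add_mem (hM _ _ (hf _)) (sum_mem fun _ _ => hf _)

end Cochains

/-! ### Weights -/

/-- The powers of the character `l`. -/
def wt (i : ZMod 3) : G24 →* F4 := ((Units.coeHom F4).comp lHom) ^ i.val

theorem wt_apply (i : ZMod 3) (g : G24) : wt i g = (ll g : F4) ^ i.val := rfl

theorem wt_add (i j : ZMod 3) (g : G24) : wt (i + j) g = wt i g * wt j g := by
  rw [wt_apply, wt_apply, wt_apply, ← pow_add, ZMod.val_add, eq_comm]
  exact pow_eq_pow_mod _ (ll_cube g)

theorem wt_zero (g : G24) : wt 0 g = 1 := by rw [wt_apply]; simp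

theorem wt_one (g : G24) : wt 1 g = ll g := by
  rw [wt_apply, ZMod.val_one]; simp

theorem wt_two (g : G24) : wt 2 g = (ll g : F4) ^ 2 := rfl

theorem wt_of_ll {g : G24} (h : ll g = 1) (i : ZMod 3) : wt i g = 1 := by
  rw [wt_apply, h, Units.val_one, one_pow]

/-- The one-dimensional representation of weight `i`. -/
def chi (i : ZMod 3) : Representation F4 G24 F4 where
  toFun g := LinearMap.mulLeft F4 (wt i g)
  map_one' := by ext; simp
  map_mul' g h := by ext; simp

theorem chi_apply (i : ZMod 3) (g : G24) (a : F4) : chi i g a = wt i g * a := rfl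

/-- The action on `𝔽₄((u₁))`, twisted by the character of weight `i`. -/
def rho (i : ZMod 3) : Representation F4 G24 KK where
  toFun g := wt i g • (act g).toLinearMap
  map_one' := by
    refine LinearMap.ext fun f => ?_
    change wt i 1 • act 1 f = f
    rw [map_one, one_smul, act_one_apply]
  map_mul' g h := by
    refine LinearMap.ext fun f => ?_
    change wt i (g * h) • act (g * h) f = wt i g • act g (wt i h • act h f)
    rw [map_mul, act_mul_apply, map_smul, smul_smul]

theorem rho_apply (i : ZMod 3) (g : G24) (f : KK) : rho i g f = wt i g • act g f := rfl

theorem rho_mul (i : ZMod 3) (g : G24) (f f' : KK) : rho i g (f * f') = act g f * rho i g f' := by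
  rw [rho_apply, rho_apply, map_mul, mul_smul_comm]

theorem rho_mem {i : ZMod 3} {t : ℤ} (g : G24) (f : KK) (hf : f ∈ Mt t) : rho i g f ∈ Mt t :=
  (Mt t).smul_mem _ (act_mem hf)

/-- Multiplication by `h`. -/
def HH1 (i : ZMod 3) (g : G24) : KK →ₗ[F4] KK := LinearMap.mulLeft F4 (hh g) ∘ₗ rho i g

theorem HH1_apply (i : ZMod 3) (g : G24) (f : KK) : HH1 i g f = hh g * rho i g f := rfl

theorem HH1_mul (i : ZMod 3) (g h : G24) (f : KK) :
    HH1 i (g * h) f = rho i g (HH1 i h f) + HH1 i g (rho i h f) := by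
  rw [HH1_apply, HH1_apply, HH1_apply, hh_mul, rho_mul, map_mul, Module.End.mul_apply]
  ring

theorem hh_mem (g : G24) : hh g ∈ Mt 1 := by
  rw [hh_eq_affine]
  refine add_mem ((Mt 1).smul_mem _ ?_) (Mt_mono (by norm_num) (algebraMap_mem_Mt _))
  simpa using zpow_mem_Mt 1

theorem HH1_mem {i : ZMod 3} {t s : ℤ} (hs : s = t + 1) (g : G24) {f : KK} (hf : f ∈ Mt t) :
    HH1 i g f ∈ Mt s := by
  rw [HH1_apply, hs, add_comm]
  exact mul_mem_Mt (hh_mem g) (rho_mem g f hf)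

theorem hh_mem_Poly (g : G24) : hh g ∈ Poly := by
  rw [hh_eq_affine]
  exact add_mem (Poly.smul_mem zz_mem_Poly _) (Poly.algebraMap_mem _)

theorem rho_mem_Poly {i : ZMod 3} (g : G24) {f : KK} (hf : f ∈ Poly) : rho i g f ∈ Poly := by
  refine Poly.smul_mem ?_ _
  have h : Poly ≤ Poly.comap (act g) := by
    rw [Poly, Algebra.adjoin_le_iff]
    rintro _ rfl
    change act g zz ∈ Poly
    rw [act_z']
    exact add_mem (Poly.smul_mem zz_mem_Poly _) (Poly.algebraMap_mem _)
  exact h hf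

theorem pr_rho (i : ZMod 3) (g : G24) (f : KK) : pr (rho i g f) = rho i g (pr f) := by
  have h1 : rho i g f = rho i g (pr f) + rho i g (f - pr f) := by
    rw [← map_add, add_sub_cancel]
  rw [h1, map_add, pr_of_mem (rho_mem g _ (pr_mem f)), pr_of_mem_Poly (rho_mem_Poly g (sub_pr_mem f)),
    add_zero]

/-! ### Traces -/

instance : Finite G24 :=
  Finite.of_injective (fun γ => (ll γ, sg γ, ta γ)) fun γ δ h => by
    simp only [Prod.mk.injEq] at h
    exact coords_injective h.1 h.2.1 h.2.2

instance : DecidableEq F4 := Classical.decEq F4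

instance : Fintype G24 := Fintype.ofFinite G24

/-- An indexing of the group by `l`, `σ` and the choice of a root `τ`, which turns sums over the
group into iterated sums. -/
theorem exists_coords (p : F4ˣ × F4 × Bool) : ∃ γ : G24, ll γ = p.1 ∧ sg γ = p.2.1 ∧
    ta γ = (exists_artinSchreier p.2.1).choose + if p.2.2 then 1 else 0 := by
  have h := (exists_artinSchreier p.2.1).choose_spec
  apply coords_surjective
  split_ifs
  · linear_combination h + ((exists_artinSchreier p.2.1).choose + 1) * two_F4
  · linear_combination h

theorem exists_coords_bijective : Function.Bijective fun p => (exists_coords p).choose := by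
  constructor
  · rintro ⟨c, s, b⟩ ⟨c', s', b'⟩ h
    obtain ⟨h1, h2, h3⟩ := (exists_coords (c, s, b)).choose_spec
    obtain ⟨h1', h2', h3'⟩ := (exists_coords (c', s', b')).choose_spec
    replace h : (exists_coords (c, s, b)).choose = (exists_coords (c', s', b')).choose := h
    rw [h] at h1 h2 h3
    obtain rfl : c = c' := h1.symm.trans h1'
    obtain rfl : s = s' := h2.symm.trans h2'
    rw [h3'] at h3
    have h4 := add_left_cancel h3
    obtain rfl : b = b' := by
      revert h4
      cases b <;> cases b' <;> simp
    rfl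
  · intro γ
    have hs := (exists_artinSchreier (sg γ)).choose_spec
    set t := (exists_artinSchreier (sg γ)).choose with ht
    have h2 : (ta γ - t) * (ta γ - t - 1) = 0 := by
      linear_combination ta_sq γ - hs + (-ta γ * t + t ^ 2 - ta γ + t) * two_F4
    rcases mul_eq_zero.1 h2 with h | h
    · refine ⟨(ll γ, sg γ, false), ?_⟩
      obtain ⟨h1, h2, h3⟩ := (exists_coords (ll γ, sg γ, false)).choose_spec
      refine coords_injective h1 h2 (h3.trans ?_)
      simp only [← ht]
      simp
      linear_combination -h
    · refine ⟨(ll γ, sg γ, true), ?_⟩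
      obtain ⟨h1, h2, h3⟩ := (exists_coords (ll γ, sg γ, true)).choose_spec
      refine coords_injective h1 h2 (h3.trans ?_)
      simp only [← ht]
      simp
      linear_combination -h

theorem act_zz_cube (g : G24) : act g (zz ^ 3) = (zz + algebraMap F4 KK (sg g)) ^ 3 := by
  rw [map_pow, act_z, Units.smul_def, Algebra.smul_def, mul_pow, ← map_pow,
    F4_pow_three (Units.ne_zero _), map_one, one_mul]

/-- The power sums of `𝔽₄` with exponents `0`, `1`, `2` vanish, and the one with exponent `3` is `3
= 1`. -/
theorem sum_F4_cube : ∑ s : F4, (zz + algebraMap F4 KK s) ^ 3 = 1 := by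
  have hc : (Fintype.card F4 : KK) = 0 := by
    rw [card_F4]; push_cast; linear_combination 2 * two_KK
  have h1 : ∑ s : F4, s = 0 := by
    simpa using FiniteField.sum_pow_lt_card_sub_one F4 1 (by rw [card_F4]; norm_num)
  have h1' : ∑ s : F4, algebraMap F4 KK s = 0 := by rw [← map_sum, h1, map_zero]
  have h2 : ∑ s : F4, s ^ 2 = 0 :=
    FiniteField.sum_pow_lt_card_sub_one F4 2 (by rw [card_F4]; norm_num)
  have h3 : ∑ s : F4, s ^ 3 = 1 := by
    classical
    have : ∀ s : F4, s ^ 3 = 1 - if s = 0 then 1 else 0 := by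
      intro s
      split_ifs with h
      · rw [h]; ring
      · rw [F4_pow_three h]; ring
    simp only [this, Finset.sum_sub_distrib, Finset.sum_ite_eq', Finset.sum_const, Finset.card_univ,
      card_F4]
    simp
    linear_combination two_F4
  have e : ∀ s : F4, (zz + algebraMap F4 KK s) ^ 3 = zz ^ 3 + 3 * zz ^ 2 * algebraMap F4 KK s +
      3 * zz * algebraMap F4 KK (s ^ 2) + algebraMap F4 KK (s ^ 3) := by
    intro s; rw [map_pow, map_pow]; ring
  simp only [e, Finset.sum_add_distrib, ← Finset.mul_sum, h1', ← map_sum, h2, h3, map_zero, map_one,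
    Finset.sum_const, Finset.card_univ, nsmul_eq_mul, hc]
  ring

/-- The summand does not depend on `τ`, so the terms of `γ` and `-γ` cancel. -/
theorem sum_act_cube : ∑ g : G24, act g (zz ^ 3) = 0 := by
  rw [← exists_coords_bijective.sum_comp (fun g => act g (zz ^ 3))]
  simp only [act_zz_cube, (exists_coords _).choose_spec.2.1, Fintype.sum_prod_type, Fintype.sum_bool,
    add_self_F4]
  simp

/-- The values of `h` at `γ` and `-γ` differ by `1`, so together these two elements contribute
`γ(z³)`. The remaining sum over `σ` is `sum_F4_cube`, repeated for three values of `l`. -/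
theorem sum_act_cube_mul_hh : ∑ g : G24, act g (zz ^ 3) * hh g = 1 := by
  rw [← exists_coords_bijective.sum_comp (fun g => act g (zz ^ 3) * hh g)]
  have e : ∀ (A B C : KK), A * (B + (C + 1)) + A * (B + C) = A := fun A B C => by
    linear_combination A * (B + C) * two_KK
  simp only [act_zz_cube, hh_eq_affine, (exists_coords _).choose_spec.2.1,
    (exists_coords _).choose_spec.2.2, Fintype.sum_prod_type, Fintype.sum_bool, map_add,
    if_true, map_one, Bool.false_eq_true, if_false, map_zero, add_zero, e, sum_F4_cube]
  rw [Finset.sum_const, Finset.card_univ, Fintype.card_units, card_F4, nsmul_eq_mul]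
  push_cast
  linear_combination two_KK

end EllCohomology
end

open CategoryTheory
noncomputable section
namespace EllCohomology

/-! ### Coordinates on the series with a pole of order at most three -/

/-- The coefficient of `zʲ`. -/
def qc (j : ℤ) : KK →ₗ[F4] F4 where
  toFun f := f.coeff (-j)
  map_add' f g := HahnSeries.coeff_add
  map_smul' a f := HahnSeries.coeff_smul

theorem qc_apply (j : ℤ) (f : KK) : qc j f = f.coeff (-j) := rfl

theorem qc_of_mem {t j : ℤ} {f : KK} (hf : f ∈ Mt t) (h : t < j) : qc j f = 0 := hf _ (by omega)

theorem mem_Mt_of_qc {t s : ℤ} {f : KK} (hf : f ∈ Mt t) (h : qc t f = 0) (hs : s = t - 1) :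
    f ∈ Mt s := hs ▸ mem_Mt_pred hf h

theorem qc_zpow (j n : ℤ) : qc j (zz ^ n) = if j = n then 1 else 0 := by
  rw [qc_apply, coeff_zz_zpow]
  simp only [neg_inj]

theorem qc_pow (j : ℤ) (n : ℕ) : qc j (zz ^ n) = if j = n then 1 else 0 := by
  rw [← zpow_natCast, qc_zpow]

theorem qc_zz (j : ℤ) : qc j zz = if j = 1 then 1 else 0 := by
  simpa using qc_pow j 1

theorem qc_algebraMap (j : ℤ) (a : F4) : qc j (algebraMap F4 KK a) = if j = 0 then a else 0 := by
  rw [qc_apply, coeff_algebraMap]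
  simp only [neg_eq_zero]

/-- The polynomial `a₃ z³ + a₂ z² + a₁ z + a₀`. -/
def cubic (a3 a2 a1 a0 : F4) : KK := a3 • zz ^ 3 + a2 • zz ^ 2 + a1 • zz + algebraMap F4 KK a0

theorem qc_cubic (a3 a2 a1 a0 : F4) {f : KK} (hf : f ∈ Mt (-1)) :
    qc 3 (cubic a3 a2 a1 a0 + f) = a3 ∧ qc 2 (cubic a3 a2 a1 a0 + f) = a2 ∧
    qc 1 (cubic a3 a2 a1 a0 + f) = a1 ∧ qc 0 (cubic a3 a2 a1 a0 + f) = a0 := by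
  refine ⟨?_, ?_, ?_, ?_⟩ <;> rw [map_add, qc_of_mem hf (by norm_num)] <;>
    simp [cubic, qc_pow, qc_zz, qc_algebraMap]

theorem exists_cubic {f : KK} (hf : f ∈ Mt 3) :
    ∃ f' ∈ Mt (-1), f = cubic (qc 3 f) (qc 2 f) (qc 1 f) (qc 0 f) + f' := by
  refine ⟨f - cubic (qc 3 f) (qc 2 f) (qc 1 f) (qc 0 f), ?_, by ring⟩
  have h0 : zz ^ 3 ∈ Mt 3 := pow_mem_Mt 3
  have h1 : zz ^ 2 ∈ Mt 3 := Mt_mono (by norm_num) (pow_mem_Mt 2)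
  have h2 : zz ∈ Mt 3 := by simpa using Mt_mono (show (1 : ℤ) ≤ 3 by norm_num) (pow_mem_Mt 1)
  have h : f - cubic (qc 3 f) (qc 2 f) (qc 1 f) (qc 0 f) ∈ Mt 3 :=
    sub_mem hf (add_mem (add_mem (add_mem ((Mt 3).smul_mem _ h0) ((Mt 3).smul_mem _ h1))
      ((Mt 3).smul_mem _ h2)) (Mt_mono (by norm_num) (algebraMap_mem_Mt _)))
  have e := qc_cubic (qc 3 f) (qc 2 f) (qc 1 f) (qc 0 f) (zero_mem _)
  rw [add_zero] at e
  refine mem_Mt_of_qc (t := 0) (mem_Mt_of_qc (t := 1) (mem_Mt_of_qc (t := 2)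
    (mem_Mt_of_qc (t := 3) h ?_ (by norm_num)) ?_ (by norm_num)) ?_ (by norm_num)) ?_ (by norm_num)
  · rw [map_sub, e.1, sub_self]
  · rw [map_sub, e.2.1, sub_self]
  · rw [map_sub, e.2.2.1, sub_self]
  · rw [map_sub, e.2.2.2, sub_self]

theorem rho_cubic (i : ZMod 3) (g : G24) (a3 a2 a1 a0 : F4) :
    rho i g (cubic a3 a2 a1 a0) = cubic (wt i g * a3) (wt (i + 1) g * a2 + sg g * wt i g * a3)
      (wt (i + 2) g * a1 + sg g ^ 2 * wt i g * a3)
      (wt i g * a0 + sg g ^ 3 * wt i g * a3 + sg g ^ 2 * wt (i + 1) g * a2 +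
        sg g * wt (i + 2) g * a1) := by
  have h3 : algebraMap F4 KK (ll g) ^ 3 = 1 := by rw [← map_pow, ll_cube, map_one]
  rw [rho_apply, cubic, cubic]
  simp only [map_add, map_smul, map_pow, act_z', AlgHom.commutes, ll_inv, wt_add, wt_one, wt_two,
    Algebra.smul_def, map_mul]
  set l := algebraMap F4 KK (ll g)
  set s := algebraMap F4 KK (sg g)
  set w := algebraMap F4 KK (wt i g)
  set b3 := algebraMap F4 KK a3
  set b2 := algebraMap F4 KK a2
  linear_combination (w * b3 * (zz + s) ^ 3 * (l ^ 3 + 1) +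
    w * b2 * (zz + s) ^ 2 * l) * h3 + (w * b3 * (zz ^ 2 * s + zz * s ^ 2)
      + w * b2 * l * zz * s) * two_KK

theorem qc_rho {i : ZMod 3} {f : KK} (hf : f ∈ Mt 3) (g : G24) :
    qc 3 (rho i g f) = wt i g * qc 3 f ∧
    qc 2 (rho i g f) = wt (i + 1) g * qc 2 f + sg g * wt i g * qc 3 f ∧
    qc 1 (rho i g f) = wt (i + 2) g * qc 1 f + sg g ^ 2 * wt i g * qc 3 f ∧
    qc 0 (rho i g f) = wt i g * qc 0 f + sg g ^ 3 * wt i g * qc 3 f +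
      sg g ^ 2 * wt (i + 1) g * qc 2 f + sg g * wt (i + 2) g * qc 1 f := by
  obtain ⟨f', hf', h⟩ := exists_cubic hf
  have h2 : rho i g f = _ := (congrArg (rho i g) h).trans (map_add _ _ _)
  rw [rho_cubic] at h2
  have e := qc_cubic (wt i g * qc 3 f) (wt (i + 1) g * qc 2 f + sg g * wt i g * qc 3 f)
      (wt (i + 2) g * qc 1 f + sg g ^ 2 * wt i g * qc 3 f)
      (wt i g * qc 0 f + sg g ^ 3 * wt i g * qc 3 f + sg g ^ 2 * wt (i + 1) g * qc 2 f +
        sg g * wt (i + 2) g * qc 1 f) (rho_mem (i := i) g _ hf')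
  rwa [← h2] at e

theorem exists_ll_one (s : F4) : ∃ g : G24, ll g = 1 ∧ sg g = s := by
  obtain ⟨t, ht⟩ := exists_artinSchreier s
  obtain ⟨g, h1, h2, -⟩ := coords_surjective 1 ht
  exact ⟨g, h1, h2⟩

/-- Summing over the three nonzero `s` kills the left side and gives `c = 0`; then `s = 1` and `s =
ω` give two independent equations. The unknown constant `c` is allowed for the application in
`words_two_injective`. -/
theorem eq_zero_of_quadratic {a b c : F4} (h : ∀ s : F4, s ≠ 0 → s * a + s ^ 2 * b = c) :
    a = 0 ∧ b = 0 := by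
  have e1 := h 1 one_ne_zero
  have e2 := h ω ω_ne_zero
  have e3 := h (ω ^ 2) (pow_ne_zero _ ω_ne_zero)
  have hω := ω_sq
  have h4 : ω ^ 4 = ω := F4_pow_four ω
  have hc : c = 0 := by
    linear_combination -(e1 + e2 + e3) + a * hω + b * hω + b * h4 - c * two_F4
  have ha : a = b := by linear_combination e1 + hc - b * two_F4
  have : b = 0 := by linear_combination - e2 + (ω * ha) + b * hω - hc
  exact ⟨by rw [ha, this], this⟩

/-- Under a translation `z ↦ z + s` the quadratic coefficient changes by `s` times the cubic one,
which must therefore vanish. The constant term then gives `s a₁ + s² a₂ = 0` for all `s`. -/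
theorem mem_of_invariant_three {i : ZMod 3} {f : KK} (hf : f ∈ Mt 3) (h : ∀ g, rho i g f = f) :
    f ∈ Mt 0 := by
  have key : ∀ s : F4, s * qc 3 f = 0 ∧ s ^ 3 * qc 3 f + s ^ 2 * qc 2 f + s * qc 1 f = 0 := by
    intro s
    obtain ⟨g, hl, rfl⟩ := exists_ll_one s
    obtain ⟨-, h2, -, h0⟩ := qc_rho (i := i) hf g
    simp only [h, wt_of_ll hl, one_mul, mul_one] at h2 h0
    exact ⟨by linear_combination -h2, by linear_combination -h0⟩
  have h3 : qc 3 f = 0 := by simpa using (key 1).1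
  obtain ⟨h1, h2⟩ := eq_zero_of_quadratic (a := qc 1 f) (b := qc 2 f) (c := 0) fun s _ => by
    have := (key s).2
    rw [h3] at this
    linear_combination this
  exact mem_Mt_of_qc (t := 1) (mem_Mt_of_qc (t := 2) (mem_Mt_of_qc (t := 3) hf h3 (by norm_num)) h2
    (by norm_num)) h1 (by norm_num)

/-! ### The norm form -/

/-- The polynomial `N = z⁴ + z`, which spans a line stable under the group. -/
def Nz : KK := zz ^ 4 + zz

/-- `N` is the product of the `z + s` over `s ∈ 𝔽₄`: translations permute the factors and scaling
contributes `l⁻⁴ = l²`. -/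
theorem act_Nz (g : G24) : act g Nz = wt 2 g • Nz := by
  have h3 : algebraMap F4 KK (ll g) ^ 3 = 1 := by rw [← map_pow, ll_cube, map_one]
  have h4 : algebraMap F4 KK (sg g) ^ 4 = algebraMap F4 KK (sg g) := by rw [← map_pow, F4_pow_four]
  simp only [Nz, map_add, map_pow, act_z', ll_inv, wt_two, Algebra.smul_def, map_mul]
  set l := algebraMap F4 KK (ll g)
  set s := algebraMap F4 KK (sg g)
  linear_combination (zz + s) ^ 4 * l ^ 2 * (l ^ 3 + 1) * h3 + l ^ 2 * h4 + l ^ 2 * (2 * zz ^ 3 * s +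
    3 * zz ^ 2 * s ^ 2 + 2 * zz * s ^ 3 + s) * two_KK

theorem Nz_eq : Nz = zz ^ (4 : ℤ) * (((1 + PowerSeries.X ^ 3 : PowerSeries F4)) : KK) := by
  have h : zz ≠ 0 := zz_ne_zero
  rw [map_add, map_one, map_pow, ← zz_inv, Nz, zpow_ofNat]
  field_simp

theorem exists_unit_Nz_zpow (q : ℤ) : ∃ p : PowerSeries F4, Nz ^ q = zz ^ (4 * q) * (p : KK) := by
  have hu : IsUnit (1 + PowerSeries.X ^ 3 : PowerSeries F4) := by
    rw [PowerSeries.isUnit_iff_constantCoeff]; simp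
  obtain ⟨v, hv⟩ := hu
  refine ⟨((v ^ q : (PowerSeries F4)ˣ) : PowerSeries F4), ?_⟩
  have h : ((((v ^ q : (PowerSeries F4)ˣ)) : PowerSeries F4) : KK) =
      ((v : PowerSeries F4) : KK) ^ q := by
    have := map_zpow (Units.map (HahnSeries.ofPowerSeries ℤ F4).toMonoidHom) v q
    have h2 := congrArg Units.val this
    rwa [Units.val_zpow_eq_zpow_val] at h2
  rw [h, hv, Nz_eq, mul_zpow, ← zpow_mul]

theorem Nz_zpow_mem (q : ℤ) : Nz ^ q ∈ Mt (4 * q) := mem_Mt_iff.2 (exists_unit_Nz_zpow q)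

theorem Nz_ne_zero : Nz ≠ 0 := by
  intro h
  have h2 := congrArg (qc 4) h
  simp [Nz, qc_pow, qc_zz] at h2

theorem rho_Nz_mul (i : ZMod 3) (g : G24) (f : KK) :
    rho (i + 1) g (Nz * f) = Nz * rho i g f := by
  have h : wt (i + 1) g * wt 2 g = wt i g := by
    rw [← wt_add, add_assoc, show (1 + 2 : ZMod 3) = 0 from rfl, add_zero]
  rw [rho_mul, act_Nz, rho_apply, rho_apply, ← h, smul_mul_smul_comm,
    mul_comm (wt 2 g), mul_smul_comm]

theorem rho_Nz_inv_mul (i : ZMod 3) (g : G24) (f : KK) :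
    rho i g (Nz⁻¹ * f) = Nz⁻¹ * rho (i + 1) g f := by
  have h := rho_Nz_mul i g (Nz⁻¹ * f)
  rw [mul_inv_cancel_left₀ Nz_ne_zero] at h
  rw [h, inv_mul_cancel_left₀ Nz_ne_zero]

/-- Periodicity: since `N` is `z⁴` times a unit, multiplication by `N^q` identifies `Mt t` in twist
`i` with `Mt (4q + t)` in twist `i + q`. Statements about all `t` reduce to `t` modulo `4`. -/
theorem rho_Nz_zpow_mul (i : ZMod 3) (q : ℤ) (g : G24) (f : KK) :
    rho (i + q) g (Nz ^ q * f) = Nz ^ q * rho i g f := by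
  induction q using Int.induction_on generalizing f with
  | zero => simp
  | succ q ih =>
    have : i + ((q + 1 : ℤ) : ZMod 3) = i + ((q : ℤ) : ZMod 3) + 1 := by push_cast; ring
    rw [this, zpow_add_one₀ Nz_ne_zero, mul_comm (Nz ^ _), mul_assoc, rho_Nz_mul, ih]
    ring
  | pred q ih =>
    have : i + ((-q : ℤ) : ZMod 3) = i + ((-q - 1 : ℤ) : ZMod 3) + 1 := by push_cast; ring
    have h := ih f
    rw [this] at h
    rw [zpow_sub_one₀ Nz_ne_zero, mul_comm (Nz ^ _), mul_assoc, rho_Nz_inv_mul, h]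
    ring

theorem Nz_zpow_mul_mem {q t s : ℤ} (hs : s = 4 * q + t) {f : KK} (hf : f ∈ Mt t) :
    Nz ^ q * f ∈ Mt s := hs ▸ mul_mem_Mt (Nz_zpow_mem q) hf

theorem mem_of_invariant {i : ZMod 3} (q : ℤ) {f : KK} (hf : f ∈ Mt (4 * q + 3))
    (h : ∀ g, rho i g f = f) : f ∈ Mt (4 * q) := by
  have h0 := mem_of_invariant_three (i := i + ((-q : ℤ) : ZMod 3)) (f := Nz ^ (-q) * f)
    (Nz_zpow_mul_mem (by ring) hf) fun g => by rw [rho_Nz_zpow_mul, h]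
  have h1 := Nz_zpow_mul_mem (q := q) (s := 4 * q) (by ring) h0
  rwa [← mul_assoc, ← zpow_add₀ Nz_ne_zero, add_neg_cancel, zpow_zero, one_mul] at h1

/-! ### Averaging -/

section Averaging

variable {n : ℕ} {i : ZMod 3}

/-- The average of a cochain with weights `W`. -/
def avg (i : ZMod 3) (W : G24 → KK) (c : (Fin (n + 1) → G24) → KK) (g : Fin n → G24) : KK :=
  ∑ x, W x * rho i x (c (Fin.cons x⁻¹ g))

theorem contractNth_cons_succ (j : Fin (n + 1)) (x : G24) (g : Fin (n + 1) → G24) :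
    Fin.contractNth j.succ (· * ·) (Fin.cons x g : Fin (n + 2) → G24) =
      Fin.cons x (Fin.contractNth j (· * ·) g) := by
  funext k
  refine Fin.cases ?_ (fun k => ?_) k
  · simp [Fin.contractNth]
  · have := congrFun (tail_contractNth j (Fin.cons x g : Fin (n + 2) → G24)) k
    simpa [Fin.tail] using this

theorem contractNth_cons_zero (x : G24) (g : Fin (n + 1) → G24) :
    Fin.contractNth 0 (· * ·) (Fin.cons x g : Fin (n + 2) → G24) =
      Fin.cons (x * g 0) (Fin.tail g) := by
  funext k
  refine Fin.cases ?_ (fun k => ?_) k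
  · simp [Fin.contractNth]
  · simp [Fin.contractNth, Fin.tail]

/-- The cocycle identity for `(x⁻¹, g₀, g₁, …)`, acted on by `x`, weighted by `W x` and summed; the
substitution `x ↦ g₀x` brings the term with `x⁻¹g₀` into the stated form. For equivariant weights it
says that the coboundary of the average is the total weight times `c`. -/
theorem sum_avg {c : (Fin (n + 1) → G24) → KK} (hc : cd (rho i) c = 0) (W : G24 → KK)
    (g : Fin (n + 1) → G24) :
    (∑ x, W (g 0 * x) * rho i (g 0) (rho i x (c (Fin.cons x⁻¹ (Fin.tail g))))) +
      ∑ j : Fin (n + 1), avg i W c (Fin.contractNth j (· * ·) g) = (∑ x, W x) * c g := by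
  have key : ∀ x, W x * rho i x (c (Fin.cons (x⁻¹ * g 0) (Fin.tail g))) +
      ∑ j : Fin (n + 1), W x * rho i x (c (Fin.cons x⁻¹ (Fin.contractNth j (· * ·) g))) =
      W x * c g := by
    intro x
    have h := congrFun hc (Fin.cons x⁻¹ g)
    simp only [cd, Fin.cons_zero, Fin.tail_cons, Pi.zero_apply] at h
    rw [Fin.sum_univ_succ, contractNth_cons_zero] at h
    simp only [contractNth_cons_succ] at h
    have h2 := congrArg (fun f => W x * rho i x f) h
    simp only [map_add, map_zero, mul_zero, map_sum, mul_add, Finset.mul_sum] at h2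
    rw [← Module.End.mul_apply, ← map_mul, mul_inv_cancel, map_one, Module.End.one_apply] at h2
    linear_combination h2 - (W x * c g) * two_KK
  have e1 : ∑ x, W (g 0 * x) * rho i (g 0) (rho i x (c (Fin.cons x⁻¹ (Fin.tail g)))) =
      ∑ x, W x * rho i x (c (Fin.cons (x⁻¹ * g 0) (Fin.tail g))) := by
    rw [← Equiv.sum_comp (Equiv.mulLeft (g 0))
      (fun x => W x * rho i x (c (Fin.cons (x⁻¹ * g 0) (Fin.tail g))))]
    refine Finset.sum_congr rfl fun x _ => ?_
    simp [map_mul]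
  rw [e1, Finset.sum_mul]
  simp only [avg]
  rw [Finset.sum_comm, ← Finset.sum_add_distrib]
  exact Finset.sum_congr rfl fun x _ => key x

/-- The weights `x ↦ x(z³)`. -/
def cubeWeight (x : G24) : KK := act x (zz ^ 3)

theorem cubeWeight_mul (g x : G24) : cubeWeight (g * x) = act g (cubeWeight x) :=
  act_mul_apply _ _ _

theorem cd_avg_cube {c : (Fin (n + 1) → G24) → KK} (hc : cd (rho i) c = 0) :
    cd (rho i) (avg i cubeWeight c) = 0 := by
  funext g
  have h := sum_avg hc cubeWeight g
  rw [show ∑ x, cubeWeight x = 0 from sum_act_cube, zero_mul] at h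
  refine Eq.trans ?_ h
  simp only [cd]
  congr 1
  rw [avg, map_sum]
  simp only [rho_mul, cubeWeight_mul]

/-- The weights `x(z³) h(x)` have sum `1`, which would make `c` a coboundary if they were
equivariant. By `hh_mul` they fail to be so by `h(g)` times the weights of `cd_avg_cube`, hence the
product with `h`. -/
theorem cd_avg_cube_mul_hh {c : (Fin (n + 1) → G24) → KK} (hc : cd (rho i) c = 0) :
    cd (rho i) (avg i (fun x => cubeWeight x * hh x) c) + cupD (HH1 i) (avg i cubeWeight c) = c := by
  funext g
  have h := sum_avg hc (fun x => cubeWeight x * hh x) g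
  rw [show ∑ x, cubeWeight x * hh x = 1 from sum_act_cube_mul_hh, one_mul] at h
  refine Eq.trans ?_ h
  simp only [cd, Pi.add_apply, cupD]
  rw [add_right_comm]
  congr 1
  rw [HH1_apply]
  conv_lhs => simp only [avg, map_sum, rho_mul, map_mul]
  rw [Finset.mul_sum, ← Finset.sum_add_distrib]
  refine Finset.sum_congr rfl fun x _ => ?_
  simp only [cubeWeight_mul, hh_mul]
  ring

theorem pr_HH1 (g : G24) (f : KK) : pr (HH1 i g f) = pr (HH1 i g (pr f)) := by
  have h : HH1 i g f = HH1 i g (pr f) + HH1 i g (f - pr f) := by rw [← map_add, add_sub_cancel]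
  rw [h, map_add, pr_of_mem_Poly (f := HH1 i g (f - pr f)), add_zero]
  rw [HH1_apply]
  exact mul_mem (hh_mem_Poly g) (rho_mem_Poly g (sub_pr_mem f))

/-- The averages have uncontrolled poles. The projection `pr` commutes with the group, and
multiplication by `h` preserves polynomials, so applying `pr` to `cd_avg_cube_mul_hh` brings
everything back into `Mt (-1)`. -/
theorem exists_eq_pr_cup {c : (Fin (n + 1) → G24) → KK} (hc : cd (rho i) c = 0)
    (hM : ∀ g, c g ∈ Mt (-1)) : ∃ (b e : (Fin n → G24) → KK), cd (rho i) b = 0 ∧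
      (∀ g, b g ∈ Mt (-1)) ∧ (∀ g, e g ∈ Mt (-1)) ∧
      c = (fun g => pr (cupD (HH1 i) b g)) + cd (rho i) e := by
  refine ⟨fun g => pr (avg i cubeWeight c g),
    fun g => pr (avg i (fun x => cubeWeight x * hh x) c g), ?_, fun g => pr_mem _,
    fun g => pr_mem _, ?_⟩
  · rw [← map_cd' (pr_rho i), cd_avg_cube hc]
    exact funext fun g => map_zero pr
  · rw [← map_cd' (pr_rho i)]
    conv_lhs => rw [show c = fun g => pr (c g) from funext fun g => (pr_of_mem (hM g)).symm,
      ← cd_avg_cube_mul_hh hc]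
    funext g
    simp only [Pi.add_apply, map_add, cupD]
    rw [add_comm, pr_HH1]

/-- The products of an element with the powers of `h`. -/
def hpow (i : ZMod 3) (b : KK) : (n : ℕ) → (Fin n → G24) → KK
  | 0 => fun _ => b
  | n + 1 => cupD (HH1 i) (hpow i b n)

theorem hpow_mem {b : KK} {t : ℤ} (hb : b ∈ Mt t) (n : ℕ) (g : Fin n → G24) :
    hpow i b n g ∈ Mt (t + n) := by
  induction n with
  | zero => simpa [hpow] using hb
  | succ n ih => exact HH1_mem (by push_cast; ring) _ (ih _)

theorem cd_zero_cochain {G V : Type} [Group G] [AddCommGroup V] [Module F4 V]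
    (ρ : Representation F4 G V) (f : (Fin 0 → G) → V) (g : Fin 1 → G) :
    cd ρ f g = ρ (g 0) (f ![]) + f ![] := by
  rw [cd, Fin.sum_univ_one, Subsingleton.elim (Fin.tail g) ![],
    Subsingleton.elim (Fin.contractNth 0 (· * ·) g) ![]]

theorem eq_of_cd_zero_cochain {G V : Type} [Group G] [AddCommGroup V] [Module F4 V]
    {ρ : Representation F4 G V} {f : (Fin 0 → G) → V} (hf : cd ρ f = 0) (g : G) :
    ρ g (f ![]) = f ![] := by
  have h := congrFun hf ![g]
  rw [cd_zero_cochain] at h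
  have h2 := add_self_F4 (f ![])
  exact add_right_cancel (h.trans h2.symm)

/-- Each application of `exists_eq_pr_cup` peels off one factor `h`, until an invariant `b` of `Mt
(-1)` is left, which lies in `Mt (-4)` by `mem_of_invariant`. Three factors `h` raise the pole order
by at most three, so the product stays in `Mt (-1)` and the projection does nothing. This is the
source of the restriction to cohomological degrees at most three. -/
theorem cocycle_eq_hpow_neg (n : ℕ) (hn : n ≤ 2) {c : (Fin (n + 1) → G24) → KK}
    (hc : cd (rho i) c = 0) (hM : ∀ g, c g ∈ Mt (-1)) : ∃ b ∈ Mt (-4), (∀ g, rho i g b = b) ∧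
      ∃ e : (Fin n → G24) → KK, (∀ g, e g ∈ Mt (-1)) ∧ c = hpow i b (n + 1) + cd (rho i) e := by
  induction n with
  | zero =>
    obtain ⟨b, e, hb, hbM, heM, h⟩ := exists_eq_pr_cup hc hM
    have hinv := eq_of_cd_zero_cochain hb
    have hb4 : b ![] ∈ Mt (-4) := by
      have := mem_of_invariant (-1) (f := b ![]) (by norm_num; exact hbM _) hinv
      norm_num at this
      exact this
    refine ⟨b ![], hb4, hinv, e, heM, h.trans ?_⟩
    congr 1
    funext g
    simp only [cupD, hpow, Subsingleton.elim (Fin.tail g) ![]]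
    exact pr_of_mem (Mt_mono (by norm_num) (HH1_mem rfl _ hb4))
  | succ n ih =>
    obtain ⟨b, e, hb, hbM, heM, h⟩ := exists_eq_pr_cup hc hM
    obtain ⟨b0, hb0, hinv, e', he', h'⟩ := ih (by omega) hb hbM
    refine ⟨b0, hb0, hinv, (fun g => pr (cupD (HH1 i) e' g)) + e,
      fun g => add_mem (pr_mem _) (heM g), h.trans ?_⟩
    rw [cd_add, ← add_assoc]
    congr 1
    rw [h', ← map_cd' (pr_rho i), cd_cupD (HH1_mul i), cupD_add]
    funext g
    simp only [Pi.add_apply, map_add]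
    congr 1
    refine pr_of_mem (Mt_mono ?_ (hpow_mem hb0 (n + 2) g))
    push_cast
    omega

theorem HH1_Nz_zpow_mul (q : ℤ) (g : G24) (f : KK) :
    HH1 (i + q) g (Nz ^ q * f) = Nz ^ q * HH1 i g f := by
  rw [HH1_apply, HH1_apply, rho_Nz_zpow_mul]
  ring

theorem hpow_Nz_zpow_mul (q : ℤ) (b : KK) (n : ℕ) (g : Fin n → G24) :
    hpow (i + q) (Nz ^ q * b) n g = Nz ^ q * hpow i b n g := by
  induction n with
  | zero => rfl
  | succ n ih =>
    simp only [hpow, cupD, ih, HH1_Nz_zpow_mul]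

theorem cd_Nz_zpow_mul (q : ℤ) (f : (Fin n → G24) → KK) :
    cd (rho (i + q)) (fun g => Nz ^ q * f g) = fun g => Nz ^ q * cd (rho i) f g := by
  funext g
  simp only [cd, rho_Nz_zpow_mul, mul_add, Finset.mul_sum]

/-- Multiplication by `N^(-q-1)` reduces to `cocycle_eq_hpow_neg`. -/
theorem cocycle_eq_hpow (q : ℤ) {n : ℕ} (hn : n ≤ 2) {c : (Fin (n + 1) → G24) → KK}
    (hc : cd (rho i) c = 0) (hM : ∀ g, c g ∈ Mt (4 * q + 3)) :
    ∃ b ∈ Mt (4 * q), (∀ g, rho i g b = b) ∧ ∃ e : (Fin n → G24) → KK,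
      (∀ g, e g ∈ Mt (4 * q + 3)) ∧ c = hpow i b (n + 1) + cd (rho i) e := by
  obtain ⟨p, rfl⟩ : ∃ p, q = p - 1 := ⟨q + 1, by ring⟩
  obtain ⟨j, rfl⟩ : ∃ j : ZMod 3, i = j + p := ⟨i - p, by ring⟩
  have hN : ∀ f, Nz ^ p * (Nz ^ (-p) * f) = f := fun f => by
    rw [← mul_assoc, ← zpow_add₀ Nz_ne_zero, add_neg_cancel, zpow_zero, one_mul]
  have hj : j + (p : ZMod 3) + ((-p : ℤ) : ZMod 3) = j := by push_cast; ring
  have hc' := cd_Nz_zpow_mul (i := j + p) (-p) c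
  rw [hj, hc] at hc'
  obtain ⟨b, hb, hinv, e, he, h⟩ := cocycle_eq_hpow_neg n hn (i := j)
    (c := fun g => Nz ^ (-p) * c g) (hc'.trans (funext fun g => mul_zero _))
    fun g => Nz_zpow_mul_mem (by ring) (hM g)
  refine ⟨Nz ^ p * b, Nz_zpow_mul_mem (by ring) hb, fun g => by rw [rho_Nz_zpow_mul, hinv],
    fun g => Nz ^ p * e g, fun g => Nz_zpow_mul_mem (by ring) (he g), ?_⟩
  rw [cd_Nz_zpow_mul]
  funext g
  have hg := congrFun h g
  rw [Pi.add_apply, hpow_Nz_zpow_mul, ← mul_add]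
  rw [Pi.add_apply] at hg
  rw [← hg, hN]

end Averaging

end EllCohomology
end

open CategoryTheory
noncomputable section
namespace EllCohomology

/-! ### Cochains with values in the one-dimensional representations -/

theorem add_one_add_one (i : ZMod 3) : i + 1 + 1 = i + 2 := by revert i; decide
theorem add_one_add_two (i : ZMod 3) : i + 1 + 2 = i := by revert i; decide
theorem add_two_add_one (i : ZMod 3) : i + 2 + 1 = i := by revert i; decide
theorem add_two_add_two (i : ZMod 3) : i + 2 + 2 = i + 1 := by revert i; decide

/-- `n`-cochains with values in `𝔽₄`. -/
abbrev Coch (n : ℕ) : Type := (Fin n → G24) → F4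

theorem two_Coch {n : ℕ} : (2 : Coch n) = 0 := funext fun _ => two_F4

/-- The product with the cochain `σ`, which maps weight `i` to weight `i + 1`. -/
def S (i : ZMod 3) (g : G24) : F4 →ₗ[F4] F4 := LinearMap.mulLeft F4 (sg g * wt i g)

/-- The product with the cochain `σ²`, which maps weight `i` to weight `i + 2`. -/
def Sb (i : ZMod 3) (g : G24) : F4 →ₗ[F4] F4 := LinearMap.mulLeft F4 (sg g ^ 2 * wt i g)

/-- The product with the cochain `σ³`. -/
def U (i : ZMod 3) (g : G24) : F4 →ₗ[F4] F4 := LinearMap.mulLeft F4 (sg g ^ 3 * wt i g)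

/-- The product with the cochain `τ`. -/
def Ta (i : ZMod 3) (g : G24) : F4 →ₗ[F4] F4 := LinearMap.mulLeft F4 (ta g * wt i g)

theorem S_apply (i : ZMod 3) (g : G24) (a : F4) : S i g a = sg g * wt i g * a := rfl
theorem Sb_apply (i : ZMod 3) (g : G24) (a : F4) : Sb i g a = sg g ^ 2 * wt i g * a := rfl
theorem U_apply (i : ZMod 3) (g : G24) (a : F4) : U i g a = sg g ^ 3 * wt i g * a := rfl
theorem Ta_apply (i : ZMod 3) (g : G24) (a : F4) : Ta i g a = ta g * wt i g * a := rfl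

section

variable {n : ℕ} {i j : ZMod 3}

theorem cd_S (f : Coch n) (hj : i + 1 = j) :
    cd (chi j) (cupD (S i) f) = cupD (S i) (cd (chi i) f) := by
  subst hj
  refine cd_cupD (fun g h v => ?_) f
  simp only [S_apply, chi_apply, sg_mul, map_mul, wt_add, wt_one]
  ring

theorem cd_Sb (f : Coch n) (hj : i + 2 = j) :
    cd (chi j) (cupD (Sb i) f) = cupD (Sb i) (cd (chi i) f) := by
  subst hj
  refine cd_cupD (fun g h v => ?_) f
  simp only [Sb_apply, chi_apply, sg_mul, map_mul, wt_add, wt_two]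
  linear_combination wt i g * wt i h * v * sg g * ll g * sg h * two_F4

/-- The failure of `τ` to be additive, from `ta_mul`: on cocycles, the product with `τ` bounds `σ ·
σ²`. -/
theorem cd_Ta (f : Coch n) : cd (chi i) (cupD (Ta i) f) =
    cupD (Ta i) (cd (chi i) f) + cupD (S (i + 2)) (cupD (Sb i) f) := by
  refine cd_cupD_defect (D := fun g h v => S (i + 2) g (Sb i h v)) (fun g h v => ?_) f
  simp only [S_apply, Sb_apply, Ta_apply, chi_apply, ta_mul, map_mul, wt_add, wt_two]
  ring

/-- The two mixed terms in the expansion of `(σ + lσ')³`. They show that `σ² · σ` and `σ · σ²` are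
cohomologous. -/
theorem cd_U (f : Coch n) : cd (chi i) (cupD (U i) f) = cupD (U i) (cd (chi i) f) +
    (cupD (Sb (i + 1)) (cupD (S i) f) + cupD (S (i + 2)) (cupD (Sb i) f)) := by
  refine cd_cupD_defect (D := fun g h v => Sb (i + 1) g (S i h v) + S (i + 2) g (Sb i h v))
    (fun g h v => ?_) f
  simp only [S_apply, Sb_apply, U_apply, chi_apply, sg_mul, map_mul, wt_add, wt_two, wt_one]
  linear_combination (wt i g * wt i h * v * (sg g ^ 2 * ll g * sg h + sg g * ll g ^ 2 * sg h ^ 2)) *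
    two_F4 + wt i g * wt i h * v * sg h ^ 3 * ll_cube g

variable (n i) in
/-- The coboundaries. -/
def BB : AddSubgroup (Coch (n + 1)) where
  carrier := {c | ∃ e : Coch n, c = cd (chi i) e}
  add_mem' := by
    rintro _ _ ⟨e, rfl⟩ ⟨e', rfl⟩
    exact ⟨e + e', (cd_add _ _ _).symm⟩
  zero_mem' := ⟨0, (cd_zero _).symm⟩
  neg_mem' := by
    rintro _ ⟨e, rfl⟩
    exact ⟨e, by linear_combination -(cd (chi i) e) * two_Coch⟩

theorem cd_mem_BB (e : Coch n) : cd (chi i) e ∈ BB n i := ⟨e, rfl⟩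

theorem S_mem_BB {c : Coch (n + 1)} (hc : c ∈ BB n i) (hj : i + 1 = j) :
    cupD (S i) c ∈ BB (n + 1) j := by
  obtain ⟨e, rfl⟩ := hc
  exact ⟨_, (cd_S e hj).symm⟩

theorem Sb_mem_BB {c : Coch (n + 1)} (hc : c ∈ BB n i) (hj : i + 2 = j) :
    cupD (Sb i) c ∈ BB (n + 1) j := by
  obtain ⟨e, rfl⟩ := hc
  exact ⟨_, (cd_Sb e hj).symm⟩

theorem S_Sb_mem_BB {c : Coch n} (hc : cd (chi i) c = 0) (hj : i + 2 = j) :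
    cupD (S j) (cupD (Sb i) c) ∈ BB (n + 1) i := by
  subst hj
  exact ⟨cupD (Ta i) c, by rw [cd_Ta, hc, cupD_zero, zero_add]⟩

theorem Sb_S_mem_BB {c : Coch n} (hc : cd (chi i) c = 0) (hj : i + 1 = j) :
    cupD (Sb j) (cupD (S i) c) ∈ BB (n + 1) i := by
  subst hj
  have h : cd (chi i) (cupD (U i) c) ∈ BB (n + 1) i := cd_mem_BB _
  rw [cd_U, hc, cupD_zero, zero_add] at h
  exact (AddSubgroup.add_mem_cancel_right _ (S_Sb_mem_BB hc rfl)).1 h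

theorem cd_S_zero {c : Coch n} (hc : cd (chi i) c = 0) (hj : i + 1 = j) :
    cd (chi j) (cupD (S i) c) = 0 := by rw [cd_S c hj, hc, cupD_zero]

theorem cd_Sb_zero {c : Coch n} (hc : cd (chi i) c = 0) (hj : i + 2 = j) :
    cd (chi j) (cupD (Sb i) c) = 0 := by rw [cd_Sb c hj, hc, cupD_zero]

/-! ### Nonvanishing -/

theorem Coch_zero_ext {f f' : Coch 0} (h : f ![] = f' ![]) : f = f' := by
  funext x
  rw [Subsingleton.elim x ![], h]

/-- On elements with `l = 1` the characters are trivial and coboundaries of constants vanish; the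
values at all `σ` separate the two terms. -/
theorem words_one_injective {a b : ZMod 3} {f1 f2 : Coch 0}
    (h : cupD (S a) f1 + cupD (Sb b) f2 ∈ BB 0 i) : f1 = 0 ∧ f2 = 0 := by
  obtain ⟨e, h⟩ := h
  obtain ⟨h1, h2⟩ := eq_zero_of_quadratic (a := f1 ![]) (b := f2 ![]) (c := 0) fun s _ => by
    obtain ⟨g, hl, rfl⟩ := exists_ll_one s
    have h3 := congrFun h ![g]
    rw [cd_zero_cochain] at h3
    simp only [cupD, Pi.add_apply, S_apply, Sb_apply, chi_apply, Matrix.cons_val_zero, wt_of_ll hl,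
      mul_one, one_mul, add_self_F4, Subsingleton.elim (Fin.tail ![g]) ![]] at h3
    exact h3
  exact ⟨Coch_zero_ext h1, Coch_zero_ext h2⟩

theorem cd_one_cochain (e : Coch 1) (g h : G24) (hg : ll g = 1) :
    cd (chi i) e ![g, h] = e ![h] + e ![g * h] + e ![g] := by
  have e0 : Fin.contractNth (0 : Fin 2) (· * ·) ![g, h] = ![g * h] := by
    ext1 i; fin_cases i; rfl
  have e1 : Fin.contractNth (1 : Fin 2) (· * ·) ![g, h] = ![g] := by
    ext1 i; fin_cases i; rfl
  have e2 : Fin.tail ![g, h] = ![h] := by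
    ext1 i; fin_cases i; rfl
  rw [cd, Fin.sum_univ_two, e0, e1, e2, chi_apply, Matrix.cons_val_zero, wt_of_ll hg]
  ring

theorem cd_two_cochain (e : Coch 2) (g h k : G24) (hg : ll g = 1) :
    cd (chi i) e ![g, h, k] = e ![h, k] + e ![g * h, k] + e ![g, h * k] + e ![g, h] := by
  have e0 : Fin.contractNth (0 : Fin 3) (· * ·) ![g, h, k] = ![g * h, k] := by
    ext1 i; fin_cases i <;> rfl
  have e1 : Fin.contractNth (1 : Fin 3) (· * ·) ![g, h, k] = ![g, h * k] := by
    ext1 i; fin_cases i <;> rfl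
  have e3 : Fin.contractNth (2 : Fin 3) (· * ·) ![g, h, k] = ![g, h] := by
    ext1 i; fin_cases i <;> rfl
  have e2 : Fin.tail ![g, h, k] = ![h, k] := by
    ext1 i; fin_cases i <;> rfl
  rw [cd, Fin.sum_univ_three, e0, e1, e2, e3, chi_apply, Matrix.cons_val_zero, wt_of_ll hg]
  ring

theorem ext_of_ll_one {g h : G24} (hg : ll g = 1) (hh : ll h = 1) (h2 : sg g = sg h)
    (h3 : ta g = ta h) : g = h := coords_injective (hg.trans hh.symm) h2 h3

theorem ll_mul_one {g h : G24} (hg : ll g = 1) (hh : ll h = 1) : ll (g * h) = 1 := by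
  rw [ll_mul, hg, hh, one_mul]

theorem sg_mul_one {g : G24} (hg : ll g = 1) (h : G24) : sg (g * h) = sg g + sg h := by
  rw [sg_mul, hg, Units.val_one, one_mul]

theorem ta_mul_one {g : G24} (hg : ll g = 1) (h : G24) :
    ta (g * h) = ta g + ta h + sg g * sg h ^ 2 := by
  rw [ta_mul, hg, Units.val_one, one_pow, one_mul]

theorem mul_self_eq_eps {g : G24} (hg : ll g = 1) (hs : sg g ≠ 0) : g * g = eps := by
  obtain ⟨h1, h2, h3⟩ := coords_eps
  refine ext_of_ll_one (ll_mul_one hg hg) h1 ?_ ?_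
  · rw [sg_mul_one hg, h2, add_self_F4]
  · rw [ta_mul_one hg, h3, add_self_F4]
    linear_combination F4_pow_three hs

/-- If `l = 1` and `σ ≠ 0`, then `g² = -1`, so the coboundary of `e` at `(g, g)` is `e(-1)`,
independent of `g`. The left side there is `σ² f₁ + σ⁴ f₂`, with `σ⁴ = σ`. -/
theorem words_two_injective {a b a' b' : ZMod 3} {f1 f2 : Coch 0}
    (h : cupD (S a) (cupD (S b) f1) + cupD (Sb a') (cupD (Sb b') f2) ∈ BB 1 i) :
    f1 = 0 ∧ f2 = 0 := by
  obtain ⟨e, h⟩ := h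
  obtain ⟨h1, h2⟩ := eq_zero_of_quadratic (a := f2 ![]) (b := f1 ![]) (c := e ![eps])
    fun s hs => by
    obtain ⟨g, hl, rfl⟩ := exists_ll_one s
    have h3 := congrFun h ![g, g]
    rw [cd_one_cochain _ _ _ hl, mul_self_eq_eps hl hs] at h3
    simp only [cupD, Pi.add_apply, S_apply, Sb_apply, Matrix.cons_val_zero, wt_of_ll hl,
      mul_one, one_mul, Subsingleton.elim (Fin.tail (Fin.tail ![g, g])) ![]] at h3
    simp only [Fin.tail, Fin.succ_zero_eq_one, Matrix.cons_val_one, Matrix.cons_val_zero,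
      wt_of_ll hl, mul_one] at h3
    linear_combination h3 - f2 ![] * F4_pow_four (sg g) + e ![g] * two_F4
  exact ⟨Coch_zero_ext h2, Coch_zero_ext h1⟩

/-- Elements `i`, `j`, `k` of the quaternion group with `ij = k`, `ki = j`. -/
theorem exists_quaternion : ∃ p q r : G24, ll p = 1 ∧ ll q = 1 ∧ ll r = 1 ∧ sg p = 1 ∧ sg q = ω ∧
    sg r = ω + 1 ∧ p * q = r ∧ r * p = q ∧ p * p = eps ∧ q * q = eps ∧ r * r = eps := by
  have hω := ω_sq
  have h3 : ω ^ 3 = 1 := F4_pow_three ω_ne_zero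
  obtain ⟨p, p1, p2, p3⟩ := coords_surjective 1 (s := 1) (t := ω)
    (by linear_combination hω - two_F4)
  obtain ⟨q, q1, q2, q3⟩ := coords_surjective 1 (s := ω) (t := ω)
    (by linear_combination hω - two_F4 - h3)
  obtain ⟨r, r1, r2, r3⟩ := coords_surjective 1 (s := ω + 1) (t := ω + 1)
    (by linear_combination -h3 - ω ^ 2 * two_F4)
  have hr : sg r ≠ 0 := by
    rw [r2]
    intro h
    exact ω_ne_one (by linear_combination h - two_F4)
  refine ⟨p, q, r, p1, q1, r1, p2, q2, r2, ?_, ?_, mul_self_eq_eps p1 (by rw [p2]; exact one_ne_zero),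
    mul_self_eq_eps q1 (by rw [q2]; exact ω_ne_zero), mul_self_eq_eps r1 hr⟩
  · refine ext_of_ll_one (ll_mul_one p1 q1) r1 ?_ ?_
    · rw [sg_mul_one p1, p2, q2, r2]; ring
    · rw [ta_mul_one p1, p2, p3, q2, q3, r3]
      linear_combination hω - two_F4
  · refine ext_of_ll_one (ll_mul_one r1 p1) q1 ?_ ?_
    · rw [sg_mul_one r1, p2, q2, r2]; linear_combination two_F4
    · rw [ta_mul_one r1, p2, p3, q3, r3, r2]
      linear_combination (1 + ω) * two_F4

/-- The chain `[p|q|q] + [p|p|p] + [r|r|p] + [r|p|q]` is a cycle modulo `2`: its sixteen faces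
cancel in pairs. Coboundaries therefore vanish on it. -/
theorem cycle_sum (e : Coch 2) (x : G24 → F4) (f : F4)
    (h : ∀ g h k, ll g = 1 → ll h = 1 → ll k = 1 →
      cd (chi i) e ![g, h, k] = x g * x h * x k * f) {p q r : G24} (hp : ll p = 1) (hq : ll q = 1)
    (hr : ll r = 1) (h1 : p * q = r) (h2 : r * p = q) (hpp : p * p = eps) (hqq : q * q = eps)
    (hrr : r * r = eps) :
    (x p * x q * x q + x p * x p * x p + x r * x r * x p + x r * x p * x q) * f = 0 := by
  have e1 := h p q q hp hq hq
  have e2 := h p p p hp hp hp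
  have e3 := h r r p hr hr hp
  have e4 := h r p q hr hp hq
  rw [cd_two_cochain _ _ _ _ hp, h1, hqq] at e1
  rw [cd_two_cochain _ _ _ _ hp, hpp] at e2
  rw [cd_two_cochain _ _ _ _ hr, h2, hrr] at e3
  rw [cd_two_cochain _ _ _ _ hr, h1, h2] at e4
  linear_combination -e1 - e2 - e3 - e4 + (e ![q, q] + e ![r, q] + e ![p, eps] + e ![p, q] +
    e ![p, p] + e ![eps, p] + e ![r, p] + e ![r, r]) * two_F4

/-- The triple product of `σ` takes the value `ω² + ω = 1` on the cycle of `cycle_sum`. The next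
lemma is its Frobenius conjugate. -/
theorem S_S_S_injective {a b c : ZMod 3} {f : Coch 0}
    (h : cupD (S a) (cupD (S b) (cupD (S c) f)) ∈ BB 2 i) : f = 0 := by
  obtain ⟨e, h⟩ := h
  obtain ⟨p, q, r, p1, q1, r1, p2, q2, r2, h1, h2, h3, h4, h5⟩ := exists_quaternion
  have := cycle_sum (i := i) e sg (f ![]) (fun g h' k hg hh hk => by
    rw [← h]
    simp only [cupD, S_apply, Fin.tail, Matrix.cons_val_zero, Fin.succ_zero_eq_one,
      Matrix.cons_val_one, wt_of_ll hg, wt_of_ll hh, mul_one]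
    simp [wt_of_ll hk]
    ring) p1 q1 r1 h1 h2 h3 h4 h5
  rw [p2, q2, r2] at this
  refine Coch_zero_ext ?_
  linear_combination (norm := (simp; ring)) -this + 3 * f ![] * ω_sq

theorem Sb_Sb_Sb_injective {a b c : ZMod 3} {f : Coch 0}
    (h : cupD (Sb a) (cupD (Sb b) (cupD (Sb c) f)) ∈ BB 2 i) : f = 0 := by
  obtain ⟨e, h⟩ := h
  obtain ⟨p, q, r, p1, q1, r1, p2, q2, r2, h1, h2, h3, h4, h5⟩ := exists_quaternion
  have := cycle_sum (i := i) e (fun g => sg g ^ 2) (f ![]) (fun g h' k hg hh hk => by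
    rw [← h]
    simp only [cupD, Sb_apply, Fin.tail, Matrix.cons_val_zero, Fin.succ_zero_eq_one,
      Matrix.cons_val_one, wt_of_ll hg, wt_of_ll hh, mul_one]
    simp [wt_of_ll hk]
    ring) p1 q1 r1 h1 h2 h3 h4 h5
  rw [p2, q2, r2] at this
  refine Coch_zero_ext ?_
  linear_combination (norm := (simp; ring)) this - f ![] * 7 * ω_sq - f ![] * 3 * F4_pow_four ω -
    f ![] * 6 * F4_pow_three ω_ne_zero

end

end EllCohomology
end

open CategoryTheory
noncomputable section
namespace EllCohomology

/-! ### Cochains with values in Laurent series, in coordinates -/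

section

variable {n : ℕ} {i : ZMod 3}

/-- `n`-cochains with values in `𝔽₄((u₁))`. -/
abbrev KCoch (n : ℕ) : Type := (Fin n → G24) → KK

theorem two_KCoch : (2 : KCoch n) = 0 := funext fun _ => two_KK

/-- The coefficient of `zʲ` of a cochain. -/
def qC (j : ℤ) (E : KCoch n) : Coch n := fun g => qc j (E g)

theorem qC_add (j : ℤ) (E F : KCoch n) : qC j (E + F) = qC j E + qC j F :=
  funext fun g => map_add (qc j) (E g) (F g)

theorem qC_of_mem {j t : ℤ} {E : KCoch n} (hE : ∀ g, E g ∈ Mt t) (h : t < j) : qC j E = 0 :=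
  funext fun g => qc_of_mem (hE g) h

theorem mem_Mt_of_qC {t s : ℤ} {E : KCoch n} (hE : ∀ g, E g ∈ Mt t) (h : qC t E = 0)
    (hs : s = t - 1) (g : Fin n → G24) : E g ∈ Mt s := mem_Mt_of_qc (hE g) (congrFun h g) hs

theorem qC_three_cd {E : KCoch n} (hE : ∀ g, E g ∈ Mt 3) :
    qC 3 (cd (rho i) E) = cd (chi i) (qC 3 E) := by
  refine (map_cd (ρ' := chi i) (r := fun _ _ => 0) (M := Mt 3) (fun g v hv => ?_) hE).trans
    (add_zero _)
  rw [(qc_rho hv g).1, chi_apply, add_zero]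

/-- The action is triangular in the coordinates, see `qc_rho`: a coordinate of a coboundary is the
coboundary of that coordinate plus products of `σ`, `σ²`, `σ³` with higher coordinates. -/
theorem qC_two_cd {E : KCoch n} (hE : ∀ g, E g ∈ Mt 3) :
    qC 2 (cd (rho i) E) = cd (chi (i + 1)) (qC 2 E) + cupD (S i) (qC 3 E) :=
  map_cd (ρ' := chi (i + 1)) (r := fun g v => S i g (qc 3 v)) (M := Mt 3)
    (fun g _ hv => (qc_rho hv g).2.1) hE

theorem qC_one_cd {E : KCoch n} (hE : ∀ g, E g ∈ Mt 3) :
    qC 1 (cd (rho i) E) = cd (chi (i + 2)) (qC 1 E) + cupD (Sb i) (qC 3 E) :=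
  map_cd (ρ' := chi (i + 2)) (r := fun g v => Sb i g (qc 3 v)) (M := Mt 3)
    (fun g _ hv => (qc_rho hv g).2.2.1) hE

theorem qC_zero_cd {E : KCoch n} (hE : ∀ g, E g ∈ Mt 3) :
    qC 0 (cd (rho i) E) = cd (chi i) (qC 0 E) + (cupD (U i) (qC 3 E) +
      cupD (Sb (i + 1)) (qC 2 E) + cupD (S (i + 2)) (qC 1 E)) :=
  map_cd (ρ' := chi i)
    (r := fun g v => U i g (qc 3 v) + Sb (i + 1) g (qc 2 v) + S (i + 2) g (qc 1 v)) (M := Mt 3)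
    (fun g v hv => by
      rw [(qc_rho hv g).2.2.2, chi_apply, U_apply, Sb_apply, S_apply]; ring) hE

/-- The leading coefficient of `h = σ²z + τ` is `σ²`; the term with `τ` has too small a pole to
contribute. -/
theorem qc_HH1 {r : ℤ} {f : KK} (hf : f ∈ Mt r) (g : G24) :
    qc (r + 1) (HH1 i g f) = sg g ^ 2 * qc r (rho i g f) := by
  have h1 : HH1 i g f = sg g ^ 2 • (zz ^ (1 : ℤ) * rho i g f) + ta g • rho i g f := by
    rw [HH1_apply, hh_eq_affine, add_mul, smul_mul_assoc, ← Algebra.smul_def, zpow_one]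
  rw [h1, map_add, map_smul, map_smul, qc_of_mem (rho_mem g f hf) (lt_add_one r), smul_zero,
    add_zero, smul_eq_mul, qc_apply, coeff_zz_zpow_mul, qc_apply]
  congr 2
  ring

theorem qC_one_HH1 {E : KCoch n} (hE : ∀ g, E g ∈ Mt 0) :
    qC 1 (cupD (HH1 i) E) = cupD (Sb i) (qC 0 E) := by
  funext g
  have h := (qc_rho (i := i) (Mt_mono (by norm_num) (hE (Fin.tail g)) : _ ∈ Mt 3) (g 0)).2.2.2
  have h2 := qc_HH1 (i := i) (hE (Fin.tail g)) (g 0)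
  rw [h, qc_of_mem (j := 3) (hE _) (by norm_num), qc_of_mem (j := 2) (hE _) (by norm_num),
    qc_of_mem (j := 1) (hE _) (by norm_num)] at h2
  refine h2.trans ?_
  simp only [cupD, Sb_apply, qC]
  ring

theorem qC_two_HH1 {E : KCoch n} (hE : ∀ g, E g ∈ Mt 1) :
    qC 2 (cupD (HH1 i) E) = cupD (Sb (i + 2)) (qC 1 E) := by
  funext g
  have h := (qc_rho (i := i) (Mt_mono (by norm_num) (hE (Fin.tail g)) : _ ∈ Mt 3) (g 0)).2.2.1
  have h2 := qc_HH1 (i := i) (hE (Fin.tail g)) (g 0)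
  rw [h, qc_of_mem (j := 3) (hE _) (by norm_num)] at h2
  refine h2.trans ?_
  simp only [cupD, Sb_apply, qC]
  ring

theorem qC_three_HH1 {E : KCoch n} (hE : ∀ g, E g ∈ Mt 2) :
    qC 3 (cupD (HH1 i) E) = cupD (Sb (i + 1)) (qC 2 E) := by
  funext g
  have h := (qc_rho (i := i) (Mt_mono (by norm_num) (hE (Fin.tail g)) : _ ∈ Mt 3) (g 0)).2.1
  have h2 := qc_HH1 (i := i) (hE (Fin.tail g)) (g 0)
  rw [h, qc_of_mem (j := 3) (hE _) (by norm_num)] at h2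
  refine h2.trans ?_
  simp only [cupD, Sb_apply, qC]
  ring

/-- A cochain with values in `𝔽₄` as one with values in Laurent series. -/
def toK (c : Coch n) : KCoch n := fun g => algebraMap F4 KK (c g)

theorem toK_mem (c : Coch n) (g : Fin n → G24) : toK c g ∈ Mt 0 := algebraMap_mem_Mt _

theorem rho_algebraMap (g : G24) (a : F4) :
    rho i g (algebraMap F4 KK a) = algebraMap F4 KK (chi i g a) := by
  rw [rho_apply, AlgHom.commutes, chi_apply, map_mul, Algebra.smul_def]

theorem cd_toK (c : Coch n) : cd (rho i) (toK c) = toK (cd (chi i) c) := by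
  funext g
  simp only [cd, toK, map_add, map_sum, rho_algebraMap]

theorem qC_zero_toK (c : Coch n) : qC 0 (toK c) = c := by
  funext g
  simp [qC, toK, qc_algebraMap]

theorem qC_toK {j : ℤ} (hj : j ≠ 0) (c : Coch n) : qC j (toK c) = 0 := by
  funext g
  simp [qC, toK, qc_algebraMap, hj]

/-- An invariant without constant term lies in `Mt (-4)`, which leaves room for three factors `h`.
-/
theorem hpow_mem_neg {b : KK} (hb : b ∈ Mt 0) (hinv : ∀ g, rho i g b = b) (h0 : qc 0 b = 0)
    (hn : n ≤ 3) (g : Fin n → G24) : hpow i b n g ∈ Mt (-1) := by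
  have h1 : b ∈ Mt (-1) := mem_Mt_of_qc hb h0 (by norm_num)
  have h2 := mem_of_invariant (-1) (f := b) (by norm_num; exact h1) hinv
  norm_num at h2
  exact Mt_mono (by omega) (hpow_mem h2 n g)

/-- A cocycle with values in a one-dimensional representation, in terms of the coordinates of a
bounding cochain. -/
theorem exists_coordinates (hn : n ≤ 2) {c : Coch (n + 1)} (hc : cd (chi i) c = 0) :
    ∃ b ∈ Mt 0, (∀ g, rho i g b = b) ∧ ∃ E3 E2 E1 E0 : Coch n,
      qC 3 (hpow i b (n + 1)) + cd (chi i) E3 = 0 ∧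
      qC 2 (hpow i b (n + 1)) + cd (chi (i + 1)) E2 + cupD (S i) E3 = 0 ∧
      qC 1 (hpow i b (n + 1)) + cd (chi (i + 2)) E1 + cupD (Sb i) E3 = 0 ∧
      c = qC 0 (hpow i b (n + 1)) + cd (chi i) E0 + cupD (U i) E3 + cupD (Sb (i + 1)) E2 +
        cupD (S (i + 2)) E1 := by
  -- Constants lie in `Mt 3`, where cocycles are known. The four equations are the coefficients of
  -- `z³`, `z²`, `z` and `1`.
  obtain ⟨b, hb, hinv, E, hE, h⟩ := cocycle_eq_hpow 0 hn (i := i) (c := toK c)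
    (by rw [cd_toK, hc]; exact funext fun g => map_zero _)
    (fun g => Mt_mono (by norm_num) (toK_mem c g))
  norm_num at hb hE
  refine ⟨b, hb, hinv, qC 3 E, qC 2 E, qC 1 E, qC 0 E, ?_, ?_, ?_, ?_⟩
  · have := congrArg (qC 3) h
    rw [qC_add, qC_toK (by norm_num), qC_three_cd hE] at this
    exact this.symm
  · have := congrArg (qC 2) h
    rw [qC_add, qC_toK (by norm_num), qC_two_cd hE, ← add_assoc] at this
    exact this.symm
  · have := congrArg (qC 1) h
    rw [qC_add, qC_toK (by norm_num), qC_one_cd hE, ← add_assoc] at this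
    exact this.symm
  · have := congrArg (qC 0) h
    rw [qC_add, qC_zero_toK, qC_zero_cd hE] at this
    rw [this]
    ring

/-- The coefficient of `1` of an invariant series, as a 0-cochain. -/
def ct (b : KK) : Coch 0 := fun _ => qc 0 b

theorem qC_hpow_one {b : KK} (hb : b ∈ Mt 0) : qC 1 (hpow i b 1) = cupD (Sb i) (ct b) :=
  qC_one_HH1 (E := hpow i b 0) fun _ => hb

theorem qC_hpow_two {b : KK} (hb : b ∈ Mt 0) :
    qC 2 (hpow i b 2) = cupD (Sb (i + 2)) (cupD (Sb i) (ct b)) := by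
  rw [← qC_hpow_one hb]
  exact qC_two_HH1 fun g => by simpa using hpow_mem hb 1 g

theorem qC_hpow_three {b : KK} (hb : b ∈ Mt 0) :
    qC 3 (hpow i b 3) = cupD (Sb (i + 1)) (cupD (Sb (i + 2)) (cupD (Sb i) (ct b))) := by
  rw [← qC_hpow_two hb]
  exact qC_three_HH1 fun g => by simpa using hpow_mem hb 2 g

theorem qC_hpow_of_ct {b : KK} (hb : b ∈ Mt 0) (hinv : ∀ g, rho i g b = b) (h0 : ct b = 0)
    (hn : n ≤ 3) {j : ℤ} (hj : -1 < j) : qC j (hpow i b n) = 0 :=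
  qC_of_mem (hpow_mem_neg hb hinv (congrFun h0 ![]) hn) hj

/-! ### Generators of the cohomology of the one-dimensional representations -/

/-- The coefficient of `z²` makes `σE₃` a coboundary, so `E₃ = 0`; the coefficient of `z` then kills
the constant term of `b`. What is left says that `E₁` and `E₂` are invariant and that `c` is `σE₁ +
σ²E₂` up to a coboundary. -/
theorem cocycle_one_eq {c : Coch 1} (hc : cd (chi i) c = 0) : ∃ f1 f2 : Coch 0,
    cd (chi (i + 2)) f1 = 0 ∧ cd (chi (i + 1)) f2 = 0 ∧
      c + cupD (S (i + 2)) f1 + cupD (Sb (i + 1)) f2 ∈ BB 0 i := by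
  obtain ⟨b, hb, hinv, E3, E2, E1, E0, h3, h2, h1, h0⟩ := exists_coordinates (by norm_num) hc
  have hm : ∀ g, hpow i b 1 g ∈ Mt 1 := fun g => by simpa using hpow_mem hb 1 g
  simp only [Nat.reduceAdd] at h3 h2 h1 h0
  rw [qC_of_mem hm (by norm_num), zero_add (cd (chi (i + 1)) E2)] at h2
  obtain rfl : E3 = 0 := by
    refine (words_one_injective (i := i + 1) (a := i) (b := 0) (f2 := 0) ⟨E2, ?_⟩).1
    rw [cupD_zero]
    linear_combination h2 - cd (chi (i + 1)) E2 * two_Coch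
  rw [cupD_zero, add_zero] at h2
  rw [cupD_zero, add_zero, qC_hpow_one hb] at h1
  have hct : ct b = 0 := by
    refine (words_one_injective (i := i + 2) (a := 0) (b := i) (f1 := 0) ⟨E1, ?_⟩).2
    rw [cupD_zero]
    linear_combination h1 - cd (chi (i + 2)) E1 * two_Coch
  rw [hct, cupD_zero, zero_add (cd (chi (i + 2)) E1)] at h1
  rw [qC_hpow_of_ct hb hinv hct (by norm_num) (by norm_num), cupD_zero] at h0
  refine ⟨E1, E2, h1, h2, E0, ?_⟩
  linear_combination h0 + (cupD (Sb (i + 1)) E2 + cupD (S (i + 2)) E1) * two_Coch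

/-- If `E₃ = de`, then `E₂ + σe` and `E₁ + σ²e` are cocycles, and by `cd_U` this correction alters
`c` by a coboundary only. -/
theorem exists_decomposition {c : Coch (n + 2)} {E3 E2 E1 E0 : Coch (n + 1)}
    (h3 : E3 ∈ BB n i) (h2 : cd (chi (i + 1)) E2 + cupD (S i) E3 = 0)
    (h1 : cd (chi (i + 2)) E1 + cupD (Sb i) E3 = 0)
    (h0 : c = cd (chi i) E0 + cupD (U i) E3 + cupD (Sb (i + 1)) E2 + cupD (S (i + 2)) E1) :
    ∃ F2 F1 : Coch (n + 1), cd (chi (i + 1)) F2 = 0 ∧ cd (chi (i + 2)) F1 = 0 ∧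
      c + cupD (Sb (i + 1)) F2 + cupD (S (i + 2)) F1 ∈ BB (n + 1) i := by
  obtain ⟨e, rfl⟩ := h3
  refine ⟨E2 + cupD (S i) e, E1 + cupD (Sb i) e, ?_, ?_, E0 + cupD (U i) e, ?_⟩
  · rw [cd_add, cd_S e rfl, h2]
  · rw [cd_add, cd_Sb e rfl, h1]
  · rw [cd_add, cd_U, cupD_add, cupD_add]
    linear_combination h0 + (cupD (Sb (i + 1)) E2 + cupD (S (i + 2)) E1) * two_Coch

/-- Now `E₃` is a 1-cocycle, so it is a combination of `σ` and `σ²`. The coefficients of `z²` and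
`z`, the vanishing of mixed products and `words_two_injective` kill this combination and the
constant term of `b`. Then `c` is `σ²F₂ + σF₁` with 1-cocycles `F₂`, `F₁`, whose mixed terms again
disappear. -/
theorem cocycle_two_eq {c : Coch 2} (hc : cd (chi i) c = 0) : ∃ f1 f2 : Coch 0,
    cd (chi (i + 1)) f1 = 0 ∧ cd (chi (i + 2)) f2 = 0 ∧
      c + cupD (S (i + 2)) (cupD (S (i + 1)) f1) + cupD (Sb (i + 1)) (cupD (Sb (i + 2)) f2)
        ∈ BB 1 i := by
  obtain ⟨b, hb, hinv, E3, E2, E1, E0, h3, h2, h1, h0⟩ := exists_coordinates (by norm_num) hc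
  have hm : ∀ g, hpow i b 2 g ∈ Mt 2 := fun g => by simpa using hpow_mem hb 2 g
  simp only [Nat.reduceAdd] at h3 h2 h1 h0
  rw [qC_of_mem hm (by norm_num), zero_add] at h3
  obtain ⟨f1, f2, hf1, hf2, hE⟩ := cocycle_one_eq h3
  rw [qC_hpow_two hb] at h2
  have hSE := S_mem_BB hE rfl
  rw [cupD_add, cupD_add] at hSE
  have k1 := words_two_injective (i := i + 1) (a := i) (b := i + 2) (a' := i + 2) (b' := i)
    (f1 := f1) (f2 := ct b) <| by
      have := add_mem (add_mem hSE (cd_mem_BB E2)) (S_Sb_mem_BB hf2 (add_one_add_two i))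
      convert this using 1
      linear_combination h2 - (cupD (S i) E3 + cupD (S i) (cupD (Sb (i + 1)) f2) +
        cd (chi (i + 1)) E2) * two_Coch
  obtain ⟨rfl, hct⟩ := k1
  rw [hct, cupD_zero, cupD_zero, zero_add] at h2
  rw [qC_hpow_of_ct hb hinv hct (by norm_num) (by norm_num), zero_add] at h1 h0
  rw [cupD_zero, add_zero] at hE
  have hSbE := Sb_mem_BB hE rfl
  rw [cupD_add] at hSbE
  have k2 := words_two_injective (i := i + 2) (a := i) (b := i + 2) (a' := i) (b' := i + 1)
    (f1 := 0) (f2 := f2) <| by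
      have := add_mem hSbE (cd_mem_BB E1)
      convert this using 1
      rw [cupD_zero, cupD_zero]
      linear_combination -h1
  obtain ⟨-, rfl⟩ := k2
  rw [cupD_zero, add_zero] at hE
  obtain ⟨F2, F1, hF2, hF1, hF⟩ := exists_decomposition hE h2 h1 h0
  obtain ⟨x1, x2, hx1, hx2, hx⟩ := cocycle_one_eq hF2
  obtain ⟨y1, y2, hy1, hy2, hy⟩ := cocycle_one_eq hF1
  rw [add_one_add_two] at hx1 hx
  rw [add_one_add_one] at hx2 hx
  rw [add_two_add_two] at hy1 hy
  rw [add_two_add_one] at hy2 hy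
  refine ⟨y1, x2, hy1, hx2, ?_⟩
  have hx' := Sb_mem_BB hx (add_one_add_two i)
  have hy' := S_mem_BB hy (add_two_add_one i)
  rw [cupD_add, cupD_add] at hx' hy'
  have := add_mem (add_mem (add_mem hF hx') (add_mem hy' (Sb_S_mem_BB hx1 rfl)))
    (S_Sb_mem_BB hy2 rfl)
  convert this using 1
  linear_combination (-(cupD (Sb (i + 1)) F2) - cupD (S (i + 2)) F1 -
    cupD (Sb (i + 1)) (cupD (S i) x1) - cupD (S (i + 2)) (cupD (Sb i) y2)) * two_Coch

/-- The argument of `cocycle_two_eq` one degree higher, with nonvanishing supplied by the quaternion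
cycle. This time the coefficient of `z³` already kills the constant term of `b`. -/
theorem cocycle_three_eq' {c : Coch 3} (hc : cd (chi i) c = 0) : ∃ f1 f2 : Coch 0,
    cd (chi i) f1 = 0 ∧ cd (chi i) f2 = 0 ∧
      c + cupD (S (i + 2)) (cupD (S (i + 1)) (cupD (S i) f1)) +
        cupD (Sb (i + 1)) (cupD (Sb (i + 2)) (cupD (Sb i) f2)) ∈ BB 2 i := by
  obtain ⟨b, hb, hinv, E3, E2, E1, E0, h3, h2, h1, h0⟩ := exists_coordinates (by norm_num) hc
  simp only [Nat.reduceAdd] at h3 h2 h1 h0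
  rw [qC_hpow_three hb] at h3
  have hct : ct b = 0 := Sb_Sb_Sb_injective (i := i) ⟨E3, by
    linear_combination h3 - cd (chi i) E3 * two_Coch⟩
  rw [hct, cupD_zero, cupD_zero, cupD_zero, zero_add] at h3
  rw [qC_hpow_of_ct hb hinv hct (by norm_num) (by norm_num), zero_add] at h2 h1 h0
  obtain ⟨f1, f2, hf1, hf2, hE⟩ := cocycle_two_eq h3
  have hSE := S_mem_BB hE rfl
  rw [cupD_add, cupD_add] at hSE
  obtain rfl : f1 = 0 := S_S_S_injective (i := i + 1) (a := i) (b := i + 2) (c := i + 1) <| by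
    have := add_mem (add_mem hSE (cd_mem_BB E2))
      (S_Sb_mem_BB (cd_Sb_zero hf2 (add_two_add_two i)) (add_one_add_two i))
    convert this using 1
    linear_combination -h2 - (cupD (S i) (cupD (Sb (i + 1)) (cupD (Sb (i + 2)) f2))) * two_Coch
  rw [cupD_zero, cupD_zero, add_zero] at hE
  have hSbE := Sb_mem_BB hE rfl
  rw [cupD_add] at hSbE
  obtain rfl : f2 = 0 := Sb_Sb_Sb_injective (i := i + 2) (a := i) (b := i + 1) (c := i + 2) <| by
    have := add_mem hSbE (cd_mem_BB E1)
    convert this using 1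
    linear_combination -h1
  rw [cupD_zero, cupD_zero, add_zero] at hE
  obtain ⟨F2, F1, hF2, hF1, hF⟩ := exists_decomposition hE h2 h1 h0
  obtain ⟨x1, x2, hx1, hx2, hx⟩ := cocycle_two_eq hF2
  obtain ⟨y1, y2, hy1, hy2, hy⟩ := cocycle_two_eq hF1
  simp only [add_one_add_one, add_one_add_two, add_two_add_one, add_two_add_two]
    at hx hy hx1 hx2 hy1 hy2
  refine ⟨y1, x2, hy1, hx2, ?_⟩
  have hx' := Sb_mem_BB hx (add_one_add_two i)
  have hy' := S_mem_BB hy (add_two_add_one i)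
  rw [cupD_add, cupD_add] at hx' hy'
  have := add_mem (add_mem (add_mem hF hx') (add_mem hy'
    (Sb_S_mem_BB (cd_S_zero hx1 (add_two_add_one i)) rfl)))
    (S_Sb_mem_BB (cd_Sb_zero hy2 (add_one_add_two i)) rfl)
  convert this using 1
  linear_combination (-(cupD (Sb (i + 1)) F2) - cupD (S (i + 2)) F1 -
    cupD (Sb (i + 1)) (cupD (S i) (cupD (S (i + 2)) x1)) -
    cupD (S (i + 2)) (cupD (Sb i) (cupD (Sb (i + 1)) y2))) * two_Coch

/-! ### Powers of `h` as cocycles, and the relation between the two generators in degree three -/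

theorem cd_const {b : KK} (hinv : ∀ g, rho i g b = b) : cd (rho i) (hpow i b 0) = 0 := by
  funext g
  rw [cd_zero_cochain]
  change rho i (g 0) b + b = 0
  rw [hinv, add_self_F4]

theorem cd_HH1_zero {c : KCoch n} (hc : cd (rho i) c = 0) : cd (rho i) (cupD (HH1 i) c) = 0 := by
  rw [cd_cupD (HH1_mul i), hc, cupD_zero]

theorem cd_hpow {b : KK} (hinv : ∀ g, rho i g b = b) (n : ℕ) : cd (rho i) (hpow i b n) = 0 := by
  induction n with
  | zero => exact cd_const hinv
  | succ n ih => exact cd_HH1_zero ih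

theorem smul_mem_BB (a : F4) {c : Coch (n + 1)} (hc : c ∈ BB n i) : a • c ∈ BB n i := by
  obtain ⟨e, rfl⟩ := hc
  refine ⟨a • e, ?_⟩
  funext g
  simp only [cd, Pi.smul_apply, map_smul, smul_add, Finset.smul_sum]

theorem cupD_smul (a : F4) (x : G24 → F4 →ₗ[F4] F4) (f : Coch n) :
    cupD x (a • f) = a • cupD x f := funext fun g => map_smul (x (g 0)) _ _

/-- For an invariant constant `f`, the cochain `h²f` is a cocycle with quadratic coefficient
`σ²σ²f`. The constant coefficient of its coboundary equates `σ²σ²σ²f` with `σ` times the linear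
coefficient, up to a coboundary, and the latter is a 2-cocycle to which `cocycle_two_eq` applies. -/
theorem exists_Sb_Sb_Sb_add {f : Coch 0} (hf : cd (chi i) f = 0) : ∃ f' : Coch 0,
    cd (chi i) f' = 0 ∧ cupD (S (i + 2)) (cupD (S (i + 1)) (cupD (S i) f')) +
        cupD (Sb (i + 1)) (cupD (Sb (i + 2)) (cupD (Sb i) f)) ∈ BB 2 i := by
  set b := algebraMap F4 KK (f ![]) with hb
  have hinv : ∀ g, rho i g b = b := fun g => by
    rw [hb, rho_algebraMap, eq_of_cd_zero_cochain hf]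
  have hbm : b ∈ Mt 0 := algebraMap_mem_Mt _
  have hct : ct b = f := Coch_zero_ext (by simp [ct, hb, qc_algebraMap])
  have hm : ∀ g, hpow i b 2 g ∈ Mt 2 := fun g => by simpa using hpow_mem hbm 2 g
  have hm3 : ∀ g, hpow i b 2 g ∈ Mt 3 := fun g => Mt_mono (by norm_num) (hm g)
  have hcd := cd_hpow hinv 2
  have h1 := qC_one_cd (i := i) hm3
  have h0 := qC_zero_cd (i := i) hm3
  rw [hcd, qC_of_mem (j := 3) hm (by norm_num), cupD_zero, add_zero] at h1
  rw [hcd, qC_of_mem (j := 3) hm (by norm_num), cupD_zero, zero_add, qC_hpow_two hbm, hct] at h0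
  have hz : ∀ j : ℤ, qC j (0 : KCoch 3) = 0 := fun j => funext fun g => map_zero _
  rw [hz] at h1 h0
  obtain ⟨f1, f2, hf1, hf2, h⟩ := cocycle_two_eq h1.symm
  simp only [add_one_add_one, add_one_add_two, add_two_add_one, add_two_add_two] at hf1 hf2 h
  have h' := S_mem_BB h (add_two_add_one i)
  rw [cupD_add, cupD_add] at h'
  refine ⟨f1, hf1, ?_⟩
  have := add_mem (add_mem h' (cd_mem_BB (qC 0 (hpow i b 2))))
    (S_Sb_mem_BB (cd_Sb_zero hf2 (add_one_add_two i)) rfl)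
  convert this using 1
  linear_combination h0 - cupD (S (i + 2)) (cupD (Sb i) (cupD (Sb (i + 1)) f2)) * two_Coch +
    cupD (Sb (i + 1)) (cupD (Sb (i + 2)) (cupD (Sb i) f)) * two_Coch

/-- The relation of `exists_Sb_Sb_Sb_add` can be inverted: its `f'` is nonzero when `f` is, and
0-cochains form a line. -/
theorem exists_S_S_S_add {f : Coch 0} (hf : cd (chi i) f = 0) : ∃ f' : Coch 0,
    cd (chi i) f' = 0 ∧ cupD (S (i + 2)) (cupD (S (i + 1)) (cupD (S i) f)) +
        cupD (Sb (i + 1)) (cupD (Sb (i + 2)) (cupD (Sb i) f')) ∈ BB 2 i := by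
  by_cases h0 : f = 0
  · refine ⟨0, cd_zero _, ?_⟩
    simp only [h0, cupD_zero, add_zero]
    exact zero_mem _
  obtain ⟨f', hf', h⟩ := exists_Sb_Sb_Sb_add hf
  have hne : f' ![] ≠ 0 := by
    intro h1
    obtain rfl : f' = 0 := Coch_zero_ext h1
    simp only [cupD_zero, zero_add] at h
    exact h0 (Sb_Sb_Sb_injective h)
  have e : f = (f ![] * (f' ![])⁻¹) • f' := Coch_zero_ext (by
    simp only [Pi.smul_apply, smul_eq_mul]
    field_simp)
  refine ⟨(f ![] * (f' ![])⁻¹) • f, ?_, ?_⟩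
  · funext g
    have := congrFun hf g
    rw [cd_zero_cochain] at this ⊢
    simp only [Pi.smul_apply, map_smul, ← smul_add]
    rw [this]
    exact smul_zero _
  · have h2 := smul_mem_BB (f ![] * (f' ![])⁻¹) h
    rw [smul_add] at h2
    simp only [← cupD_smul] at h2
    rwa [← e] at h2

theorem cocycle_three_eq {c : Coch 3} (hc : cd (chi i) c = 0) : ∃ f : Coch 0, cd (chi i) f = 0 ∧
      c + cupD (Sb (i + 1)) (cupD (Sb (i + 2)) (cupD (Sb i) f)) ∈ BB 2 i := by
  obtain ⟨f1, f2, hf1, hf2, h⟩ := cocycle_three_eq' hc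
  obtain ⟨f', hf', h'⟩ := exists_S_S_S_add hf1
  refine ⟨f2 + f', by rw [cd_add, hf2, hf', add_zero], ?_⟩
  have := add_mem h h'
  convert this using 1
  rw [cupD_add, cupD_add, cupD_add]
  linear_combination - cupD (S (i + 2)) (cupD (S (i + 1)) (cupD (S i) f1)) * two_Coch

end

end EllCohomology
end

open CategoryTheory
noncomputable section
namespace EllCohomology

/-! ### Inflated cochains -/

section

variable {n : ℕ} {i : ZMod 3} {V V' : Type} [AddCommGroup V] [Module F4 V] [AddCommGroup V']
  [Module F4 V']

theorem act_eps : act eps = 1 := by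
  apply AlgHom.ext
  intro f
  obtain ⟨t, ht⟩ : ∃ t : ℤ, f ∈ Mt t := by
    refine ⟨f.order.natAbs, fun n hn => ?_⟩
    by_contra h
    have := HahnSeries.order_le_of_coeff_ne_zero h
    omega
  obtain ⟨p, rfl⟩ := mem_Mt_iff.1 ht
  obtain ⟨a, rfl⟩ := redS_surjective p
  have h1 : act eps zz = zz := by
    obtain ⟨h1, h2, -⟩ := coords_eps
    rw [act_z, h1, h2, map_zero, add_zero, inv_one, one_smul]
  rw [map_mul, map_zpow₀, h1, act_coe, actS_redS]
  rfl

theorem act_eq_of_mk {g g' : G24} (h : (g : A4) = g') : act g = act g' := by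
  have h1 : g⁻¹ * g' ∈ CurveAut.C2 W4 curveCU := QuotientGroup.eq.1 h
  have h2 : act (g⁻¹ * g') = 1 := by
    have h3 : CurveAut.C2 W4 curveCU ≤ act.ker := by
      rw [CurveAut.C2, Subgroup.zpowers_le]
      exact act_eps
    exact h3 h1
  have h4 := map_mul act g (g⁻¹ * g')
  rw [h2, mul_one, mul_inv_cancel_left] at h4
  exact h4.symm

/-- Both coordinates are read off from the action on `z`, which `-1` fixes. There is no such
statement for `τ`. -/
theorem coords_eq_of_mk {g g' : G24} (h : (g : A4) = g') : ll g = ll g' ∧ sg g = sg g' := by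
  have h1 := act_z' g
  rw [act_eq_of_mk h, act_z' g'] at h1
  obtain ⟨h2, h3⟩ := affine_unique h1
  have h4 : ll g' = ll g := inv_injective (Units.ext h2)
  refine ⟨h4.symm, ?_⟩
  rw [h4] at h3
  exact (mul_left_cancel₀ (Units.ne_zero _) h3).symm

theorem wt_eq_of_mk {g g' : G24} (h : (g : A4) = g') : wt i g = wt i g' := by
  rw [wt_apply, wt_apply, (coords_eq_of_mk h).1]

theorem rho_eq_of_mk {g g' : G24} (h : (g : A4) = g') : rho i g = rho i g' := by
  refine LinearMap.ext fun f => ?_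
  rw [rho_apply, rho_apply, wt_eq_of_mk h, act_eq_of_mk h]

/-- Cochains that are inflated from the quotient by `{±1}`. -/
def Infl {X : Type} (c : (Fin n → G24) → X) : Prop :=
  ∀ g g' : Fin n → G24, (∀ k, (g k : A4) = g' k) → c g = c g'

theorem Infl.add {c c' : (Fin n → G24) → V} (h : Infl c) (h' : Infl c') : Infl (c + c') :=
  fun g g' hg => by rw [Pi.add_apply, Pi.add_apply, h g g' hg, h' g g' hg]

theorem Infl.comp {X Y : Type} {c : (Fin n → G24) → X} (h : Infl c) (q : X → Y) :
    Infl fun g => q (c g) := fun g g' hg => congrArg q (h g g' hg)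

theorem Infl.zero : Infl (0 : (Fin n → G24) → V) := fun _ _ _ => rfl

theorem Infl.of_zero {X : Type} (c : (Fin 0 → G24) → X) : Infl c :=
  fun g g' _ => congrArg c (Subsingleton.elim g g')

theorem mk_contractNth {g g' : Fin (n + 1) → G24} (h : ∀ k, (g k : A4) = g' k) (j : Fin (n + 1))
    (k : Fin n) : QuotientGroup.mk (s := CurveAut.C2 W4 curveCU) (Fin.contractNth j (· * ·) g k) =
      QuotientGroup.mk (s := CurveAut.C2 W4 curveCU) (Fin.contractNth j (· * ·) g' k) := by
  simp only [Fin.contractNth]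
  split_ifs
  · exact h _
  · rw [QuotientGroup.mk_mul, QuotientGroup.mk_mul, h, h]
  · exact h _

theorem Infl.cd {ρ : Representation F4 G24 V} (hρ : ∀ g g' : G24, (g : A4) = g' → ρ g = ρ g')
    {c : (Fin n → G24) → V} (h : Infl c) : Infl (cd ρ c) := fun g g' hg => by
  rw [EllCohomology.cd, EllCohomology.cd, hρ _ _ (hg 0), h (Fin.tail g) (Fin.tail g') fun k => hg k.succ]
  congr 1
  exact Finset.sum_congr rfl fun j _ => h _ _ (mk_contractNth hg j)

theorem Infl.cupD {a : G24 → V →ₗ[F4] V'} (ha : ∀ g g' : G24, (g : A4) = g' → a g = a g')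
    {c : (Fin n → G24) → V} (h : Infl c) : Infl (cupD a c) := fun g g' hg => by
  rw [EllCohomology.cupD, EllCohomology.cupD, ha _ _ (hg 0), h (Fin.tail g) (Fin.tail g') fun k => hg k.succ]

theorem Infl.S {c : Coch n} (h : Infl c) : Infl (EllCohomology.cupD (S i) c) :=
  h.cupD fun g g' hg => by
    rw [EllCohomology.S, EllCohomology.S, wt_eq_of_mk hg, (coords_eq_of_mk hg).2]

theorem Infl.Sb {c : Coch n} (h : Infl c) : Infl (EllCohomology.cupD (Sb i) c) :=
  h.cupD fun g g' hg => by
    rw [EllCohomology.Sb, EllCohomology.Sb, wt_eq_of_mk hg, (coords_eq_of_mk hg).2]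

/-! ### Cocycles modulo `h` -/

variable (n i) in
/-- Cochains that are the sum of an inflated cocycle, a multiple of `h` and a coboundary, with
bounds on the orders of the poles. -/
def Good (r : ℤ) : AddSubgroup (KCoch (n + 1)) where
  carrier := {c | ∃ (a : KCoch (n + 1)) (b e : KCoch n), Infl a ∧ cd (rho i) a = 0 ∧
    (∀ g, a g ∈ Mt r) ∧ cd (rho i) b = 0 ∧ (∀ g, b g ∈ Mt (r - 1)) ∧ (∀ g, e g ∈ Mt r) ∧
    c = a + cupD (HH1 i) b + cd (rho i) e}
  add_mem' := by
    rintro _ _ ⟨a, b, e, h1, h2, h3, h4, h5, h6, rfl⟩ ⟨a', b', e', h1', h2', h3', h4', h5', h6', rfl⟩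
    refine ⟨a + a', b + b', e + e', h1.add h1', by rw [cd_add, h2, h2', add_zero],
      fun g => add_mem (h3 g) (h3' g), by rw [cd_add, h4, h4', add_zero],
      fun g => add_mem (h5 g) (h5' g), fun g => add_mem (h6 g) (h6' g), ?_⟩
    rw [cd_add, cupD_add]
    ring
  zero_mem' := ⟨0, 0, 0, Infl.zero, cd_zero _, fun _ => zero_mem _, cd_zero _, fun _ => zero_mem _,
    fun _ => zero_mem _, by rw [cd_zero, cupD_zero]; ring⟩
  neg_mem' := by
    intro c h
    rwa [show -c = c by linear_combination -c * two_KCoch]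

theorem infl_mem_Good {r : ℤ} {a : KCoch (n + 1)} (h1 : Infl a) (h2 : cd (rho i) a = 0)
    (h3 : ∀ g, a g ∈ Mt r) : a ∈ Good n i r :=
  ⟨a, 0, 0, h1, h2, h3, cd_zero _, fun _ => zero_mem _, fun _ => zero_mem _, by
    rw [cd_zero, cupD_zero, add_zero, add_zero]⟩

theorem HH1_mem_Good {r s : ℤ} (hs : s = r - 1) {b : KCoch n} (h2 : cd (rho i) b = 0)
    (h3 : ∀ g, b g ∈ Mt s) : cupD (HH1 i) b ∈ Good n i r :=
  ⟨0, b, 0, Infl.zero, cd_zero _, fun _ => zero_mem _, h2, hs ▸ h3, fun _ => zero_mem _, by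
    rw [cd_zero, zero_add, add_zero]⟩

theorem cd_mem_Good {r : ℤ} {e : KCoch n} (h : ∀ g, e g ∈ Mt r) : cd (rho i) e ∈ Good n i r :=
  ⟨0, 0, e, Infl.zero, cd_zero _, fun _ => zero_mem _, cd_zero _, fun _ => zero_mem _, h, by
    rw [cupD_zero, zero_add, zero_add]⟩

theorem Good_mono {r s : ℤ} (h : r ≤ s) : Good n i r ≤ Good n i s := by
  rintro _ ⟨a, b, e, h1, h2, h3, h4, h5, h6, rfl⟩
  exact ⟨a, b, e, h1, h2, fun g => Mt_mono h (h3 g), h4, fun g => Mt_mono (by omega) (h5 g),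
    fun g => Mt_mono h (h6 g), rfl⟩

/-- No inflated part is needed: `b` has no pole, so `hⁿb` lies in `Mt 2`, as the bound for the
multiple of `h` demands. -/
theorem good_three (hn : n ≤ 2) {c : KCoch (n + 1)} (hc : cd (rho i) c = 0)
    (hM : ∀ g, c g ∈ Mt 3) : c ∈ Good n i 3 := by
  obtain ⟨b, hb, hinv, e, he, h⟩ := cocycle_eq_hpow 0 hn hc hM
  norm_num at hb he
  rw [h]
  exact add_mem (HH1_mem_Good (s := 2) (by norm_num) (cd_hpow hinv n)
    fun g => Mt_mono (by omega) (hpow_mem hb n g)) (cd_mem_Good he)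

theorem good_neg_one (hn : n ≤ 2) {c : KCoch (n + 1)} (hc : cd (rho i) c = 0)
    (hM : ∀ g, c g ∈ Mt (-1)) : c ∈ Good n i (-1) := by
  obtain ⟨b, hb, hinv, e, he, h⟩ := cocycle_eq_hpow_neg n hn hc hM
  rw [h]
  exact add_mem (HH1_mem_Good (s := -2) (by norm_num) (cd_hpow hinv n)
    fun g => Mt_mono (by omega) (hpow_mem hb n g)) (cd_mem_Good he)

/-- A cochain with values in `𝔽₄`, multiplied by a power of `z`. -/
def toKz (j : ℕ) (c : Coch n) : KCoch n := fun g => c g • zz ^ j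

theorem toKz_mem (j : ℕ) (c : Coch n) (g : Fin n → G24) : toKz j c g ∈ Mt j :=
  (Mt j).smul_mem _ (pow_mem_Mt j)

theorem qC_toKz (j : ℕ) (k : ℤ) (c : Coch n) : qC k (toKz j c) = if k = j then c else 0 := by
  funext g
  simp only [qC, toKz, map_smul, qc_pow, smul_eq_mul]
  split_ifs <;> simp

theorem cd_eq_zero_add {c d : KCoch n} (hc : cd (rho i) c = 0) (hd : cd (rho i) d = 0) :
    cd (rho i) (c + d) = 0 := by rw [cd_add, hc, hd, add_zero]

theorem mem_Good_of_add {r : ℤ} {c d : KCoch (n + 1)} (hd : d ∈ Good n i r)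
    (h : c + d ∈ Good n i r) : c ∈ Good n i r :=
  (AddSubgroup.add_mem_cancel_right _ hd).1 h

theorem cd_toK_zero {c : Coch n} (hc : cd (chi i) c = 0) : cd (rho i) (toK c) = 0 := by
  rw [cd_toK, hc]
  exact funext fun g => map_zero _

theorem qC_zero (j : ℤ) : qC j (0 : KCoch n) = 0 := funext fun _ => map_zero _

/-- If the leading coefficient is an inflated cocycle up to a coboundary, subtracting constants
leaves a cocycle in `Mt (-1)`. -/
theorem good_zero_aux (hn : n ≤ 2) {c : KCoch (n + 1)} (hc : cd (rho i) c = 0)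
    (hM : ∀ g, c g ∈ Mt 0) {W : Coch (n + 1)} (hW : Infl W) (hWc : cd (chi i) W = 0)
    (h : qC 0 c + W ∈ BB n i) : c ∈ Good n i 0 := by
  obtain ⟨e, he⟩ := h
  have g1 : toK W ∈ Good n i 0 := infl_mem_Good (hW.comp _) (cd_toK_zero hWc) (toK_mem W)
  have g2 : cd (rho i) (toK e) ∈ Good n i 0 := cd_mem_Good (toK_mem e)
  refine mem_Good_of_add (add_mem g1 g2) (Good_mono (by norm_num) (good_neg_one hn
    (cd_eq_zero_add hc (cd_eq_zero_add (cd_toK_zero hWc) (cd_cd _ _))) ?_))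
  refine mem_Mt_of_qC (t := 0) (fun g => add_mem (hM g) (add_mem (toK_mem W g) ?_)) ?_ (by norm_num)
  · rw [cd_toK]; exact toK_mem _ g
  · rw [qC_add, qC_add, cd_toK, qC_zero_toK, qC_zero_toK, ← he]
    linear_combination (qC 0 c + W) * two_Coch

/-- The leading coefficient is a cocycle in a character, so it is given by words in `σ` and `σ²`,
and these descend to `A₄`. -/
theorem good_zero (hn : n ≤ 2) {c : KCoch (n + 1)} (hc : cd (rho i) c = 0)
    (hM : ∀ g, c g ∈ Mt 0) : c ∈ Good n i 0 := by
  have h0 := qC_zero_cd (i := i) (E := c) fun g => Mt_mono (by norm_num) (hM g)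
  rw [hc, qC_zero, qC_of_mem (j := 3) hM (by norm_num), qC_of_mem (j := 2) hM (by norm_num),
    qC_of_mem (j := 1) hM (by norm_num), cupD_zero, cupD_zero, cupD_zero, add_zero, add_zero,
    add_zero] at h0
  interval_cases n
  · obtain ⟨f1, f2, hf1, hf2, h⟩ := cocycle_one_eq h0.symm
    rw [add_assoc] at h
    refine good_zero_aux hn hc hM (Infl.add (Infl.of_zero f1).S (Infl.of_zero f2).Sb) ?_ h
    rw [cd_add, cd_S_zero hf1 (add_two_add_one i), cd_Sb_zero hf2 (add_one_add_two i), add_zero]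
  · obtain ⟨f1, f2, hf1, hf2, h⟩ := cocycle_two_eq h0.symm
    rw [add_assoc] at h
    refine good_zero_aux hn hc hM (Infl.add (Infl.of_zero f1).S.S (Infl.of_zero f2).Sb.Sb) ?_ h
    rw [cd_add, cd_S_zero (cd_S_zero hf1 (add_one_add_one i)) (add_two_add_one i),
      cd_Sb_zero (cd_Sb_zero hf2 (add_two_add_two i)) (add_one_add_two i), add_zero]
  · obtain ⟨f, hf, h⟩ := cocycle_three_eq h0.symm
    refine good_zero_aux hn hc hM (Infl.of_zero f).Sb.Sb.Sb ?_ h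
    exact cd_Sb_zero (cd_Sb_zero (cd_Sb_zero hf rfl) (add_two_add_two i)) (add_one_add_two i)

/-- `σ²F` is the leading coefficient of the product of `h` with the constant cocycle `F`. -/
theorem good_one_aux (hn : n ≤ 2) {c : KCoch (n + 1)} (hc : cd (rho i) c = 0)
    (hM : ∀ g, c g ∈ Mt 1) {F : Coch n} (hF : cd (chi i) F = 0)
    (h : qC 1 c + cupD (Sb i) F ∈ BB n (i + 2)) : c ∈ Good n i 1 := by
  obtain ⟨e, he⟩ := h
  have hKm : ∀ g, toKz 1 e g ∈ Mt 1 := toKz_mem 1 e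
  have g1 : cupD (HH1 i) (toK F) ∈ Good n i 1 :=
    HH1_mem_Good (s := 0) (by norm_num) (cd_toK_zero hF) (toK_mem F)
  have g2 : cd (rho i) (toKz 1 e) ∈ Good n i 1 := cd_mem_Good hKm
  refine mem_Good_of_add (add_mem g1 g2) (Good_mono (by norm_num) (good_zero hn
    (cd_eq_zero_add hc (cd_eq_zero_add (cd_HH1_zero (cd_toK_zero hF)) (cd_cd _ _))) ?_))
  refine mem_Mt_of_qC (t := 1) (fun g => add_mem (hM g) (add_mem (HH1_mem (by norm_num) _
    (toK_mem F _)) (cd_mem rho_mem hKm g))) ?_ (by norm_num)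
  rw [qC_add, qC_add, qC_one_HH1 (toK_mem F), qC_zero_toK,
    qC_one_cd fun g => Mt_mono (by norm_num) (hKm g), qC_toKz, qC_toKz, if_pos (by norm_num),
    if_neg (by norm_num), cupD_zero, add_zero, ← he]
  linear_combination (qC 1 c + cupD (Sb i) F) * two_Coch

/-- The constant coefficient of `dc = 0` makes `σ` times the leading coefficient a coboundary. This
excludes words in `σ` in degrees one and two; in degree three the generator may be taken as a word
in `σ²`. All words that begin with `σ²` are covered by `good_one_aux`. -/
theorem good_one (hn : n ≤ 2) {c : KCoch (n + 1)} (hc : cd (rho i) c = 0)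
    (hM : ∀ g, c g ∈ Mt 1) : c ∈ Good n i 1 := by
  have hM3 : ∀ g, c g ∈ Mt 3 := fun g => Mt_mono (by norm_num) (hM g)
  have h1 := qC_one_cd (i := i) hM3
  have h0 := qC_zero_cd (i := i) hM3
  rw [hc, qC_zero, qC_of_mem (j := 3) hM (by norm_num), cupD_zero, add_zero] at h1
  rw [hc, qC_zero, qC_of_mem (j := 3) hM (by norm_num), qC_of_mem (j := 2) hM (by norm_num),
    cupD_zero, cupD_zero, add_zero, zero_add (cupD (S (i + 2)) (qC 1 c))] at h0
  have hS : cupD (S (i + 2)) (qC 1 c) ∈ BB (n + 1) i := ⟨qC 0 c, by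
    linear_combination -h0 - cd (chi i) (qC 0 c) * two_Coch⟩
  interval_cases n
  · obtain ⟨f1, f2, hf1, hf2, h⟩ := cocycle_one_eq h1.symm
    simp only [add_two_add_one, add_two_add_two] at hf1 hf2 h
    have h' := S_mem_BB h (add_two_add_one i)
    rw [cupD_add, cupD_add] at h'
    obtain ⟨rfl, -⟩ := words_two_injective (i := i) (a := i + 2) (b := i + 1) (f1 := f1) (a' := 0)
      (b' := 0) (f2 := 0) <| by
        have := add_mem (add_mem h' hS) (S_Sb_mem_BB hf2 rfl)
        convert this using 1
        rw [cupD_zero, cupD_zero]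
        linear_combination -(cupD (S (i + 2)) (qC 1 c) + cupD (S (i + 2)) (cupD (Sb i) f2)) * two_Coch
    rw [cupD_zero, add_zero] at h
    exact good_one_aux hn hc hM hf2 h
  · obtain ⟨f1, f2, hf1, hf2, h⟩ := cocycle_two_eq h1.symm
    simp only [add_two_add_one, add_two_add_two] at hf1 hf2 h
    have h' := S_mem_BB h (add_two_add_one i)
    rw [cupD_add, cupD_add] at h'
    obtain rfl : f1 = 0 := S_S_S_injective (i := i) (a := i + 2) (b := i + 1) (c := i) <| by
        have := add_mem (add_mem h' hS) (S_Sb_mem_BB (cd_Sb_zero hf2 (add_one_add_two i)) rfl)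
        convert this using 1
        linear_combination -(cupD (S (i + 2)) (qC 1 c) +
          cupD (S (i + 2)) (cupD (Sb i) (cupD (Sb (i + 1)) f2))) * two_Coch
    rw [cupD_zero, cupD_zero, add_zero] at h
    exact good_one_aux hn hc hM (cd_Sb_zero hf2 (add_one_add_two i)) h
  · obtain ⟨f, hf, h⟩ := cocycle_three_eq h1.symm
    simp only [add_two_add_one, add_two_add_two] at hf h
    exact good_one_aux hn hc hM
      (cd_Sb_zero (cd_Sb_zero hf (add_two_add_two i)) (add_one_add_two i)) h

/-- `σF` is the leading coefficient of `d(Fz³)`. This cocycle is inflated together with `F` and has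
values in `Mt 2` because `dF = 0`, although `Fz³` itself need not. The other term is the leading
coefficient of `h · b`. -/
theorem good_two_aux (hn : n ≤ 2) {c : KCoch (n + 1)} (hc : cd (rho i) c = 0)
    (hM : ∀ g, c g ∈ Mt 2) {F : Coch n} (hF : cd (chi i) F = 0) (hFi : Infl F) {b : KCoch n}
    (hb : cd (rho i) b = 0) (hbM : ∀ g, b g ∈ Mt 1)
    (h : qC 2 c + cupD (S i) F + cupD (Sb (i + 2)) (qC 1 b) ∈ BB n (i + 1)) : c ∈ Good n i 2 := by
  obtain ⟨e, he⟩ := h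
  have hKm : ∀ g, toKz 2 e g ∈ Mt 2 := toKz_mem 2 e
  have hK3 : ∀ g, toKz 3 F g ∈ Mt 3 := toKz_mem 3 F
  have hFM : ∀ g, cd (rho i) (toKz 3 F) g ∈ Mt 2 := mem_Mt_of_qC (t := 3) (cd_mem rho_mem hK3) (by
    rw [qC_three_cd hK3, qC_toKz, if_pos (by norm_num), hF]) (by norm_num)
  have g0 : cd (rho i) (toKz 3 F) ∈ Good n i 2 :=
    infl_mem_Good (Infl.cd (fun _ _ => rho_eq_of_mk) (hFi.comp fun a => a • zz ^ 3)) (cd_cd _ _) hFM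
  have g1 : cupD (HH1 i) b ∈ Good n i 2 := HH1_mem_Good (s := 1) (by norm_num) hb hbM
  have g2 : cd (rho i) (toKz 2 e) ∈ Good n i 2 := cd_mem_Good hKm
  refine mem_Good_of_add (add_mem g0 (add_mem g1 g2)) (Good_mono (by norm_num) (good_one hn
    (cd_eq_zero_add hc (cd_eq_zero_add (cd_cd _ _)
      (cd_eq_zero_add (cd_HH1_zero hb) (cd_cd _ _)))) ?_))
  refine mem_Mt_of_qC (t := 2) (fun g => add_mem (hM g) (add_mem (hFM g) (add_mem
    (HH1_mem (by norm_num) _ (hbM _)) (cd_mem rho_mem hKm g)))) ?_ (by norm_num)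
  rw [qC_add, qC_add, qC_add, qC_two_HH1 hbM, qC_two_cd fun g => Mt_mono (by norm_num) (hKm g),
    qC_two_cd hK3]
  simp only [qC_toKz]
  norm_num
  rw [cd_zero, cupD_zero, add_zero, zero_add (cupD (S i) F), ← he]
  linear_combination (qC 2 c + cupD (S i) F + cupD (Sb (i + 2)) (qC 1 b)) * two_Coch

/-- Words in `σ` come from `d(Fz³)`, and words that begin with two factors `σ²` from `h · (h · f)`.
A single `σ²`, in degree one, is excluded by the linear and constant coefficients of `dc = 0`. -/
theorem good_two (hn : n ≤ 2) {c : KCoch (n + 1)} (hc : cd (rho i) c = 0)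
    (hM : ∀ g, c g ∈ Mt 2) : c ∈ Good n i 2 := by
  have hM3 : ∀ g, c g ∈ Mt 3 := fun g => Mt_mono (by norm_num) (hM g)
  have h2 := qC_two_cd (i := i) hM3
  have h1 := qC_one_cd (i := i) hM3
  have h0 := qC_zero_cd (i := i) hM3
  rw [hc, qC_zero, qC_of_mem (j := 3) hM (by norm_num), cupD_zero, add_zero] at h2 h1
  rw [hc, qC_zero, qC_of_mem (j := 3) hM (by norm_num), cupD_zero,
    zero_add (cupD (Sb (i + 1)) (qC 2 c))] at h0
  interval_cases n
  · obtain ⟨f1, f2, hf1, hf2, h⟩ := cocycle_one_eq h2.symm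
    obtain ⟨y1, y2, hy1, hy2, hy⟩ := cocycle_one_eq h1.symm
    simp only [add_one_add_one, add_one_add_two] at hf1 hf2 h
    simp only [add_two_add_one, add_two_add_two] at hy1 hy2 hy
    have h' := Sb_mem_BB h (add_one_add_two i)
    have hy' := S_mem_BB hy (add_two_add_one i)
    rw [cupD_add, cupD_add] at h' hy'
    obtain ⟨-, rfl⟩ := words_two_injective (i := i) (a := i + 2) (b := i + 1) (f1 := y1)
      (a' := i + 1) (b' := i + 2) (f2 := f2) <| by
        have := add_mem (add_mem (add_mem h' hy') (add_mem (Sb_S_mem_BB hf1 rfl)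
          (S_Sb_mem_BB hy2 rfl))) (cd_mem_BB (i := i) (qC 0 c))
        convert this using 1
        linear_combination h0 - (cupD (Sb (i + 1)) (cupD (S i) f1) +
          cupD (S (i + 2)) (cupD (Sb i) y2)) * two_Coch
    refine good_two_aux hn hc hM hf1 (Infl.of_zero _) (b := 0) (cd_zero _) (fun _ => zero_mem _) ?_
    rwa [qC_zero]
  · obtain ⟨f1, f2, hf1, hf2, h⟩ := cocycle_two_eq h2.symm
    simp only [add_one_add_one, add_one_add_two] at hf1 hf2 h
    refine good_two_aux hn hc hM (cd_S_zero hf1 (add_two_add_one i)) (Infl.of_zero _).S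
      (b := cupD (HH1 i) (toK f2)) (cd_HH1_zero (cd_toK_zero hf2))
      (fun g => HH1_mem (by norm_num) _ (toK_mem _ _)) ?_
    rwa [qC_one_HH1 (toK_mem _), qC_zero_toK]
  · obtain ⟨f, hf, h⟩ := cocycle_three_eq h2.symm
    simp only [add_one_add_one, add_one_add_two] at hf h
    refine good_two_aux hn hc hM (F := 0) (cd_zero _) Infl.zero
      (b := cupD (HH1 i) (toK (cupD (Sb (i + 1)) f)))
      (cd_HH1_zero (cd_toK_zero (cd_Sb_zero hf (add_one_add_two i))))
      (fun g => HH1_mem (by norm_num) _ (toK_mem _ _)) ?_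
    rwa [qC_one_HH1 (toK_mem _), qC_zero_toK, cupD_zero, add_zero]

theorem Nz_mul_mem_Good (q : ℤ) {r s : ℤ} (hs : s = 4 * q + r) {c : KCoch (n + 1)}
    (hc : c ∈ Good n i r) : (fun g => Nz ^ q * c g) ∈ Good n (i + q) s := by
  obtain ⟨a, b, e, h1, h2, h3, h4, h5, h6, rfl⟩ := hc
  refine ⟨fun g => Nz ^ q * a g, fun g => Nz ^ q * b g, fun g => Nz ^ q * e g, h1.comp _, ?_,
    fun g => Nz_zpow_mul_mem hs (h3 g), ?_, fun g => Nz_zpow_mul_mem (by rw [hs]; ring) (h5 g),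
    fun g => Nz_zpow_mul_mem hs (h6 g), ?_⟩
  · rw [cd_Nz_zpow_mul, h2]
    exact funext fun g => mul_zero _
  · rw [cd_Nz_zpow_mul, h4]
    exact funext fun g => mul_zero _
  · rw [cd_Nz_zpow_mul]
    funext g
    simp only [Pi.add_apply, cupD, HH1_Nz_zpow_mul]
    ring

/-- In degrees one to three, every cocycle is, up to a coboundary, the sum of an inflated cocycle
and of a multiple of `h`. -/
theorem cocycle_mem_Good (hn : n ≤ 2) (t : ℤ) {c : KCoch (n + 1)} (hc : cd (rho i) c = 0)
    (hM : ∀ g, c g ∈ Mt t) : c ∈ Good n i t := by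
  -- Division by `N^q` leaves the residues `r = 0, 1, 2, 3`.
  obtain ⟨q, r, hr0, hr, rfl⟩ : ∃ q r : ℤ, 0 ≤ r ∧ r ≤ 3 ∧ t = 4 * q + r :=
    ⟨t / 4, t % 4, by omega, by omega, by omega⟩
  obtain ⟨j, rfl⟩ : ∃ j : ZMod 3, i = j + q := ⟨i - q, by ring⟩
  have hj : j + (q : ZMod 3) + ((-q : ℤ) : ZMod 3) = j := by push_cast; ring
  have hc' := cd_Nz_zpow_mul (i := j + q) (-q) c
  rw [hj, hc] at hc'
  have hc0 : cd (rho j) (fun g => Nz ^ (-q) * c g) = 0 :=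
    hc'.trans (funext fun g => mul_zero _)
  have hM0 : ∀ g, Nz ^ (-q) * c g ∈ Mt r := fun g => Nz_zpow_mul_mem (by ring) (hM g)
  have key : (fun g => Nz ^ (-q) * c g) ∈ Good n j r := by
    interval_cases r
    · exact good_zero hn hc0 hM0
    · exact good_one hn hc0 hM0
    · exact good_two hn hc0 hM0
    · exact good_three hn hc0 hM0
  have := Nz_mul_mem_Good q rfl key
  convert this using 1
  funext g
  rw [← mul_assoc, ← zpow_add₀ Nz_ne_zero, add_neg_cancel, zpow_zero, one_mul]

end

end EllCohomology
end

open CategoryTheory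
noncomputable section
namespace EllCohomology

open WeierstrassCurve LaurentPolynomial

/-! ### The homogeneous components of `(E_C)_* V(0)` -/

/-- The ring homomorphism `𝕎[[u₁]] → 𝔽₄((u₁))`. -/
def redK : E0 →+* KK := (HahnSeries.ofPowerSeries ℤ F4).comp redS

theorem redK_apply (a : E0) : redK a = ((redS a : PowerSeries F4) : KK) := rfl

/-- The unit `u₁ T⁻¹` of `𝔽₄((u₁))[T, T⁻¹]`. -/
def uK : (LaurentPolynomial KK)ˣ :=
  ⟨C zz⁻¹ * T (-1), C zz * T 1,
    by rw [mul_mul_mul_comm, ← map_mul, inv_mul_cancel₀ zz_ne_zero, ← T_add]; simp,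
    by rw [mul_mul_mul_comm, ← map_mul, mul_inv_cancel₀ zz_ne_zero, ← T_add]; simp⟩

theorem uK_zpow (n : ℤ) : ((uK ^ n : (LaurentPolynomial KK)ˣ) : LaurentPolynomial KK) =
    C (zz ^ (-n)) * T (-n) := by
  have e1 : (uK : LaurentPolynomial KK) = C zz⁻¹ * T (-1) := rfl
  have e2 : ((uK⁻¹ : (LaurentPolynomial KK)ˣ) : LaurentPolynomial KK) = C zz * T 1 := rfl
  induction n using Int.induction_on with
  | zero => simp
  | succ n ih =>
    rw [zpow_add_one, Units.val_mul, ih, e1, mul_mul_mul_comm, ← map_mul, ← T_add, neg_add,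
      zpow_add₀ zz_ne_zero, zpow_neg_one]
  | pred n ih =>
    rw [zpow_sub_one, Units.val_mul, ih, e2, mul_mul_mul_comm, ← map_mul, ← T_add]
    have h : -(-(n : ℤ) - 1) = -(-(n : ℤ)) + 1 := by ring
    rw [h, zpow_add₀ zz_ne_zero, zpow_one]

/-- The homomorphism `(E_C)_* → 𝔽₄((u₁))[T, T⁻¹]` with `u ↦ u₁ T⁻¹`. -/
def psi : Estar →+* LaurentPolynomial KK := eval₂ (C.comp redK) uK

theorem psi_C_mul_T (a : E0) (n : ℤ) : psi (C a * T n) = C (redK a * zz ^ (-n)) * T (-n) := by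
  rw [psi, eval₂_C_mul_T, uK_zpow, map_mul, mul_assoc]
  rfl

theorem psi_coeff (x : Estar) (t : ℤ) : (psi x).coeff t = redK (x.coeff (-t)) * zz ^ t := by
  induction x using LaurentPolynomial.induction_on' with
  | add p q hp hq =>
    rw [map_add, AddMonoidAlgebra.coeff_add, AddMonoidAlgebra.coeff_add, Finsupp.add_apply,
      Finsupp.add_apply, hp, hq, map_add, add_mul]
  | C_mul_T n a =>
    rw [psi_C_mul_T, ← single_eq_C_mul_T, ← single_eq_C_mul_T, AddMonoidAlgebra.coeff_single,
      AddMonoidAlgebra.coeff_single, Finsupp.single_apply, Finsupp.single_apply]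
    by_cases h : n = -t
    · subst h; simp
    · rw [if_neg (by omega), if_neg h, map_zero, zero_mul]

theorem two_LKK : (2 : LaurentPolynomial KK) = 0 := by
  rw [← map_ofNat (C : KK →+* LaurentPolynomial KK) 2, two_KK, map_zero]

/-- The induced homomorphism on `(E_C)_* V(0)`. -/
def psiV : EV0 →+* LaurentPolynomial KK := Ideal.Quotient.lift _ psi fun x hx => by
  obtain ⟨y, rfl⟩ := Ideal.mem_span_singleton.1 hx
  rw [map_mul, map_ofNat, two_LKK, zero_mul]

theorem psiV_red (x : Estar) : psiV (red W4 E0 x) = psi x := rfl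

theorem psiV_injective : Function.Injective psiV := by
  rw [injective_iff_map_eq_zero]
  intro x hx
  obtain ⟨x, rfl⟩ := red_surjective (k := W4) x
  rw [psiV_red] at hx
  rw [red_eq_zero_iff]
  have h : ∀ n, ∃ y : E0, x.coeff n = 2 * y := by
    intro n
    have h1 := psi_coeff x (-n)
    rw [hx, neg_neg] at h1
    have h2 : redK (x.coeff n) = 0 :=
      (mul_eq_zero.1 h1.symm).resolve_right (zpow_ne_zero _ zz_ne_zero)
    exact redS_eq_zero_iff.1 (HahnSeries.ofPowerSeries_injective (h2.trans (map_zero _).symm))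
  choose y hy using h
  refine ⟨AddMonoidAlgebra.ofCoeff (Finsupp.onFinset x.coeff.support y fun n hn => ?_), ?_⟩
  · rw [Finsupp.mem_support_iff, hy]
    intro h0
    exact hn (two_regular _ h0)
  · apply LaurentPolynomial.ext
    intro n
    have h2 : (2 : Estar) = C 2 := (map_ofNat _ _).symm
    rw [h2, ← smul_eq_C_mul, hy]
    simp

/-- The component of internal degree `2t`. -/
def comp (t : ℤ) : EV0 →+ KK where
  toFun x := (psiV x).coeff t
  map_zero' := by rw [map_zero]; rfl
  map_add' x y := by rw [map_add, AddMonoidAlgebra.coeff_add, Finsupp.add_apply]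

theorem comp_apply (t : ℤ) (x : EV0) : comp t x = (psiV x).coeff t := rfl

theorem comp_red (t : ℤ) (x : Estar) : comp t (red W4 E0 x) = redK (x.coeff (-t)) * zz ^ t :=
  psi_coeff x t

theorem comp_ext {x y : EV0} (h : ∀ t, comp t x = comp t y) : x = y :=
  psiV_injective (LaurentPolynomial.ext h)

/-- Together with `comp_nu` this identifies the component of internal degree `2t` with the whole of
`Mt t`. -/
theorem comp_mem (t : ℤ) (x : EV0) : comp t x ∈ Mt t := by
  obtain ⟨x, rfl⟩ := red_surjective (k := W4) x
  rw [comp_red, mul_comm]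
  exact mem_Mt_iff.2 ⟨_, rfl⟩

/-- The variable `T` is the image of `v₁`, hence fixed. The factor `lⁿ` that `uⁿ` acquires is the
one by which the group multiplies `z⁻ⁿ`. -/
theorem psi_actE (γ : G24) (x : Estar) (t : ℤ) :
    (psi (actionE W4 curveCU γ x)).coeff t = act γ ((psi x).coeff t) := by
  induction x using LaurentPolynomial.induction_on' with
  | add p q hp hq =>
    rw [map_add, map_add, map_add, AddMonoidAlgebra.coeff_add, AddMonoidAlgebra.coeff_add,
      Finsupp.add_apply, Finsupp.add_apply, hp, hq, map_add]
  | C_mul_T n a =>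
    change (psi (actE γ _)).coeff t = _
    rw [actE_C_mul_T, psi_C_mul_T, psi_C_mul_T, ← single_eq_C_mul_T, ← single_eq_C_mul_T,
      AddMonoidAlgebra.coeff_single, AddMonoidAlgebra.coeff_single, Finsupp.single_apply,
      Finsupp.single_apply]
    split_ifs with h
    · have h1 : redK ((γ.f.u ^ n : E0ˣ) : E0) = ((lbar γ : PowerSeries F4) : KK) ^ n := by
        have := map_zpow (Units.map redK.toMonoidHom) γ.f.u n
        have h2 := congrArg Units.val this
        rwa [Units.val_zpow_eq_zpow_val] at h2
      have h3 : ((↑(lbar γ)⁻¹ : PowerSeries F4) : KK) = (((lbar γ : PowerSeries F4) : KK))⁻¹ := by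
        refine eq_inv_of_mul_eq_one_left ?_
        rw [← map_mul, Units.inv_mul, map_one]
      rw [map_mul, map_mul, map_zpow₀, act_zz, redK_apply a, act_coe, actS_redS, h1, h3, mul_zpow,
        inv_zpow', neg_neg, redK_apply]
      ring
    · rw [map_zero]

theorem comp_action (γ : G24) (x : EV0) (t : ℤ) :
    comp t (actionModTwo W4 curveCU γ x) = act γ (comp t x) := by
  obtain ⟨x, rfl⟩ := red_surjective (k := W4) x
  exact psi_actE γ x t

theorem exists_nu (t : ℤ) {f : KK} (hf : f ∈ Mt t) :
    ∃ a : E0, psiV (red W4 E0 (C a * T (-t))) = C f * T t := by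
  obtain ⟨p, rfl⟩ := mem_Mt_iff.1 hf
  obtain ⟨a, rfl⟩ := redS_surjective p
  refine ⟨a, ?_⟩
  rw [psiV_red, psi_C_mul_T, neg_neg, mul_comm (zz ^ t), redK_apply]

/-- The homogeneous element with a given component. -/
def nu (t : ℤ) (f : KK) : EV0 :=
  open Classical in
  if hf : f ∈ Mt t then red W4 E0 (C (exists_nu t hf).choose * T (-t)) else 0

theorem psiV_nu {t : ℤ} {f : KK} (hf : f ∈ Mt t) : psiV (nu t f) = C f * T t := by
  rw [nu, dif_pos hf]
  exact (exists_nu t hf).choose_spec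

theorem comp_nu {t : ℤ} {f : KK} (hf : f ∈ Mt t) (s : ℤ) :
    comp s (nu t f) = if s = t then f else 0 := by
  rw [comp_apply, psiV_nu hf, ← single_eq_C_mul_T, AddMonoidAlgebra.coeff_single,
    Finsupp.single_apply]
  simp only [eq_comm]

theorem comp_nu_mul {s : ℤ} {f : KK} (hf : f ∈ Mt s) (x : EV0) (t : ℤ) :
    comp t (nu s f * x) = f * comp (t - s) x := by
  rw [comp_apply, comp_apply, map_mul, psiV_nu hf, ← single_eq_C_mul_T]
  exact AddMonoidAlgebra.coeff_single_mul_eq_mul_coeff _ fun m _ => by omega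

theorem comp_smul (w : W4) (x : EV0) (t : ℤ) :
    comp t (w • x) = WittVector.constantCoeff w • comp t x := by
  obtain ⟨x, rfl⟩ := red_surjective (k := W4) x
  rw [← map_smul, comp_red, comp_red]
  have h : (w • x).coeff (-t) = PowerSeries.C w * x.coeff (-t) := by
    have : w • x = PowerSeries.C w • x := by
      rw [Algebra.smul_def, Algebra.smul_def]
      rfl
    rw [this]; simp
  rw [h, map_mul, Algebra.smul_def, algebraMap_KK, redK_apply, redS_C, mul_assoc]

theorem two_EV0 : (2 : EV0) = 0 := psiV_injective (by rw [map_ofNat, two_LKK, map_zero])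

theorem neg_EV0 (x : EV0) : -x = x := by linear_combination -x * two_EV0

theorem neg_one_pow_smul (n : ℕ) (x : EV0) : (-1 : W4) ^ n • x = x := by
  induction n with
  | zero => rw [pow_zero, one_smul]
  | succ n ih => rw [pow_succ, mul_neg, mul_one, neg_smul, ih, neg_EV0]

theorem eq_sum_nu (F : Finset ℤ) (x : EV0) (h : ∀ t ∉ F, comp t x = 0) :
    x = ∑ t ∈ F, nu t (comp t x) := by
  apply comp_ext
  intro s
  rw [map_sum]
  simp only [comp_nu (comp_mem _ x)]
  rw [Finset.sum_ite_eq]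
  split_ifs with hs
  · rfl
  · exact h s hs

theorem v1_eq_nu : v1 = nu 1 1 := by
  apply psiV_injective
  rw [psiV_nu (by simpa using Mt_mono (show (0 : ℤ) ≤ 1 by norm_num) (zpow_mem_Mt 0)), v1, psiV_red,
    psi_C_mul_T, redK_apply, redS_X, ← zz_inv, neg_neg, zpow_one, inv_mul_cancel₀ zz_ne_zero]

/-- Multiplication by `v₁` is the inclusion of `Mt (t - 1)` in `Mt t`. -/
theorem comp_v1_mul (x : EV0) (t : ℤ) : comp t (v1 * x) = comp (t - 1) x := by
  rw [v1_eq_nu, comp_nu_mul (by simpa using Mt_mono (show (0 : ℤ) ≤ 1 by norm_num) (zpow_mem_Mt 0)),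
    one_mul]

theorem mem_gradedPiece {t : ℤ} {x : EV0} :
    x ∈ gradedPiece (2 * t) ↔ ∀ s ≠ t, comp s x = 0 := by
  constructor
  · intro hx s hs
    induction hx using Submodule.span_induction with
    | mem x hx =>
      obtain ⟨a, l, hl, rfl⟩ := hx
      rw [comp_apply, psiV_red, psi_C_mul_T, ← single_eq_C_mul_T, AddMonoidAlgebra.coeff_single,
        Finsupp.single_apply, if_neg (by omega)]
    | zero => exact map_zero _
    | add x y _ _ h1 h2 => rw [map_add, h1, h2, add_zero]
    | smul a x _ h => rw [comp_smul, h, smul_zero]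
  · intro h
    have h1 := eq_sum_nu {t} x fun s hs => h s (by simpa using hs)
    rw [Finset.sum_singleton, nu, dif_pos (comp_mem t x)] at h1
    rw [h1]
    exact Submodule.subset_span ⟨_, -t, by ring, rfl⟩

/-! ### Cochains -/

section

variable {n : ℕ}

/-- `n`-cochains with values in `(E_C)_* V(0)`. -/
abbrev ECoch (n : ℕ) : Type := (Fin n → G24) → EV0

/-- The coboundary of cochains with values in `(E_C)_* V(0)`. -/
abbrev dE (c : ECoch n) : ECoch (n + 1) := dCochain (actionModTwo W4 curveCU) c

theorem dE_apply (c : ECoch n) (g : Fin (n + 1) → G24) :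
    dE c g = actionModTwo W4 curveCU (g 0) (c (Fin.tail g)) +
      ∑ j : Fin (n + 1), c (Fin.contractNth j (· * ·) g) := by
  simp only [dE, dCochain, neg_one_pow_smul]

/-- The components of a cochain. -/
def compC (t : ℤ) (c : ECoch n) : KCoch n := fun g => comp t (c g)

theorem compC_mem (t : ℤ) (c : ECoch n) (g : Fin n → G24) : compC t c g ∈ Mt t := comp_mem t _

theorem compC_ext {c c' : ECoch n} (h : ∀ t, compC t c = compC t c') : c = c' :=
  funext fun g => comp_ext fun t => congrFun (h t) g

theorem compC_add (t : ℤ) (c c' : ECoch n) : compC t (c + c') = compC t c + compC t c' :=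
  funext fun g => map_add (comp t) (c g) (c' g)

theorem compC_zero (t : ℤ) : compC t (0 : ECoch n) = 0 := funext fun _ => map_zero _

theorem rho_zero (g : G24) (f : KK) : rho 0 g f = act g f := by
  rw [rho_apply, wt_zero, one_smul]

theorem compC_dE (t : ℤ) (c : ECoch n) : compC t (dE c) = cd (rho 0) (compC t c) := by
  funext g
  simp only [compC, dE_apply, cd, map_add, map_sum, comp_action, rho_zero]

/-- The homogeneous cochain with given component. -/
def nuC (t : ℤ) (c : KCoch n) : ECoch n := fun g => nu t (c g)

theorem compC_nuC {t : ℤ} {c : KCoch n} (hc : ∀ g, c g ∈ Mt t) (s : ℤ) :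
    compC s (nuC t c) = if s = t then c else 0 := by
  funext g
  rw [compC, nuC, comp_nu (hc g)]
  split_ifs <;> rfl

theorem dE_nuC {t : ℤ} {c : KCoch n} (hc : ∀ g, c g ∈ Mt t) :
    dE (nuC t c) = nuC t (cd (rho 0) c) := by
  apply compC_ext
  intro s
  rw [compC_dE, compC_nuC hc, compC_nuC (cd_mem rho_mem hc)]
  split_ifs
  · rfl
  · exact cd_zero _

theorem nuC_zero (t : ℤ) : nuC t (0 : KCoch n) = 0 := by
  apply compC_ext
  intro s
  rw [compC_nuC (c := 0) (fun _ => zero_mem _), compC_zero, ite_self]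

theorem nuC_add {t : ℤ} {c c' : KCoch n} (hc : ∀ g, c g ∈ Mt t) (hc' : ∀ g, c' g ∈ Mt t) :
    nuC t (c + c') = nuC t c + nuC t c' := by
  apply compC_ext
  intro s
  rw [compC_add, compC_nuC hc, compC_nuC hc', compC_nuC (c := c + c') fun g => add_mem (hc g) (hc' g)]
  split_ifs
  · rfl
  · rw [add_zero]

/-- The group is finite, so a cochain has only finitely many nonzero components. -/
theorem exists_eq_sum_nuC (c : ECoch n) : ∃ F : Finset ℤ, c = ∑ t ∈ F, nuC t (compC t c) := by
  classical
  refine ⟨Finset.univ.biUnion fun g => (psiV (c g)).coeff.support, ?_⟩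
  funext g
  rw [Finset.sum_apply]
  refine eq_sum_nu _ _ fun t ht => ?_
  by_contra h
  exact ht (Finset.mem_biUnion.2 ⟨g, Finset.mem_univ g, Finsupp.mem_support_iff.2 h⟩)

end

end EllCohomology
end

open CategoryTheory
noncomputable section
namespace EllCohomology

open WeierstrassCurve LaurentPolynomial

/-! ### Maps between cohomology groups, on cocycles -/

section

variable {n : ℕ}

/-- Cocycles with values in `(E_C)_* V(0)`. -/
abbrev ZE (n : ℕ) : Type := groupCohomology.cocycles (algRep (actionModTwo W4 curveCU)) n

/-- The cochain of a cocycle. -/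
abbrev cocE (z : ZE n) : ECoch n := coc (actionModTwo W4 curveCU) z

/-- The class of a cocycle. -/
abbrev cls (z : ZE n) : HG24 n := groupCohomology.π (algRep (actionModTwo W4 curveCU)) n z

theorem map_cocycles {G H : Type} [Group G] [Group H] {A : Rep.{0} W4 H} {B : Rep.{0} W4 G}
    (f : G →* H) (φ : Rep.res f A ⟶ B) (z : groupCohomology.cocycles A n) :
    groupCohomology.map f φ n (groupCohomology.π A n z) =
      groupCohomology.π B n (groupCohomology.cocyclesMap f φ n z) :=
  congrArg (fun F => F.hom z) (groupCohomology.π_map f φ n)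

theorem iCocycles_cocyclesMap {G H : Type} [Group G] [Group H] {A : Rep.{0} W4 H} {B : Rep.{0} W4 G}
    (f : G →* H) (φ : Rep.res f A ⟶ B) (z : groupCohomology.cocycles A n) :
    groupCohomology.iCocycles B n (groupCohomology.cocyclesMap f φ n z) =
      (groupCohomology.cochainsMap f φ).f n (groupCohomology.iCocycles A n z) :=
  congrArg (fun F => F.hom z) (HomologicalComplex.cyclesMap_i (groupCohomology.cochainsMap f φ) n)

theorem phi_cls (z : groupCohomology.cocycles (algRep (actionQuot W4 curveCU)) n) :
    ∃ w : ZE n, phi n (groupCohomology.π _ n z) = cls w ∧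
      cocE w = fun g => coc (actionQuot W4 curveCU) z (fun k => (g k : A4)) :=
  ⟨_, map_cocycles _ _ z, iCocycles_cocyclesMap _ _ z⟩

theorem mulMap_cls (m : EV0) (hm : ∀ g, actionModTwo W4 curveCU g m = m) (z : ZE n) :
    ∃ w : ZE n, mulMap (actionModTwo W4 curveCU) m hm n (cls z) = cls w ∧
      cocE w = fun g => m * cocE z g :=
  ⟨_, map_cocycles _ _ z, iCocycles_cocyclesMap _ _ z⟩

theorem exists_cocycle {c : ECoch n} (hc : dE c = 0) : ∃ z : ZE n, cocE z = c :=
  ⟨groupCohomology.cocyclesMk c hc, groupCohomology.iCocycles_mk _ _⟩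

/-- A class represented by an inflated cocycle is in the image of inflation. -/
theorem cls_mem_range {z : ZE n} (hz : Infl (cocE z)) : cls z ∈ LinearMap.range (phi n) := by
  have hd := d_iCocycles (actionModTwo W4 curveCU) z
  have key : ∀ g : Fin n → G24, cocE z (fun k => (g k : A4).out) = cocE z g :=
    fun g => hz _ _ fun k => Quotient.out_eq' _
  have hc : dCochain (actionQuot W4 curveCU) (fun x : Fin n → A4 => cocE z fun k => (x k).out) = 0 := by
    funext x
    obtain ⟨g, rfl⟩ : ∃ g : Fin (n + 1) → G24, x = fun k => (g k : A4) :=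
      ⟨fun k => (x k).out, funext fun k => (Quotient.out_eq' (x k)).symm⟩
    have h := congrFun hd g
    refine Eq.trans ?_ h
    simp only [dCochain]
    congr 1
    · change actionModTwo W4 curveCU (g 0) (cocE z fun k => (Fin.tail g k : A4).out) = _
      rw [key]
    · refine Finset.sum_congr rfl fun j _ => ?_
      congr 1
      refine Eq.trans ?_ (key _)
      congr 1
      funext k
      congr 1
      simp only [Fin.contractNth]
      split_ifs <;> rfl
  obtain ⟨w, h1, h2⟩ := phi_cls (groupCohomology.cocyclesMk (A := algRep (actionQuot W4 curveCU))
    (fun x : Fin n → A4 => cocE z fun k => (x k).out) hc)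
  refine ⟨_, h1.trans ?_⟩
  congr 1
  apply coc_injective
  refine h2.trans ?_
  funext g
  refine Eq.trans ?_ (key g)
  exact congrFun (groupCohomology.iCocycles_mk _ hc) fun k => (g k : A4)

/-! ### The class `h₁` -/

/-- The cocycle representing `h₁`. -/
def hE : ECoch 1 := nuC 1 fun g => hh (g 0)

/-- The difference `γ(v₁) - v₁` is `2x u⁻¹`, and the equation for `a₁` gives `x ≡ -s/l` modulo `2`.
Division by `u₁` turns this into `h`. -/
theorem bockstein_eq (γ : G24) : ∃ x : E0, (γ.φ PowerSeries.X * ((γ.f.u ^ (-1 : ℤ) : E0ˣ) : E0) -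
    PowerSeries.X = 2 * x) ∧ redK x * zz = hh γ := by
  set l : E0 := ((γ.f.u ^ (-1 : ℤ) : E0ˣ) : E0) with hl
  set D := γ.φ PowerSeries.X * l - PowerSeries.X with hD
  have hlu : (γ.f.u : E0) * l = 1 := by rw [hl, zpow_neg_one]; exact Units.mul_inv _
  have h1 := γ.eq_a₁
  have h3 : D = 2 * (-(γ.f.s * l) - D) := by
    rw [hD]
    linear_combination l * h1 + 3 * PowerSeries.X * hlu
  refine ⟨-(γ.f.s * l) - D, h3, ?_⟩
  have h4 : redK D = 0 := by
    have : redS D = 0 := redS_eq_zero_iff.2 ⟨_, h3⟩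
    rw [redK_apply, this, map_zero]
  have h5 : redK l = ((↑(lbar γ)⁻¹ : PowerSeries F4) : KK) := by
    rw [hl, zpow_neg_one]; rfl
  rw [map_sub, map_neg, map_mul, h4, h5, hh, redK_apply]
  linear_combination (-((redS γ.f.s : PowerSeries F4) : KK) *
    ((↑(lbar γ)⁻¹ : PowerSeries F4) : KK) * zz) * two_KK

theorem δ_zero_eq {G : Type} [Group G] {X : ShortComplex (Rep.{0} W4 G)} (hX : X.ShortExact)
    (z : X.X₃.ρ.invariants) (y : X.X₂) (hy : X.g.hom y = z) (x : G → X.X₁)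
    (hx : ∀ g, X.f.hom (x g) = X.X₂.ρ g y - y) : ∃ w : groupCohomology.cocycles X.X₁ 1,
      groupCohomology.δ hX 0 1 rfl ((groupCohomology.H0Iso X.X₃).inv z) =
        groupCohomology.π X.X₁ 1 w ∧
      (groupCohomology.iCocycles X.X₁ 1 w : (Fin 1 → G) → X.X₁) = fun g => x (g 0) := by
  have hxx : X.f.hom ∘ x = groupCohomology.d₀₁ X.X₂ y := funext hx
  refine ⟨_, groupCohomology.δ₀_apply hX z y hy x hxx, ?_⟩
  exact groupCohomology.isoCocycles₁_inv_comp_iCocycles_apply X.X₁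
    ⟨x, groupCohomology.mem_cocycles₁_of_comp_eq_d₀₁ hX hxx⟩

theorem bockstein_zero_eq {k R : Type} [CommRing k] [CommRing R] [Algebra k R]
    {U : WeierstrassCurve R} (hU : (bocksteinSeq k U).ShortExact) (c : HH (actionModTwo k U) 0) :
    bockstein hU 0 c = groupCohomology.map (MonoidHom.id _) (bocksteinSeq k U).g 1
      (groupCohomology.δ hU 0 1 rfl c) := rfl

theorem hE_eq {x : G24 → E0} (hx : ∀ γ, redK (x γ) * zz = hh γ) :
    (fun g : Fin 1 → G24 => red W4 E0 (C (x (g 0)) * T (-1))) = hE := by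
  apply compC_ext
  intro t
  rw [hE, compC_nuC fun g => hh_mem _]
  funext g
  rw [compC, comp_apply, psiV_red, psi_C_mul_T, neg_neg, zpow_one, hx, ← single_eq_C_mul_T,
    AddMonoidAlgebra.coeff_single, Finsupp.single_apply]
  by_cases h : t = 1
  · rw [if_pos h.symm, if_pos h]
  · rw [if_neg (Ne.symm h), if_neg h]
    rfl

theorem h1_eq : ∃ z : ZE 1, cls z = h1 ∧ cocE z = hE := by
  choose x hx hxh using bockstein_eq
  obtain ⟨w, hw1, hw2⟩ := δ_zero_eq bocksteinSeq_exact
    (⟨v1, v1_invariant⟩ : (bocksteinSeq W4 curveCU).X₃.ρ.invariants)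
    (C PowerSeries.X * T (-1) : Estar) rfl (fun g => (C (x g) * T (-1) : Estar)) fun g => by
      change 2 * (C (x g) * T (-1) : Estar) = actE g (C PowerSeries.X * T (-1)) -
        C PowerSeries.X * T (-1)
      rw [actE_C_mul_T, ← sub_mul, ← map_sub, hx, map_mul, map_ofNat, mul_assoc]
  have h2 : h1 = _ := bockstein_zero_eq bocksteinSeq_exact _
  rw [invClass] at h2
  have h3 := h2.trans ((congrArg _ hw1).trans (map_cocycles _ _ w))
  refine ⟨_, h3.symm, ?_⟩
  have h4 := iCocycles_cocyclesMap (MonoidHom.id _) (bocksteinSeq W4 curveCU).g w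
  rw [hw2] at h4
  exact h4.trans (hE_eq hxh)

end

end EllCohomology
end

open CategoryTheory
noncomputable section
namespace EllCohomology

open WeierstrassCurve LaurentPolynomial

/-! ### Surjectivity modulo `h₁` -/

section

variable {n : ℕ}

theorem dE_add (c c' : ECoch n) : dE (c + c') = dE c + dE c' :=
  compC_ext fun t => by rw [compC_dE, compC_add, cd_add, compC_add, compC_dE, compC_dE]

theorem dE_zero : dE (0 : ECoch n) = 0 :=
  compC_ext fun t => by rw [compC_dE, compC_zero, cd_zero, compC_zero]

/-- The product of two cochains, the first of degree one. -/
abbrev cupE (a : ECoch 1) (c : ECoch n) : ECoch (n + 1) := cupCochain (actionModTwo W4 curveCU) a c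

theorem cupE_add (a : ECoch 1) (c c' : ECoch n) : cupE a (c + c') = cupE a c + cupE a c' := by
  funext g
  simp only [cupE, cupCochain, Pi.add_apply, map_add, mul_add]

theorem cupE_zero (a : ECoch 1) : cupE a (0 : ECoch n) = 0 := by
  funext g
  simp only [cupE, cupCochain, Pi.zero_apply, map_zero, mul_zero]

theorem two_ECoch : (2 : ECoch n) = 0 := funext fun _ => two_EV0

/-- The product with `h₁` is the product with `h` one step higher in the filtration; this is why
`Good` bounds the factor of `h` by `r - 1`. -/
theorem cupE_hE_nuC {t s : ℤ} (hs : t = s + 1) {b : KCoch n} (hb : ∀ g, b g ∈ Mt s) :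
    cupE hE (nuC s b) = nuC t (cupD (HH1 0) b) := by
  apply compC_ext
  intro r
  rw [compC_nuC (c := cupD (HH1 0) b) fun g => HH1_mem hs _ (hb _)]
  funext g
  simp only [compC, cupE, cupCochain, hE, nuC]
  rw [comp_nu_mul (hh_mem _), comp_action, comp_nu (hb _)]
  by_cases h : r = t
  · rw [if_pos (by omega), if_pos h, cupD, HH1_apply, rho_zero]
  · rw [if_neg (by omega), if_neg h, map_zero, mul_zero]
    rfl

variable (n) in
/-- Sums of an inflated cocycle, a multiple of `h₁`, and a coboundary. -/
def GoodE : AddSubgroup (ECoch (n + 1)) where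
  carrier := {c | ∃ (a : ECoch (n + 1)) (b e : ECoch n), Infl a ∧ dE a = 0 ∧ dE b = 0 ∧
    c = a + cupE hE b + dE e}
  add_mem' := by
    rintro _ _ ⟨a, b, e, h1, h2, h3, rfl⟩ ⟨a', b', e', h1', h2', h3', rfl⟩
    refine ⟨a + a', b + b', e + e', fun g g' hg => by
      rw [Pi.add_apply, Pi.add_apply, h1 g g' hg, h1' g g' hg], by rw [dE_add, h2, h2', add_zero],
      by rw [dE_add, h3, h3', add_zero], ?_⟩
    rw [dE_add, cupE_add]
    ring
  zero_mem' := ⟨0, 0, 0, fun _ _ _ => rfl, dE_zero, dE_zero, by rw [dE_zero, cupE_zero]; ring⟩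
  neg_mem' := by
    intro c h
    rwa [show -c = c by linear_combination -c * two_ECoch]

theorem nuC_mem_GoodE {t : ℤ} {c : KCoch (n + 1)} (hc : c ∈ Good n 0 t) : nuC t c ∈ GoodE n := by
  obtain ⟨a, b, e, h1, h2, h3, h4, h5, h6, rfl⟩ := hc
  have hb : ∀ g, cupD (HH1 0) b g ∈ Mt t := fun g => HH1_mem (by ring) _ (h5 _)
  refine ⟨nuC t a, nuC (t - 1) b, nuC t e, h1.comp _, by rw [dE_nuC h3, h2, nuC_zero],
    by rw [dE_nuC h5, h4, nuC_zero], ?_⟩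
  rw [cupE_hE_nuC (by ring) h5, dE_nuC h6, ← nuC_add h3 hb,
    ← nuC_add (c := a + cupD (HH1 0) b) (fun g => add_mem (h3 g) (hb g)) (cd_mem rho_mem h6)]

theorem dE_cocE (z : ZE n) : dE (cocE z) = 0 := d_iCocycles (actionModTwo W4 curveCU) z

theorem cocE_add (z w : ZE n) : cocE (z + w) = cocE z + cocE w :=
  map_add (groupCohomology.iCocycles (algRep (actionModTwo W4 curveCU)) n).hom _ _

theorem cocE_cupCocycle (α : ZE 1) (z : ZE n) :
    cocE (cupCocycle (actionModTwo W4 curveCU) α z) = cupE (cocE α) (cocE z) :=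
  coc_cupCocycle _ α z

theorem cls_eq_iff {z w : ZE (n + 1)} : cls z = cls w ↔ ∃ b, cocE z = cocE w + dE b :=
  π_eq_succ _

theorem cocE_mem_GoodE (hn : n ≤ 2) (z : ZE (n + 1)) : cocE z ∈ GoodE n := by
  obtain ⟨F, hF⟩ := exists_eq_sum_nuC (cocE z)
  rw [hF]
  refine sum_mem fun t _ => nuC_mem_GoodE (cocycle_mem_Good hn t ?_ (compC_mem t _))
  rw [← compC_dE, dE_cocE, compC_zero]

theorem cls_mem_sup (hn : n ≤ 2) (c : HG24 (n + 1)) :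
    c ∈ LinearMap.range (phi (n + 1)) ⊔ h1Ideal (n + 1) := by
  obtain ⟨z, rfl⟩ := exists_rep _ c
  obtain ⟨a, b, e, h1, h2, h3, h⟩ := cocE_mem_GoodE hn z
  obtain ⟨za, rfl⟩ := exists_cocycle h2
  obtain ⟨zb, rfl⟩ := exists_cocycle h3
  obtain ⟨zh, hzh, hzE⟩ := h1_eq
  have key : cls z = cls za + cupG EllCohomology.h1 (cls zb) := by
    rw [← hzh, cupG, cup_π, ← map_add]
    exact cls_eq_iff.2 ⟨e, by rw [h, cocE_add, cocE_cupCocycle, hzE]⟩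
  change cls z ∈ _
  rw [key]
  exact Submodule.add_mem_sup (cls_mem_range h1) (Submodule.subset_span ⟨_, rfl⟩)

/-- In degree zero there are no coboundaries, and every cochain is inflated for lack of arguments.
-/
theorem phi_zero_bijective : Function.Bijective (phi 0) := by
  constructor
  · intro c c' h
    obtain ⟨z, rfl⟩ := exists_rep _ c
    obtain ⟨z', rfl⟩ := exists_rep _ c'
    obtain ⟨w, hw, e⟩ := phi_cls z
    obtain ⟨w', hw', e'⟩ := phi_cls z'
    rw [hw, hw'] at h
    rw [π_injective_zero _ h, e'] at e
    congr 1
    apply coc_injective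
    funext x
    have := congrFun e ![]
    rw [Subsingleton.elim x fun k => ((![] : Fin 0 → G24) k : A4)]
    exact this.symm
  · intro c
    obtain ⟨z, rfl⟩ := exists_rep _ c
    exact cls_mem_range (Infl.of_zero _)

theorem mkQ_comp_phi_surjective : ∀ n ≤ 3, Function.Surjective ((h1Ideal n).mkQ ∘ₗ phi n) := by
  intro n hn
  cases n with
  | zero =>
    exact ((h1Ideal 0).mkQ_surjective).comp phi_zero_bijective.2
  | succ n =>
    intro q
    obtain ⟨c, rfl⟩ := (h1Ideal (n + 1)).mkQ_surjective q
    obtain ⟨_, ⟨a, rfl⟩, y, hy, rfl⟩ := Submodule.mem_sup.1 (cls_mem_sup (by omega) c)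
    refine ⟨a, ?_⟩
    rw [map_add, (Submodule.mkQ_apply _ y).trans ((Submodule.Quotient.mk_eq_zero _).2 hy), add_zero]
    rfl

end

end EllCohomology
end

open CategoryTheory
noncomputable section
namespace EllCohomology

open WeierstrassCurve LaurentPolynomial

/-! ### Inflated classes -/

section

variable {n : ℕ}

/-- Classes represented by inflated cocycles. -/
def InflClass (c : HG24 n) : Prop := ∃ z : ZE n, Infl (cocE z) ∧ cls z = c

theorem InflClass.mem_range {c : HG24 n} (h : InflClass c) : c ∈ LinearMap.range (phi n) := by
  obtain ⟨z, hz, rfl⟩ := h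
  exact cls_mem_range hz

theorem InflClass.mulMap {c : HG24 n} (h : InflClass c) (m : EV0)
    (hm : ∀ g, actionModTwo W4 curveCU g m = m) :
    InflClass (mulMap (actionModTwo W4 curveCU) m hm n c) := by
  obtain ⟨z, hz, rfl⟩ := h
  obtain ⟨w, hw, e⟩ := mulMap_cls m hm z
  exact ⟨w, by rw [e]; exact hz.comp _, hw.symm⟩

theorem actionModTwo_eq_of_mk {g g' : G24} (h : (g : A4) = g') :
    actionModTwo W4 curveCU g = actionModTwo W4 curveCU g' :=
  congrArg (actionQuot W4 curveCU) h

theorem InflClass.cup {a : HG24 1} {c : HG24 n} (ha : InflClass a) (hc : InflClass c) :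
    InflClass (cupG a c) := by
  obtain ⟨x, hx, rfl⟩ := ha
  obtain ⟨z, hz, rfl⟩ := hc
  refine ⟨cupCocycle (actionModTwo W4 curveCU) x z, ?_, (cup_π _ x z).symm⟩
  rw [cocE_cupCocycle]
  intro g g' hg
  simp only [cupE, cupCochain]
  rw [hx (fun _ => g 0) (fun _ => g' 0) fun _ => hg 0, actionModTwo_eq_of_mk (hg 0),
    hz (Fin.tail g) (Fin.tail g') fun k => hg k.succ]

theorem cocE_smul (w : W4) (z : ZE n) : cocE (w • z) = w • cocE z :=
  map_smul (groupCohomology.iCocycles (algRep (actionModTwo W4 curveCU)) n).hom w z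

theorem InflClass.smul {c : HG24 n} (h : InflClass c) (w : W4) : InflClass (w • c) := by
  obtain ⟨z, hz, rfl⟩ := h
  refine ⟨w • z, ?_, map_smul (groupCohomology.π (algRep (actionModTwo W4 curveCU)) n).hom w z⟩
  rw [cocE_smul]
  exact hz.comp fun x => w • x

/-! ### Torsion classes -/

theorem v1Mul_pow_cls (e : ℕ) (z : ZE 1) :
    ∃ w : ZE 1, (v1Mul 1 ^ e) (cls z) = cls w ∧ cocE w = fun g => v1 ^ e * cocE z g := by
  induction e with
  | zero => exact ⟨z, rfl, by simp⟩
  | succ e ih =>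
    obtain ⟨w, hw, h⟩ := ih
    obtain ⟨w', hw', h'⟩ := mulMap_cls v1 v1_invariant w
    refine ⟨w', ?_, ?_⟩
    · rw [pow_succ', Module.End.mul_apply, hw]
      exact hw'
    · rw [h', h]
      funext g
      ring

theorem comp_v1_pow_mul (e : ℕ) (x : EV0) (t : ℤ) : comp t (v1 ^ e * x) = comp (t - e) x := by
  induction e generalizing t with
  | zero => simp
  | succ e ih =>
    rw [pow_succ', mul_assoc, comp_v1_mul, ih]
    congr 1
    push_cast
    ring_nf

/-- The 0-cochain `zᵏ`. -/
def zpowC (k : ℕ) : KCoch 0 := fun _ => zz ^ k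

theorem comp_smulC (w : W4) (c : ECoch n) (t : ℤ) :
    compC t (w • c) = WittVector.constantCoeff w • compC t c :=
  funext fun g => comp_smul w (c g) t

theorem cls_zero_iff {z : ZE (n + 1)} : cls z = 0 ↔ ∃ b, cocE z = dE b := by
  have h0 : cocE (0 : ZE (n + 1)) = 0 :=
    map_zero (groupCohomology.iCocycles (algRep (actionModTwo W4 curveCU)) (n + 1)).hom
  have h1 : cls (0 : ZE (n + 1)) = 0 := map_zero _
  rw [← h1, cls_eq_iff, h0]
  simp only [zero_add]

theorem cd_smul {G V : Type} [Group G] [AddCommGroup V] [Module F4 V] (ρ : Representation F4 G V)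
    (a : F4) (f : (Fin n → G) → V) : cd ρ (a • f) = a • cd ρ f := by
  funext g
  simp only [cd, Pi.smul_apply, map_smul, smul_add, Finset.smul_sum]

/-- The class of the coboundary of `zᵏ` in degree `2t` generates the classes of degree `2t`
annihilated by `v₁ᵉ`. -/
theorem isTorsionGenerator_of {t : ℤ} {e k : ℕ} (hk : (k : ℤ) = t + e)
    (h1 : ∀ g, cd (rho 0) (zpowC k) g ∈ Mt t)
    (h2 : ∀ m ∈ Mt k, (∀ g, act g m + m ∈ Mt t) → m - qc k m • zz ^ k ∈ Mt t)
    (h3 : ∀ m ∈ Mt k, (∀ g, act g m = m) → qc k m = 0) (ht : t < k) :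
    ∃ c : HG24 1, InflClass c ∧ IsTorsionGenerator (2 * t) e c := by
  -- The generator is the coboundary of `zᵏ`, taken in `Mt t`, where `zᵏ` itself does not live.
  have hd : dE (nuC t (cd (rho 0) (zpowC k))) = 0 := by
    rw [dE_nuC h1, cd_cd, nuC_zero]
  obtain ⟨z0, hz0⟩ := exists_cocycle hd
  have hzm : ∀ g, zpowC k g ∈ Mt k := fun _ => pow_mem_Mt k
  refine ⟨cls z0, ⟨z0, ?_, rfl⟩, ?_, fun c' => ⟨?_, ?_⟩⟩
  · rw [hz0]
    exact Infl.comp (Infl.cd (fun _ _ => rho_eq_of_mk) (Infl.of_zero _)) _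
  · intro h0
    obtain ⟨b, hb⟩ := cls_zero_iff.1 h0
    have h4 := congrArg (compC t) hb
    rw [hz0, compC_nuC h1, if_pos rfl, compC_dE] at h4
    set m := compC t b ![] with hm
    have hmt : m ∈ Mt t := compC_mem t b _
    -- If the class were zero, `zᵏ + m` with `m ∈ Mt t` would be an invariant with leading term
    -- `zᵏ`.
    have h5 := h3 (zz ^ k + m) (add_mem (pow_mem_Mt k) (Mt_mono ht.le hmt)) fun g => by
      have h6 := congrFun h4 ![g]
      rw [cd_zero_cochain, cd_zero_cochain, ← hm] at h6
      simp only [rho_zero, zpowC, Matrix.cons_val_zero] at h6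
      rw [map_add]
      linear_combination h6 + (act g m - zz ^ k) * two_KK
    rw [map_add, qc_of_mem hmt ht, qc_pow, if_pos rfl, add_zero] at h5
    exact one_ne_zero h5
  · rintro ⟨⟨z, rfl, hz⟩, hv⟩
    obtain ⟨w, hw, hwc⟩ := v1Mul_pow_cls e z
    have hv' : cls w = 0 := hw.symm.trans hv
    obtain ⟨b, hb⟩ := cls_zero_iff.1 hv'
    -- Multiplication by `v₁ᵉ` changes the degree but not the Laurent series, so a class killed by
    -- it is the coboundary of some `m ∈ Mt k`.
    have h4 : compC t (cocE z) = cd (rho 0) (compC k b) := by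
      rw [← compC_dE, ← hb, hwc]
      funext g
      rw [compC, compC, comp_v1_pow_mul, show (k : ℤ) - e = t by omega]
    set m := compC k b ![] with hm
    have h5 := h2 m (compC_mem k b _) fun g => by
      have h6 := congrFun h4 ![g]
      rw [cd_zero_cochain, ← hm] at h6
      simp only [rho_zero, Matrix.cons_val_zero] at h6
      rw [← h6]
      exact compC_mem t _ _
    have hMt : ∀ g, (fun _ => m - qc k m • zz ^ k : KCoch 0) g ∈ Mt t := fun _ => h5
    have h7 : compC k b = qc k m • zpowC k + fun _ => m - qc k m • zz ^ k := by
      funext x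
      rw [Subsingleton.elim x ![], ← hm]
      simp only [Pi.add_apply, Pi.smul_apply, zpowC]
      ring
    -- Modulo `Mt t` the series `m` is a multiple of `zᵏ`, and the scalar is lifted from `𝔽₄` to
    -- `𝕎`.
    refine ⟨WittVector.teichmuller 2 (qc k m), ?_⟩
    refine Eq.trans ?_ (map_smul (groupCohomology.π (algRep (actionModTwo W4 curveCU)) 1).hom
      (WittVector.teichmuller 2 (qc k m)) z0)
    refine cls_eq_iff.2 ⟨nuC t fun _ => m - qc k m • zz ^ k, ?_⟩
    apply compC_ext
    intro s
    rw [cocE_smul, hz0, compC_add, comp_smulC, compC_nuC h1, compC_dE, compC_nuC hMt]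
    by_cases hs : s = t
    · subst hs
      rw [if_pos rfl, if_pos rfl, h4, h7, cd_add, cd_smul]
      congr 2
    · rw [if_neg hs, if_neg hs, cd_zero, smul_zero, add_zero]
      exact funext fun g => mem_gradedPiece.1 (hz g) s hs
  · rintro ⟨w, rfl⟩
    refine ⟨⟨w • z0, map_smul (groupCohomology.π (algRep (actionModTwo W4 curveCU)) 1).hom w z0,
      fun g => ?_⟩, ?_⟩
    · change cocE (w • z0) g ∈ _
      rw [cocE_smul, hz0, mem_gradedPiece]
      intro s hs
      rw [Pi.smul_apply, comp_smul]
      have := congrFun (compC_nuC h1 s) g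
      rw [if_neg hs] at this
      refine (congrArg _ this).trans (smul_zero _)
    · rw [map_smul]
      obtain ⟨w', hw', hwc⟩ := v1Mul_pow_cls e z0
      have h0 : cls w' = 0 := by
        -- After multiplication by `v₁ᵉ` the series `zᵏ` is an admissible bounding cochain.
        refine cls_zero_iff.2 ⟨nuC k (zpowC k), ?_⟩
        rw [dE_nuC hzm, hwc, hz0]
        apply compC_ext
        intro s
        rw [compC_nuC (cd_mem rho_mem hzm)]
        funext g
        rw [compC, comp_v1_pow_mul]
        refine (congrFun (compC_nuC h1 (s - e)) g).trans ?_
        by_cases hs : s = k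
        · rw [if_pos hs, if_pos (by omega)]
        · rw [if_neg hs, if_neg (by omega)]
      rw [hw', h0, smul_zero]

theorem IsTorsionGenerator.inflClass {t : ℤ} {e : ℕ} {c c0 : HG24 1}
    (hc : IsTorsionGenerator t e c) (h0 : InflClass c0) (hc0 : IsTorsionGenerator t e c0) :
    InflClass c := by
  obtain ⟨w, rfl⟩ := (hc0.2 c).1 ((hc.2 c).2 ⟨1, (one_smul _ c).symm⟩)
  exact h0.smul w

/-! ### Explicit torsion generators: the coboundaries of `z³`, `z⁹` and `z⁶` -/

theorem act_zz_pow {j : ℕ} (g : G24) :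
    act g (zz ^ (3 * j)) = (zz + algebraMap F4 KK (sg g)) ^ (3 * j) := by
  rw [pow_mul, map_pow, act_zz_cube, pow_mul]

theorem qc_eq_zero_of_invariant {k : ℕ} (q : ℤ) (hq : 4 * q < k) (hk : (k : ℤ) ≤ 4 * q + 3) {m : KK}
    (hm : m ∈ Mt k) (h : ∀ g, act g m = m) : qc k m = 0 :=
  qc_of_mem (mem_of_invariant (i := 0) q (Mt_mono hk hm) fun g => by rw [rho_zero, h]) hq

theorem smul_pow_mem {r : ℕ} {t : ℤ} (h : (r : ℤ) ≤ t) (a : KK) (ha : a ∈ Mt 0) :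
    a * zz ^ r ∈ Mt t := by
  have := mul_mem_Mt ha (pow_mem_Mt r)
  rw [zero_add] at this
  exact Mt_mono h this

theorem sub_qc_mem {k : ℕ} {t : ℤ} (ht : t = k - 1) {m : KK} (hm : m ∈ Mt k) :
    m - qc k m • zz ^ k ∈ Mt t := by
  rw [ht, ← zpow_natCast]
  exact sub_lead_mem hm

theorem exists_generator_four : ∃ c : HG24 1, InflClass c ∧ IsTorsionGenerator 4 1 c := by
  refine isTorsionGenerator_of (t := 2) (k := 3) (by norm_num) (fun g => ?_) (fun m hm _ => ?_)
    (fun m hm h => qc_eq_zero_of_invariant 0 (by norm_num) (by norm_num) hm h) (by norm_num)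
  · rw [cd_zero_cochain, rho_zero, zpowC, act_zz_cube]
    set s := algebraMap F4 KK (sg (g 0)) with hs
    have hsm : s ∈ Mt 0 := algebraMap_mem_Mt _
    have h : (zz + s) ^ 3 + zz ^ 3 = s * zz ^ 2 + s ^ 2 * zz ^ 1 + s ^ 3 * zz ^ 0 := by
      linear_combination (zz ^ 3 + zz ^ 2 * s + zz * s ^ 2) * two_KK
    rw [h]
    refine add_mem (add_mem (smul_pow_mem (by norm_num) _ hsm)
      (smul_pow_mem (by norm_num) _ ?_)) (smul_pow_mem (by norm_num) _ ?_) <;>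
      rw [hs, ← map_pow] <;> exact algebraMap_mem_Mt _
  · exact sub_qc_mem (by norm_num) hm

theorem exists_generator_sixteen : ∃ c : HG24 1, InflClass c ∧ IsTorsionGenerator 16 1 c := by
  refine isTorsionGenerator_of (t := 8) (k := 9) (by norm_num) (fun g => ?_) (fun m hm _ => ?_)
    (fun m hm h => qc_eq_zero_of_invariant 2 (by norm_num) (by norm_num) hm h) (by norm_num)
  · rw [cd_zero_cochain, rho_zero, zpowC, act_zz_pow (j := 3)]
    set s := algebraMap F4 KK (sg (g 0)) with hs
    have hsm : s ∈ Mt 0 := algebraMap_mem_Mt _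
    have h : (zz + s) ^ 9 + zz ^ 9 = s * zz ^ 8 + s ^ 8 * zz ^ 1 + s ^ 9 * zz ^ 0 := by
      linear_combination (zz ^ 9 + 4 * zz ^ 8 * s + 18 * zz ^ 7 * s ^ 2 + 42 * zz ^ 6 * s ^ 3 +
        63 * zz ^ 5 * s ^ 4 + 63 * zz ^ 4 * s ^ 5 + 42 * zz ^ 3 * s ^ 6 + 18 * zz ^ 2 * s ^ 7 +
        4 * zz * s ^ 8) * two_KK
    change (zz + s) ^ 9 + zz ^ 9 ∈ Mt 8
    rw [h]
    refine add_mem (add_mem (smul_pow_mem (by norm_num) _ hsm)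
      (smul_pow_mem (by norm_num) _ ?_)) (smul_pow_mem (by norm_num) _ ?_) <;>
      rw [hs, ← map_pow] <;> exact algebraMap_mem_Mt _
  · exact sub_qc_mem (by norm_num) hm

theorem exists_rotation_coords : ∃ g : G24, (ll g : F4) = ω ∧ sg g = 0 := by
  obtain ⟨g, h1, h2, -⟩ := coords_surjective (Units.mk0 ω ω_ne_zero) (s := 0) (t := 0) (by ring)
  exact ⟨g, by rw [h1]; rfl, h2⟩

/-- In characteristic two `(z + s)⁶ = (z² + s²)³` has no term in `z⁵`, so the coboundary of `z⁶`
drops by two filtration steps. -/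
theorem exists_generator_eight : ∃ c : HG24 1, InflClass c ∧ IsTorsionGenerator 8 2 c := by
  have hd : ∀ g, act g (zz ^ 6) + zz ^ 6 ∈ Mt 4 := by
    intro g
    rw [show 6 = 3 * 2 from rfl, act_zz_pow (j := 2)]
    set s := algebraMap F4 KK (sg g) with hs
    have h : (zz + s) ^ 6 + zz ^ 6 = s ^ 2 * zz ^ 4 + s ^ 4 * zz ^ 2 + s ^ 6 * zz ^ 0 := by
      linear_combination (zz ^ 6 + 3 * zz ^ 5 * s + 7 * zz ^ 4 * s ^ 2 + 10 * zz ^ 3 * s ^ 3 +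
        7 * zz ^ 2 * s ^ 4 + 3 * zz * s ^ 5) * two_KK
    change (zz + s) ^ 6 + zz ^ 6 ∈ Mt 4
    rw [h]
    refine add_mem (add_mem (smul_pow_mem (by norm_num) _ ?_)
      (smul_pow_mem (by norm_num) _ ?_)) (smul_pow_mem (by norm_num) _ ?_) <;>
      rw [hs, ← map_pow] <;> exact algebraMap_mem_Mt _
  refine isTorsionGenerator_of (t := 4) (k := 6) (by norm_num) (fun g => ?_) (fun m hm hg => ?_)
    (fun m hm h => qc_eq_zero_of_invariant 1 (by norm_num) (by norm_num) hm h) (by norm_num)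
  · rw [cd_zero_cochain, rho_zero]
    exact hd _
  · set m' := m - qc 6 m • zz ^ 6 with hm'
    have h5 : m' ∈ Mt 5 := sub_qc_mem (k := 6) (by norm_num) hm
    -- The quotient of `Mt 6` by `Mt 4` also contains `z⁵`, but the rotation multiplies it by `ω⁻⁵ =
    -- ω ≠ 1`, so it cannot occur in `m`.
    obtain ⟨g, hl, hs⟩ := exists_rotation_coords
    have h6 : act g m' + m' ∈ Mt 4 := by
      have e : act g m' + m' = (act g m + m) - qc 6 m • (act g (zz ^ 6) + zz ^ 6) := by
        rw [hm', map_sub, map_smul, smul_add]; ring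
      rw [e]
      exact sub_mem (hg g) ((Mt 4).smul_mem _ (hd g))
    obtain ⟨f, hf, hf'⟩ : ∃ f ∈ Mt 4, m' = qc 5 m' • zz ^ 5 + f :=
      ⟨m' - qc 5 m' • zz ^ 5, sub_qc_mem (k := 5) (by norm_num) h5, by ring⟩
    have hact : act g (zz ^ 5) = ω • zz ^ 5 := by
      rw [map_pow, act_z', hs, mul_zero, map_zero, add_zero, ll_inv, hl, smul_pow, ← pow_mul]
      congr 1
      linear_combination (ω ^ 7 + ω ^ 4 + ω) * F4_pow_three ω_ne_zero
    have h7 : qc 5 (act g m' + m') = (ω + 1) * qc 5 m' := by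
      have e : act g m' + m' = (qc 5 m' * ω) • zz ^ 5 + (act g f + m') := by
        conv_lhs => rw [hf', map_add, map_smul, hact, smul_smul]
        rw [← hf']
        ring
      rw [e, map_add, map_add, map_smul, qc_of_mem (act_mem hf) (by norm_num), qc_pow,
        if_pos (by norm_num), smul_eq_mul]
      ring
    rw [qc_of_mem h6 (by norm_num)] at h7
    have h8 : qc 5 m' = 0 := (mul_eq_zero.1 h7.symm).resolve_left fun h =>
      ω_ne_one (by linear_combination h - two_F4)
    exact mem_Mt_of_qc h5 h8 (by norm_num)

end

end EllCohomology
end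

theorem mainTheorem7 :
    Set.BijOn (fun γ : G24 => γ.f.map residue) Set.univ (AutC : Set _) ∧
    (∀ n ≤ 3, Function.Surjective ((h1Ideal n).mkQ ∘ₗ phi n)) ∧
    Function.Bijective (phi 0) ∧
    (∃ h2 x y : HG24 1,
      IsTorsionGenerator 4 1 h2 ∧ IsTorsionGenerator 8 2 x ∧ IsTorsionGenerator 16 1 y) ∧
    ∀ h2 x y : HG24 1,
      IsTorsionGenerator 4 1 h2 → IsTorsionGenerator 8 2 x → IsTorsionGenerator 16 1 y →
      ∀ m : ℤ,
        DeltaMul m 1 h2 ∈ LinearMap.range (phi 1) ∧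
        DeltaMul m 2 (cupG h2 h2) ∈ LinearMap.range (phi 2) ∧
        DeltaMul m 3 (cupG h2 (cupG h2 h2)) ∈ LinearMap.range (phi 3) ∧
        DeltaMul m 1 x ∈ LinearMap.range (phi 1) ∧
        DeltaMul m 1 (v1Mul 1 x) ∈ LinearMap.range (phi 1) ∧
        DeltaMul m 2 (cupG x x) ∈ LinearMap.range (phi 2) ∧
        DeltaMul m 2 (v1Mul 2 (cupG x x)) ∈ LinearMap.range (phi 2) ∧
        DeltaMul m 1 y ∈ LinearMap.range (phi 1) ∧
        DeltaMul m 2 (cupG h2 y) ∈ LinearMap.range (phi 2) ∧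
        DeltaMul m 3 (cupG h2 (cupG h2 y)) ∈ LinearMap.range (phi 3) := by
  obtain ⟨c4, i4, g4⟩ := exists_generator_four
  obtain ⟨c8, i8, g8⟩ := exists_generator_eight
  obtain ⟨c16, i16, g16⟩ := exists_generator_sixteen
  refine ⟨reduction_bijOn, mkQ_comp_phi_surjective, phi_zero_bijective, ⟨c4, c8, c16, g4, g8, g16⟩,
    fun h2 x y hh2 hx hy m => ?_⟩
  -- The given generators are scalar multiples of the explicit inflated ones.
  have ih := hh2.inflClass i4 g4
  have ix := hx.inflClass i8 g8
  have iy := hy.inflClass i16 g16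
  have hv : ∀ {n : ℕ} {c : HG24 n}, InflClass c → InflClass (v1Mul n c) := fun hc => hc.mulMap _ _
  have hD : ∀ {n : ℕ} {c : HG24 n}, InflClass c → DeltaMul m n c ∈ LinearMap.range (phi n) :=
    fun hc => (hc.mulMap _ _).mem_range
  exact ⟨hD ih, hD (ih.cup ih), hD (ih.cup (ih.cup ih)), hD ix, hD (hv ix), hD (ix.cup ix),
    hD (hv (ix.cup ix)), hD iy, hD (ih.cup iy), hD (ih.cup (ih.cup iy))⟩
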